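/- For an advice function $\beta:\mathbb N\to\{0,1\}^*$ and a language $L\subseteq\{0,1\}^*$, write $L\in\mathrm{P}/\beta$ if there is a Turing machine $M$ such that for every $x\in\{0,1\}^*$, $M$ on input $(x,\beta(|x|))$ decides whether $x\in L$ in time polynomial in $|x|$. Write $L\in\mathrm{BPP}/\beta$ if there is a probabilistic Turing machine that, on every input $(x,\beta(|x|))$, always halts in time polynomial in $|x|$ and decides correctly whether $x\in L$ with probability at least $2/3$. For a function $f:\{0\}^*\to\{0,1\}^*$ write $f\in\mathrm{EXP}/\beta$ if there is a Turing machine that for every $n$, on input $(0^n,\beta(n))$, outputs $f(0^n)$ in time $2^{n^{O(1)}}$. In all cases nothing is required of the machine on advice other than $\beta(|x|)$. For $\ell:\mathbb N\to\mathbb N$, $\mathcal C/\ell$ is the union of the classes $\mathcal C/\beta$ over all $\beta$ with $|\beta(n)|\le \ell(n)$ for all $n$; $\mathrm{BPP}/O(n\log n)$ is the union of the classes $\mathrm{BPP}/\ell$ over all $\ell$ with $\ell(n)=O(n\log n)$ as $n\to\infty$. The length bound $n-c\log n$ stands for $\ell(n)=\max(0,\lfloor n-c\log_2 n\rfloor)$,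 with $\ell(0)=0$. A function $f:\{0\}^*\to\{0,1\}^*$ is in $\mathrm{i.o.}\text{-}\mathcal C$ if there is $g\in\mathcal C$ with $f(0^n)=g(0^n)$ for infinitely many $n$. $\mathrm{EXP}$ is the class of languages decidable in time $2^{n^{O(1)}}$. **Theorem.** Let $\alpha:\{0\}^*\to\{0,1\}^*$ be a length-preserving function (that is, $|\alpha(0^n)|=n$ for all $n$) and let $c>0$ be a constant. Suppose that $\alpha\notin \mathrm{i.o.}\text{-}\mathrm{EXP}/(n-c\log n)$. Then for every $A\in\mathrm{EXP}$: if $A\in\mathrm{P}/\alpha(0^{n^d})$ for some positive integer $d$ (that is, $A\in \mathrm P/\beta$ with $\beta(n)=\alpha(0^{n^d})$), then $A\in\mathrm{BPP}/O(n\log n)$. -/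

import Mathlib

/-! Time-bounded computation with advice, over Mathlib's multi-stack Turing machines. -/

namespace AdviceComplexity

open Turing Filter Asymptotics

/-- A Turing machine with finite control whose input alphabet is `{0, 1, separator}`
(the separator is `none`) and whose output alphabet is `{0, 1}`. -/
abbrev Machine : Type 1 := TM2ComputableAux (Option Bool) Bool

/-- A tuple of binary strings written on the input tape,
each string being followed by a separator. -/
def encodeInput (ws : List (List Bool)) : List (Option Bool) :=
  ws.flatMap fun w => w.map some ++ [none]

/-- On the input tuple `ws` the machine `M` halts after at most `t` steps
with output `y`. -/
def OutputsWithin (M : Machine) (ws : List (List Bool)) (y : List Bool) (t : ℕ) : Prop :=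
  Nonempty (TM2OutputsInTime M.tm ((encodeInput ws).map M.inputAlphabet.symm)
    (some (y.map M.outputAlphabet.symm)) t)

/-- The bound `n ^ k + k`; a function `ℕ → ℕ` is polynomially bounded iff
it is below one of these. -/
def polyBound (k n : ℕ) : ℕ := n ^ k + k

open Classical in
/-- The characteristic function of a language, as a one-bit string. -/
noncomputable def answer (L : Language Bool) (x : List Bool) : List Bool :=
  [decide (x ∈ L)]

/-- `EXP`: the languages decided in time `2 ^ poly(|x|)`. -/
def EXP : Set (Language Bool) :=
  {L | ∃ (M : Machine) (k : ℕ), ∀ x : List Bool,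
    OutputsWithin M [x] (answer L x) (2 ^ polyBound k x.length)}

/-- `P/β` for an advice function `β`: the languages `L` for which some machine, on every
input `(x, β(|x|))`, decides `x ∈ L` in time polynomial in `|x|`.  Nothing is required of the
machine on other advice. -/
def PAdvice (β : ℕ → List Bool) : Set (Language Bool) :=
  {L | ∃ (M : Machine) (k : ℕ), ∀ x : List Bool,
    OutputsWithin M [x, β x.length] (answer L x) (polyBound k x.length)}

/-- `EXP/β` for functions `f : {0}* → {0,1}*`, where `f n` stands for `f(0^n)`: some machine,
on every input `(0^n, β(n))`, outputs `f(0^n)` in time `2 ^ poly(n)`. -/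
def FunEXPAdvice (β : ℕ → List Bool) : Set (ℕ → List Bool) :=
  {f | ∃ (M : Machine) (k : ℕ), ∀ n : ℕ,
    OutputsWithin M [List.replicate n false, β n] (f n) (2 ^ polyBound k n)}

/-- `EXP/ℓ` for functions `{0}* → {0,1}*`: the union of `EXP/β` over all advice functions `β`
with `|β(n)| ≤ ℓ(n)` for all `n`. -/
def FunEXPAdviceLength (ℓ : ℕ → ℕ) : Set (ℕ → List Bool) :=
  {f | ∃ β : ℕ → List Bool, (∀ n, (β n).length ≤ ℓ n) ∧ f ∈ FunEXPAdvice β}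

/-- `i.o.-C` for a class `C` of functions `{0}* → {0,1}*`: agreement with a member of `C`
at infinitely many input lengths. -/
def InfinitelyOften (C : Set (ℕ → List Bool)) : Set (ℕ → List Bool) :=
  {f | ∃ g ∈ C, ∃ᶠ n in atTop, f n = g n}

/-- The probability of the event `E` for a uniformly random string of `m` bits. -/
noncomputable def prob (m : ℕ) (E : Set (Fin m → Bool)) : ℝ :=
  (E.ncard : ℝ) / 2 ^ m

/-- `BPP/β`: a machine is given `x`, the advice `β(|x|)` and a uniformly random string of
length polynomial in `|x|`; it always halts, with a one-bit answer, in time polynomial in `|x|`,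
and its answer is correct with probability at least `2/3`.  Nothing is required of the
machine on other advice. -/
def BPPAdvice (β : ℕ → List Bool) : Set (Language Bool) :=
  {L | ∃ (M : Machine) (k m : ℕ), ∀ x : List Bool,
    (∀ r : Fin (polyBound m x.length) → Bool, ∃ b : Bool,
      OutputsWithin M [x, β x.length, List.ofFn r] [b] (polyBound k x.length)) ∧
    2 / 3 ≤ prob (polyBound m x.length)
      {r | OutputsWithin M [x, β x.length, List.ofFn r] (answer L x) (polyBound k x.length)}}

/-- `BPP/ℓ`: the union of `BPP/β` over all advice functions `β`
with `|β(n)| ≤ ℓ(n)` for all `n`. -/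
def BPPAdviceLength (ℓ : ℕ → ℕ) : Set (Language Bool) :=
  {L | ∃ β : ℕ → List Bool, (∀ n, (β n).length ≤ ℓ n) ∧ L ∈ BPPAdvice β}

/-- `BPP/O(n log n)`. -/
def BPPAdviceBigONLogN : Set (Language Bool) :=
  {L | ∃ ℓ : ℕ → ℕ, ((fun n => (ℓ n : ℝ)) =O[atTop] fun n : ℕ => (n : ℝ) * Real.log n) ∧
    L ∈ BPPAdviceLength ℓ}

end AdviceComplexity

/-! Let `D` decide `A` in exponential time, and let `M` decide `A` in polynomial time with advice `α
(n ^ d)`. Put N = n ^ d, and call a string of length N good if `M`, cut off at its time bound and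
given that string as advice, is right on every question of length n. Then `α N` is good.

Good advice is dense. Goodness can be checked in exponential time, by comparing `M` with `D` on all
questions of length n, so `α N` can be recovered in exponential time from its position among the
good strings. If infinitely often there were at most 2 ^ ℓ(N) good strings, with ℓ the advice length
in the hardness hypothesis, such positions would be short enough to contradict that hypothesis
(`outputsWithin_exp`, `exists_expOutput_eq`, `infinitelyOften_of_card_goodAdvice_le`). So for almost
all n a fraction of at least 1 / (2 N ^ ⌈c⌉) of the strings is good (`two_pow_le_of_lt`); enlarging
the denominator to a polynomial Q(n) covers the finitely many other n.

Density gives a randomized algorithm with short advice. A random string cannot be checked for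
goodness in polynomial time, but a few test questions with their answers are a sufficient
substitute. As long as some question is answered wrongly by more than a quarter of the strings that
pass all tests so far, make it a test. Each new test leaves less than 3/4 of these strings, while
good strings are never lost, so the process stops after O(log Q) = O(log n) tests, each of n + 1
bits (`exists_tests`). From then on, for every x, at least 3/4 of the surviving strings are right
about x. The probabilistic machine cuts its random string into blocks and runs `M` on x with the
first block that passes the tests. Survivors have density at least 1 / Q, so 8 Q blocks bring the
error down to 1/3 (`expect_error_le`, `exists_advice`).

Both algorithms are realised as stack machines. They are written as while-programs over registers
with embedded copies of `M` and `D`, and compiled by `Runs.stepsTo` and `VProg.outputsWithin`;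
outputs and running times are in `outputsWithin_bpp` and `outputsWithin_exp`. `M` always runs
against a clock, since nothing is known about its behaviour on unintended advice. -/

/-! ## Structured programs over a finite collection of stacks -/

namespace AdviceComplexity

open Turing TM2

section Programs

variable {K : Type} [DecidableEq K] {Γ : K → Type} {σ S : Type}

/-- A primitive operation on abstract states `S`, whose finite control is read by `ctl` and whose
stacks are read by `stk`; it is carried out by a single step of a stack machine. -/
structure Op (ctl : S → σ) (stk : S → ∀ k, List (Γ k)) where
  run : S → S
  code : ∀ L : Type, L → TM2.Stmt Γ L σ
  spec : ∀ (L : Type) (l : L) (s : S),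
    TM2.stepAux (code L l) (ctl s) (stk s) = ⟨some l, ctl (run s), stk (run s)⟩

/-- While-programs built from primitive operations. -/
inductive Prog (ctl : S → σ) (stk : S → ∀ k, List (Γ k))
  | op (o : Op ctl stk) : Prog ctl stk
  | seq (p q : Prog ctl stk) : Prog ctl stk
  | ite (b : σ → Bool) (p q : Prog ctl stk) : Prog ctl stk
  | while (b : σ → Bool) (p : Prog ctl stk) : Prog ctl stk

variable {ctl : S → σ} {stk : S → ∀ k, List (Γ k)}

/-- `Runs p s t s'`: started in `s`, the program `p` ends in `s'` after exactly `t` steps. -/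
inductive Runs : Prog ctl stk → S → ℕ → S → Prop
  | op (o : Op ctl stk) (s : S) : Runs (.op o) s 1 (o.run s)
  | seq {p q : Prog ctl stk} {s t s₁ t₁ s₂} :
      Runs p s t s₁ → Runs q s₁ t₁ s₂ → Runs (.seq p q) s (t + t₁) s₂
  | ite_true {b : σ → Bool} {p q : Prog ctl stk} {s t s₁} :
      b (ctl s) = true → Runs p s t s₁ → Runs (.ite b p q) s (1 + t) s₁
  | ite_false {b : σ → Bool} {p q : Prog ctl stk} {s t s₁} :
      b (ctl s) = false → Runs q s t s₁ → Runs (.ite b p q) s (1 + t) s₁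
  | while_true {b : σ → Bool} {p : Prog ctl stk} {s t s₁ t₁ s₂} :
      b (ctl s) = true → Runs p s t s₁ → Runs (.while b p) s₁ t₁ s₂ →
      Runs (.while b p) s (1 + (t + t₁)) s₂
  | while_false {b : σ → Bool} {p : Prog ctl stk} {s} :
      b (ctl s) = false → Runs (.while b p) s 1 s

/-- The type of control points of a program. -/
def Prog.Lab : Prog ctl stk → Type
  | .op _ => Unit
  | .seq p q => p.Lab ⊕ q.Lab
  | .ite _ p q => Option (p.Lab ⊕ q.Lab)
  | .while _ p => Option p.Lab

noncomputable instance Prog.labFintype : ∀ p : Prog ctl stk, Fintype p.Lab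
  | .op _ => inferInstanceAs (Fintype Unit)
  | .seq p q =>
    haveI := Prog.labFintype p; haveI := Prog.labFintype q
    inferInstanceAs (Fintype (p.Lab ⊕ q.Lab))
  | .ite _ p q =>
    haveI := Prog.labFintype p; haveI := Prog.labFintype q
    inferInstanceAs (Fintype (Option (p.Lab ⊕ q.Lab)))
  | .while _ p =>
    haveI := Prog.labFintype p
    inferInstanceAs (Fintype (Option p.Lab))

/-- The control point at which a program starts. -/
def Prog.entry : ∀ p : Prog ctl stk, p.Lab
  | .op _ => ()
  | .seq p _ => .inl p.entry
  | .ite _ _ _ => none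
  | .while _ _ => none

/-- Compilation to stack machine statements; control points are embedded by `emb` in the
label type `L`, and `exit` is the label reached at the end. -/
def Prog.code : ∀ (p : Prog ctl stk) (L : Type), (p.Lab → L) → L → p.Lab → TM2.Stmt Γ L σ
  | .op o, L, _, exit, _ => o.code L exit
  | .seq p q, L, emb, exit, a => match a with
    | .inl a => p.code L (emb ∘ .inl) (emb (.inr q.entry)) a
    | .inr a => q.code L (emb ∘ .inr) exit a
  | .ite b p q, L, emb, exit, a => match a with
    | none => .branch b (.goto fun _ => emb (some (.inl p.entry)))
        (.goto fun _ => emb (some (.inr q.entry)))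
    | some (.inl a) => p.code L (emb ∘ some ∘ .inl) exit a
    | some (.inr a) => q.code L (emb ∘ some ∘ .inr) exit a
  | .while b p, L, emb, exit, a => match a with
    | none => .branch b (.goto fun _ => emb (some p.entry)) (.goto fun _ => exit)
    | some a => p.code L (emb ∘ some) (emb none) a

/-- `c` reaches `c'` after exactly `t` steps. -/
def StepsTo {L : Type} (m : L → TM2.Stmt Γ L σ) (c : TM2.Cfg Γ L σ) (t : ℕ)
    (c' : TM2.Cfg Γ L σ) : Prop :=
  (flip bind (TM2.step m))^[t] (some c) = some c'

theorem StepsTo.trans {L : Type} {m : L → TM2.Stmt Γ L σ} {a b c : TM2.Cfg Γ L σ} {t u : ℕ}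
    (h : StepsTo m a t b) (h' : StepsTo m b u c) : StepsTo m a (t + u) c := by
  unfold StepsTo at *
  rw [Nat.add_comm, Function.iterate_add_apply, h, h']

theorem StepsTo.single {L : Type} {m : L → TM2.Stmt Γ L σ} {l : L} {v : σ}
    {T : ∀ k, List (Γ k)} {c : TM2.Cfg Γ L σ} (h : TM2.stepAux (m l) v T = c) :
    StepsTo m ⟨some l, v, T⟩ 1 c := by
  simp [StepsTo, flip, h]

/-- Correctness of the compilation. -/
theorem Runs.stepsTo {p : Prog ctl stk} {s s' : S} {t : ℕ} (h : Runs p s t s') :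
    ∀ {L : Type} (m : L → TM2.Stmt Γ L σ) (emb : p.Lab → L) (exit : L),
      (∀ a, m (emb a) = p.code L emb exit a) →
      StepsTo m ⟨some (emb p.entry), ctl s, stk s⟩ t ⟨some exit, ctl s', stk s'⟩ := by
  induction h with
  | op o s =>
    intro L m emb exit hm
    refine StepsTo.single ?_
    rw [hm]
    exact o.spec L exit s
  | seq _ _ ih₁ ih₂ =>
    intro L m emb exit hm
    exact (ih₁ m (emb ∘ .inl) _ fun a => hm (.inl a)).trans
      (ih₂ m (emb ∘ .inr) exit fun a => hm (.inr a))
  | @ite_true b p q s t s₁ hb _ ih =>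
    intro L m emb exit hm
    refine (StepsTo.single ?_).trans
      (ih m (emb ∘ some ∘ .inl) exit fun a => hm (some (.inl a)))
    erw [hm none]
    simp only [Prog.code, TM2.stepAux, hb, cond_true]
    rfl
  | @ite_false b p q s t s₁ hb _ ih =>
    intro L m emb exit hm
    refine (StepsTo.single ?_).trans
      (ih m (emb ∘ some ∘ .inr) exit fun a => hm (some (.inr a)))
    erw [hm none]
    simp only [Prog.code, TM2.stepAux, hb, cond_false]
    rfl
  | @while_true b p s t s₁ t₁ s₂ hb _ _ ih₁ ih₂ =>
    intro L m emb exit hm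
    refine (StepsTo.single ?_).trans
      ((ih₁ m (emb ∘ some) (emb none) fun a => hm (some a)).trans (ih₂ m emb exit hm))
    erw [hm none]
    simp only [Prog.code, TM2.stepAux, hb, cond_true]
    rfl
  | @while_false b p s hb =>
    intro L m emb exit hm
    refine StepsTo.single ?_
    erw [hm none]
    simp [Prog.code, hb]

/-- Started in `s`, the program `p` ends in `s'` after at most `T` steps. -/
def RunsIn (p : Prog ctl stk) (s : S) (T : ℕ) (s' : S) : Prop :=
  ∃ t ≤ T, Runs p s t s'

theorem RunsIn.mono {p : Prog ctl stk} {s s' : S} {T T' : ℕ} (h : RunsIn p s T s')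
    (hT : T ≤ T') : RunsIn p s T' s' :=
  let ⟨t, ht, hr⟩ := h
  ⟨t, ht.trans hT, hr⟩

theorem RunsIn.op (o : Op ctl stk) (s : S) : RunsIn (.op o) s 1 (o.run s) :=
  ⟨1, le_rfl, .op o s⟩

theorem RunsIn.seq {p q : Prog ctl stk} {s s₁ s₂ : S} {T T₁ : ℕ} (h : RunsIn p s T s₁)
    (h' : RunsIn q s₁ T₁ s₂) : RunsIn (.seq p q) s (T + T₁) s₂ :=
  let ⟨_, ht, hr⟩ := h
  let ⟨_, ht', hr'⟩ := h'
  ⟨_, Nat.add_le_add ht ht', .seq hr hr'⟩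

theorem RunsIn.congr {p : Prog ctl stk} {s₁ s₂ s₁' s₂' : S} {T T' : ℕ} (h : RunsIn p s₁ T s₂)
    (hs : s₁ = s₁') (hT : T ≤ T') (hs' : s₂ = s₂') : RunsIn p s₁' T' s₂' :=
  hs ▸ hs' ▸ h.mono hT

theorem RunsIn.ite_pos {b : σ → Bool} {p q : Prog ctl stk} {s s₁ : S} {T : ℕ}
    (hb : b (ctl s) = true) (h : RunsIn p s T s₁) : RunsIn (.ite b p q) s (1 + T) s₁ :=
  let ⟨_, ht, hr⟩ := h
  ⟨_, by omega, .ite_true hb hr⟩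

theorem RunsIn.ite_neg {b : σ → Bool} {p q : Prog ctl stk} {s s₁ : S} {T : ℕ}
    (hb : b (ctl s) = false) (h : RunsIn q s T s₁) : RunsIn (.ite b p q) s (1 + T) s₁ :=
  let ⟨_, ht, hr⟩ := h
  ⟨_, by omega, .ite_false hb hr⟩

theorem RunsIn.while_true {b : σ → Bool} {p : Prog ctl stk} {s s₁ s₂ : S} {T T₁ : ℕ}
    (hb : b (ctl s) = true) (h : RunsIn p s T s₁) (h' : RunsIn (.while b p) s₁ T₁ s₂) :
    RunsIn (.while b p) s (1 + (T + T₁)) s₂ :=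
  let ⟨_, ht, hr⟩ := h
  let ⟨_, ht', hr'⟩ := h'
  ⟨_, by omega, .while_true hb hr hr'⟩

theorem RunsIn.while_false {b : σ → Bool} {p : Prog ctl stk} {s : S}
    (hb : b (ctl s) = false) : RunsIn (.while b p) s 1 s :=
  ⟨1, le_rfl, .while_false hb⟩

/-- Sequential composition of programs. -/
infixr:60 " ⨾ " => Prog.seq

end Programs

end AdviceComplexity

/-! ## Programs with registers and embedded Turing machines -/

namespace AdviceComplexity

open Turing TM2

set_option linter.unusedSectionVars false
set_option linter.unusedVariables false

section VM

variable {ι R : Type} [DecidableEq ι] [DecidableEq R]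
variable {M : ι → Machine}

/-- The configurations of a machine. -/
abbrev Machine.Cfg (M : Machine) : Type := TM2.Cfg M.tm.Γ M.tm.Λ M.tm.σ

/-- States of a machine that has a scratch cell `v`, an input stack, binary registers indexed
by `R`, and the machines `M i` embedded. -/
structure St (M : ι → Machine) (R : Type) where
  v : Option (Option Bool)
  inp : List (Option Bool)
  reg : R → List Bool
  cfg : ∀ i, (M i).Cfg

/-- The stacks. -/
abbrev StackIx (M : ι → Machine) (R : Type) : Type := (Σ i, (M i).tm.K) ⊕ Option R

/-- The stack alphabets. -/
abbrev Sym (M : ι → Machine) (R : Type) : StackIx M R → Type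
  | .inl x => (M x.1).tm.Γ x.2
  | .inr none => Option Bool
  | .inr (some _) => Bool

/-- The finite control. -/
abbrev Ctl (M : ι → Machine) : Type :=
  Option (Option Bool) × ∀ i, Option (M i).tm.Λ × (M i).tm.σ

/-- Write the scratch cell. -/
def St.setV (s : St M R) (v : Option (Option Bool)) : St M R := {s with v := v}

/-- Write the input stack. -/
def St.setInp (s : St M R) (l : List (Option Bool)) : St M R := {s with inp := l}

/-- Write a register. -/
def St.setReg (s : St M R) (r : R) (l : List Bool) : St M R :=
  {s with reg := Function.update s.reg r l}

/-- Write the configuration of an embedded machine. -/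
def St.setCfg (s : St M R) (i : ι) (c : (M i).Cfg) : St M R :=
  {s with cfg := Function.update s.cfg i c}

/-- The control part of a state. -/
def St.ctl (s : St M R) : Ctl M := (s.v, fun i => ((s.cfg i).l, (s.cfg i).var))

/-- The stacks of a state. -/
def St.stk (s : St M R) : ∀ k, List (Sym M R k)
  | .inl x => (s.cfg x.1).stk x.2
  | .inr none => s.inp
  | .inr (some r) => s.reg r

/-- Programs over the states `St M R`. -/
abbrev VProg (M : ι → Machine) (R : Type) [DecidableEq R] : Type 1 :=
  Prog (St.ctl (M := M) (R := R)) St.stk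

/-- Primitive operations on the states `St M R`. -/
abbrev VOp (M : ι → Machine) (R : Type) [DecidableEq R] : Type 1 :=
  Op (St.ctl (M := M) (R := R)) St.stk

theorem St.stk_setReg (s : St M R) (r : R) (l : List Bool) :
    (s.setReg r l).stk = Function.update s.stk (.inr (some r)) l := by
  funext k
  rcases k with x | _ | q
  · simp [St.stk, St.setReg]
  · simp [St.stk, St.setReg]
  · by_cases h : q = r
    · subst h; simp [St.stk, St.setReg]
    · simp [St.stk, St.setReg, h]

theorem St.stk_setInp (s : St M R) (l : List (Option Bool)) :
    (s.setInp l).stk = Function.update s.stk (.inr none) l := by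
  funext k
  rcases k with x | _ | q <;> simp [St.stk, St.setInp]

theorem St.stk_setCfg_update (s : St M R) (i : ι) (l : Option (M i).tm.Λ) (w : (M i).tm.σ)
    (k : (M i).tm.K) (x : List ((M i).tm.Γ k)) :
    (s.setCfg i ⟨l, w, Function.update (s.cfg i).stk k x⟩).stk =
      Function.update s.stk (.inl ⟨i, k⟩) x := by
  funext y
  rcases y with ⟨j, k'⟩ | _ | q
  · by_cases h : j = i
    · subst h
      by_cases hk : k' = k
      · subst hk; simp [St.stk, St.setCfg]
      · simp [St.stk, St.setCfg, hk]
    · simp [St.stk, St.setCfg, h]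
  · simp [St.stk, St.setCfg]
  · simp [St.stk, St.setCfg]

theorem St.stk_setCfg_self (s : St M R) (i : ι) (l : Option (M i).tm.Λ) (w : (M i).tm.σ) :
    (s.setCfg i ⟨l, w, (s.cfg i).stk⟩).stk = s.stk := by
  funext y
  rcases y with ⟨j, k'⟩ | _ | q
  · by_cases h : j = i
    · subst h; simp [St.stk, St.setCfg]
    · simp [St.stk, St.setCfg, h]
  · simp [St.stk, St.setCfg]
  · simp [St.stk, St.setCfg]

/-- Update of the control state of the machine `M i`. -/
def Ctl.set (c : Ctl M) (i : ι) (l : Option (M i).tm.Λ) (w : (M i).tm.σ) : Ctl M :=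
  (c.1, Function.update c.2 i (l, w))

theorem St.ctl_setCfg (s : St M R) (i : ι) (l : Option (M i).tm.Λ) (w : (M i).tm.σ)
    (T : ∀ k, List ((M i).tm.Γ k)) :
    (s.setCfg i ⟨l, w, T⟩).ctl = s.ctl.set i l w := by
  refine Prod.ext rfl ?_
  funext j
  by_cases h : j = i
  · subst h; simp [St.ctl, Ctl.set, St.setCfg]
  · simp [St.ctl, Ctl.set, h, St.setCfg]

theorem Ctl.set_self (s : St M R) (i : ι) :
    s.ctl.set i (s.cfg i).l (s.cfg i).var = s.ctl := by
  refine Prod.ext rfl ?_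
  simp [Ctl.set, St.ctl]

section setters

variable (s : St M R) (r : R) (l l' : List Bool) (v v' : Option (Option Bool))
  (z z' : List (Option Bool)) (i : ι) (c c' : (M i).Cfg)

@[simp] theorem St.setReg_reg : (s.setReg r l).reg = Function.update s.reg r l := rfl
@[simp] theorem St.setReg_v : (s.setReg r l).v = s.v := rfl
@[simp] theorem St.setReg_inp : (s.setReg r l).inp = s.inp := rfl
@[simp] theorem St.setReg_cfg : (s.setReg r l).cfg = s.cfg := rfl
@[simp] theorem St.setV_reg : (s.setV v).reg = s.reg := rfl
@[simp] theorem St.setV_v : (s.setV v).v = v := rfl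
@[simp] theorem St.setV_inp : (s.setV v).inp = s.inp := rfl
@[simp] theorem St.setV_cfg : (s.setV v).cfg = s.cfg := rfl
@[simp] theorem St.setInp_reg : (s.setInp z).reg = s.reg := rfl
@[simp] theorem St.setInp_v : (s.setInp z).v = s.v := rfl
@[simp] theorem St.setInp_inp : (s.setInp z).inp = z := rfl
@[simp] theorem St.setInp_cfg : (s.setInp z).cfg = s.cfg := rfl
@[simp] theorem St.setCfg_reg : (s.setCfg i c).reg = s.reg := rfl
@[simp] theorem St.setCfg_v : (s.setCfg i c).v = s.v := rfl
@[simp] theorem St.setCfg_inp : (s.setCfg i c).inp = s.inp := rfl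
@[simp] theorem St.setCfg_cfg : (s.setCfg i c).cfg = Function.update s.cfg i c := rfl
@[simp] theorem St.setReg_setReg : (s.setReg r l).setReg r l' = s.setReg r l' := by
  simp [St.setReg]
@[simp] theorem St.setCfg_setCfg : (s.setCfg i c).setCfg i c' = s.setCfg i c' := by
  simp [St.setCfg]
@[simp] theorem St.setV_setV : (s.setV v).setV v' = s.setV v' := rfl
@[simp] theorem St.setInp_setInp : (s.setInp z).setInp z' = s.setInp z' := rfl
@[simp] theorem St.setReg_self : s.setReg r (s.reg r) = s := by simp [St.setReg]
@[simp] theorem St.setCfg_self : s.setCfg i (s.cfg i) = s := by simp [St.setCfg]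
@[simp] theorem St.setV_self : s.setV s.v = s := rfl
@[simp] theorem St.setReg_setV : (s.setReg r l).setV v = (s.setV v).setReg r l := rfl
@[simp] theorem St.setCfg_setV : (s.setCfg i c).setV v = (s.setV v).setCfg i c := rfl
@[simp] theorem St.setInp_setV : (s.setInp z).setV v = (s.setV v).setInp z := rfl

end setters

@[ext] theorem St.ext' {s s' : St M R} (hv : s.v = s'.v) (hi : s.inp = s'.inp)
    (hr : ∀ r, s.reg r = s'.reg r) (hc : ∀ i, s.cfg i = s'.cfg i) : s = s' := by
  rcases s with ⟨v, i, r, c⟩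
  rcases s' with ⟨v', i', r', c'⟩
  obtain rfl : r = r' := funext hr
  obtain rfl : c = c' := funext hc
  simp only at hv hi
  subst hv hi
  rfl

/-- Set the scratch cell to a function of its value. -/
def opV (f : Option (Option Bool) → Option (Option Bool)) : VOp M R where
  run s := s.setV (f s.v)
  code L l := .load (fun c => (f c.1, c.2)) (.goto fun _ => l)
  spec L l s := rfl

/-- Push a function of the scratch cell on a register. -/
def opPush (r : R) (f : Option (Option Bool) → Bool) : VOp M R where
  run s := s.setReg r (f s.v :: s.reg r)
  code L l := .push (.inr (some r)) (fun c => f c.1) (.goto fun _ => l)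
  spec L l s := by rw [St.stk_setReg]; rfl

/-- Pop a register into the scratch cell. -/
def opPop (r : R) : VOp M R where
  run s := (s.setV ((s.reg r).head?.map some)).setReg r (s.reg r).tail
  code L l := .pop (.inr (some r)) (fun c x => (x.map some, c.2)) (.goto fun _ => l)
  spec L l s := by rw [St.stk_setReg]; rfl

/-- Pop the input stack into the scratch cell. -/
def opInp : VOp M R where
  run s := (s.setV s.inp.head?).setInp s.inp.tail
  code L l := .pop (.inr none) (fun c x => (x, c.2)) (.goto fun _ => l)
  spec L l s := by rw [St.stk_setInp]; rfl

/-- Prepare the machine `M i` for a run. -/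
def opInit (i : ι) : VOp M R where
  run s := s.setCfg i ⟨some (M i).tm.main, (M i).tm.initialState, (s.cfg i).stk⟩
  code L l := .load (fun c => c.set i (some (M i).tm.main) (M i).tm.initialState) (.goto fun _ => l)
  spec L l s := by rw [St.stk_setCfg_self, St.ctl_setCfg]; rfl

/-- Push a symbol on the input stack of a configuration. -/
def Machine.feed (M : Machine) (a : Option Bool) (c : M.Cfg) : M.Cfg :=
  ⟨c.l, c.var, Function.update c.stk M.tm.k₀ (M.inputAlphabet.symm a :: c.stk M.tm.k₀)⟩

/-- Push a function of the scratch cell on the input stack of the machine `M i`. -/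
def opFeed (i : ι) (f : Option (Option Bool) → Option Bool) : VOp M R where
  run s := s.setCfg i ((M i).feed (f s.v) (s.cfg i))
  code L l := .push (.inl ⟨i, (M i).tm.k₀⟩) (fun c => (M i).inputAlphabet.symm (f c.1))
    (.goto fun _ => l)
  spec L l s := by
    rw [Machine.feed, St.stk_setCfg_update, St.ctl_setCfg, Ctl.set_self]
    rfl

/-- The top of the output stack of a configuration. -/
def Machine.topOut (M : Machine) (c : M.Cfg) : Bool :=
  ((c.stk M.tm.k₁).head?.map M.outputAlphabet).getD false

/-- Read the top of the output stack of the machine `M i`. -/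
def opOut (i : ι) : VOp M R where
  run s := s.setV (some (some ((M i).topOut (s.cfg i))))
  code L l := .peek (.inl ⟨i, (M i).tm.k₁⟩)
    (fun c x => (some (some ((x.map (M i).outputAlphabet).getD false)), c.2)) (.goto fun _ => l)
  spec L l s := rfl

/-- Translation of the statements of the machine `M i`. -/
def embStmt (R : Type) (i : ι) {L : Type} (l : L) :
    TM2.Stmt (M i).tm.Γ (M i).tm.Λ (M i).tm.σ → TM2.Stmt (Sym M R) L (Ctl M)
  | .push k f q => .push (.inl ⟨i, k⟩) (fun c => f (c.2 i).2) (embStmt R i l q)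
  | .peek k f q => .peek (.inl ⟨i, k⟩) (fun c x => c.set i (c.2 i).1 (f (c.2 i).2 x))
      (embStmt R i l q)
  | .pop k f q => .pop (.inl ⟨i, k⟩) (fun c x => c.set i (c.2 i).1 (f (c.2 i).2 x))
      (embStmt R i l q)
  | .load f q => .load (fun c => c.set i (c.2 i).1 (f (c.2 i).2)) (embStmt R i l q)
  | .branch f q₁ q₂ => .branch (fun c => f (c.2 i).2) (embStmt R i l q₁) (embStmt R i l q₂)
  | .goto f => .load (fun c => c.set i (some (f (c.2 i).2)) (c.2 i).2) (.goto fun _ => l)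
  | .halt => .load (fun c => c.set i none (c.2 i).2) (.goto fun _ => l)

/-- A whole statement is carried out in one step, so its translation is too. The label to which the
embedded machine jumps is stored in the finite control, and the outer machine itself continues at
`l`. -/
theorem stepAux_embStmt (i : ι) {L : Type} (l : L)
    (q : TM2.Stmt (M i).tm.Γ (M i).tm.Λ (M i).tm.σ) (s : St M R) :
    TM2.stepAux (embStmt R i l q) s.ctl s.stk =
      ⟨some l, (s.setCfg i (TM2.stepAux q (s.cfg i).var (s.cfg i).stk)).ctl,
        (s.setCfg i (TM2.stepAux q (s.cfg i).var (s.cfg i).stk)).stk⟩ := by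
  induction q generalizing s with
  | push k f q ih =>
    have := ih (s.setCfg i ⟨(s.cfg i).l, (s.cfg i).var,
      Function.update (s.cfg i).stk k (f (s.cfg i).var :: (s.cfg i).stk k)⟩)
    simp only [St.setCfg_cfg, Function.update_self, St.setCfg_setCfg] at this
    rwa [St.stk_setCfg_update, St.ctl_setCfg, Ctl.set_self] at this
  | peek k f q ih =>
    have := ih (s.setCfg i ⟨(s.cfg i).l,
      f (s.cfg i).var ((s.cfg i).stk k).head?, (s.cfg i).stk⟩)
    simp only [St.setCfg_cfg, Function.update_self, St.setCfg_setCfg] at this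
    rwa [St.stk_setCfg_self, St.ctl_setCfg] at this
  | pop k f q ih =>
    have := ih (s.setCfg i ⟨(s.cfg i).l, f (s.cfg i).var ((s.cfg i).stk k).head?,
      Function.update (s.cfg i).stk k ((s.cfg i).stk k).tail⟩)
    simp only [St.setCfg_cfg, Function.update_self, St.setCfg_setCfg] at this
    rwa [St.stk_setCfg_update, St.ctl_setCfg] at this
  | load f q ih =>
    have := ih (s.setCfg i ⟨(s.cfg i).l, f (s.cfg i).var, (s.cfg i).stk⟩)
    simp only [St.setCfg_cfg, Function.update_self, St.setCfg_setCfg] at this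
    rwa [St.stk_setCfg_self, St.ctl_setCfg] at this
  | branch f q₁ q₂ ih₁ ih₂ =>
    simp only [embStmt, TM2.stepAux]
    change cond (f (s.cfg i).var) _ _ = _
    cases f (s.cfg i).var
    · exact ih₂ s
    · exact ih₁ s
  | goto f =>
    simp only [embStmt, TM2.stepAux]
    rw [St.stk_setCfg_self, St.ctl_setCfg]
    rfl
  | halt =>
    simp only [embStmt, TM2.stepAux]
    rw [St.stk_setCfg_self, St.ctl_setCfg]
    rfl

/-- One step of a machine; halting configurations are kept. -/
def Machine.next (M : Machine) (c : M.Cfg) : M.Cfg := (TM2.step M.tm.m c).getD c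

open Classical in
/-- Dispatch over a list of labels. -/
noncomputable def dispatch (R : Type) (i : ι) {L : Type} (l : L) :
    List (M i).tm.Λ → TM2.Stmt (Sym M R) L (Ctl M)
  | [] => .goto fun _ => l
  | a :: as => .branch (fun c => decide ((c.2 i).1 = some a)) (embStmt R i l ((M i).tm.m a))
      (dispatch R i l as)

/-- The stored label is looked up in the list. If it is in no entry, the embedded machine has
halted, and `Machine.next` keeps its configuration. -/
theorem stepAux_dispatch (i : ι) {L : Type} (l : L) (s : St M R) (as : List (M i).tm.Λ)
    (h : ∀ a, (s.cfg i).l = some a → a ∈ as) :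
    TM2.stepAux (dispatch R i l as) s.ctl s.stk =
      ⟨some l, (s.setCfg i ((M i).next (s.cfg i))).ctl,
        (s.setCfg i ((M i).next (s.cfg i))).stk⟩ := by
  classical
  induction as with
  | nil =>
    have : (M i).next (s.cfg i) = s.cfg i := by
      rcases hc : s.cfg i with ⟨_ | a, w, T⟩
      · rfl
      · exact absurd (h a (by rw [hc])) (by simp)
    rw [this, St.setCfg_self]
    rfl
  | cons a as ih =>
    simp only [dispatch, TM2.stepAux]
    by_cases ha : (s.cfg i).l = some a
    · rw [Bool.cond_decide, if_pos (show (s.ctl.2 i).1 = some a from ha), stepAux_embStmt]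
      have : (M i).next (s.cfg i) = TM2.stepAux ((M i).tm.m a) (s.cfg i).var (s.cfg i).stk := by
        rcases hc : s.cfg i with ⟨l', w, T⟩
        rw [hc] at ha
        simp only at ha
        subst ha
        rfl
      rw [this]
    · rw [Bool.cond_decide, if_neg (show ¬(s.ctl.2 i).1 = some a from ha)]
      refine ih fun b hb => ?_
      rcases List.mem_cons.1 (h b hb) with rfl | h'
      · exact absurd hb ha
      · exact h'

/-- Let the machine `M i` do a step. -/
noncomputable def opStep (i : ι) : VOp M R where
  run s := s.setCfg i ((M i).next (s.cfg i))
  code L l := dispatch R i l (M i).tm.ΛFin.elems.toList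
  spec L l s := stepAux_dispatch i l s _ fun a _ => by
    have := (M i).tm.ΛFin.complete a
    simpa using this

/-- Pop a list of stacks of the machine `M i`, with a note in the scratch cell
if one of them is not empty. -/
def popMany (R : Type) (i : ι) {L : Type} (l : L) :
    List (M i).tm.K → TM2.Stmt (Sym M R) L (Ctl M)
  | [] => .goto fun _ => l
  | k :: ks => .pop (.inl ⟨i, k⟩) (fun c x => (if x.isSome then some none else c.1, c.2))
      (popMany R i l ks)

/-- Pop all stacks of a configuration. -/
def Machine.popAll (M : Machine) (c : M.Cfg) : M.Cfg :=
  ⟨none, M.tm.initialState, fun k => (c.stk k).tail⟩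

/-- The configuration with empty stacks. -/
def Machine.blank (M : Machine) : M.Cfg := ⟨none, M.tm.initialState, fun _ => []⟩

/-- As the list has no repetitions, each stack is popped once, and every emptiness test sees the
original contents. The final state is a variable with an equation, so that the induction can change
the initial state freely. -/
theorem stepAux_popMany (i : ι) {L : Type} (l : L) (ks : List (M i).tm.K) (hks : ks.Nodup)
    (s : St M R) (s' : St M R)
    (hs' : s' = (s.setV (if ∃ k ∈ ks, (s.cfg i).stk k ≠ [] then some none else s.v)).setCfg i
      ⟨(s.cfg i).l, (s.cfg i).var, fun k =>
        if k ∈ ks then ((s.cfg i).stk k).tail else (s.cfg i).stk k⟩) :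
    TM2.stepAux (popMany R i l ks) s.ctl s.stk = ⟨some l, s'.ctl, s'.stk⟩ := by
  induction ks generalizing s with
  | nil =>
    have : s' = s := by
      rw [hs']
      simp only [List.not_mem_nil, false_and, exists_false, if_false, St.setV_self]
      exact St.setCfg_self s i
    rw [this]
    rfl
  | cons k ks ih =>
    have hk : k ∉ ks := (List.nodup_cons.1 hks).1
    have := ih (List.nodup_cons.1 hks).2
      ((s.setV (if ((s.cfg i).stk k).head?.isSome then some none else s.v)).setCfg i
        ⟨(s.cfg i).l, (s.cfg i).var,
          Function.update (s.cfg i).stk k ((s.cfg i).stk k).tail⟩) ?_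
    · rw [St.ctl_setCfg] at this
      have e := St.stk_setCfg_update
        (s.setV (if ((s.cfg i).stk k).head?.isSome then some none else s.v)) i
        (s.cfg i).l (s.cfg i).var k ((s.cfg i).stk k).tail
      rw [St.setV_cfg] at e
      rw [e] at this
      have e' := Ctl.set_self
        (s.setV (if ((s.cfg i).stk k).head?.isSome then some none else s.v)) i
      rw [St.setV_cfg] at e'
      rw [e'] at this
      exact this
    · rw [hs']
      simp only [St.setCfg_cfg, Function.update_self, St.setCfg_setV, St.setCfg_setCfg,
        St.setV_setV, St.setCfg_v, St.setV_v]
      have e₁ : (if ∃ k' ∈ ks, Function.update (s.cfg i).stk k ((s.cfg i).stk k).tail k' ≠ [] then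
          some none else if ((s.cfg i).stk k).head?.isSome then some none else s.v) =
          if ∃ k' ∈ k :: ks, (s.cfg i).stk k' ≠ [] then some none else s.v := by
        have : (∃ k' ∈ ks, Function.update (s.cfg i).stk k ((s.cfg i).stk k).tail k' ≠ []) ↔
            ∃ k' ∈ ks, (s.cfg i).stk k' ≠ [] := by
          refine exists_congr fun k' => and_congr_right fun h' => ?_
          rw [Function.update_of_ne (by rintro rfl; exact hk h')]
        simp only [this, List.mem_cons, exists_eq_or_imp]
        cases hs : (s.cfg i).stk k <;> simp
      have e₂ : (fun k' => if k' ∈ ks then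
          (Function.update (s.cfg i).stk k ((s.cfg i).stk k).tail k').tail
          else Function.update (s.cfg i).stk k ((s.cfg i).stk k).tail k') =
          fun k' => if k' ∈ k :: ks then ((s.cfg i).stk k').tail else (s.cfg i).stk k' := by
        funext k'
        by_cases h : k' = k
        · subst h; simp [hk]
        · simp [h]
      rw [e₁, e₂]

open Classical in
/-- Pop all stacks of the machine `M i`, with a note in the scratch cell
if one of them is not empty. -/
noncomputable def opDrain (i : ι) : VOp M R where
  run s := (s.setV (if ∃ k, (s.cfg i).stk k ≠ [] then some none else none)).setCfg i
    ((M i).popAll (s.cfg i))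
  code L l := .load (fun c => (none, (c.set i none (M i).tm.initialState).2))
    (popMany R i l (M i).tm.kFin.elems.toList)
  spec L l s := by
    have hc : ∀ k, k ∈ (M i).tm.kFin.elems.toList := fun k => by
      have := (M i).tm.kFin.complete k
      simpa using this
    have := stepAux_popMany (R := R) i l (M i).tm.kFin.elems.toList (Finset.nodup_toList _)
      ((s.setV none).setCfg i ⟨none, (M i).tm.initialState, (s.cfg i).stk⟩)
      ((s.setV (if ∃ k, (s.cfg i).stk k ≠ [] then some none else none)).setCfg i
        ((M i).popAll (s.cfg i))) ?_
    · have e := St.stk_setCfg_self (s.setV none) i none (M i).tm.initialState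
      rw [St.setV_cfg] at e
      rw [e, St.ctl_setCfg] at this
      exact this
    · simp only [St.setCfg_cfg, Function.update_self, St.setCfg_setV, St.setCfg_setCfg,
        St.setV_setV, St.setCfg_v, St.setV_v, hc, true_and, if_true]
      rfl

/-- Test: the scratch cell is filled. -/
def vSome (c : Ctl M) : Bool := c.1.isSome

/-- Test: the scratch cell holds a symbol different from the separator. -/
def vBit (c : Ctl M) : Bool := (c.1.getD none).isSome

/-- Test: the scratch cell holds the bit `1`. -/
def vTrue (c : Ctl M) : Bool := c.1 = some (some true)

/-- Test: the machine `M i` has not halted. -/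
def running (i : ι) (c : Ctl M) : Bool := (c.2 i).1.isSome

/-- The state at the start, with the given input. -/
def St.start (M : ι → Machine) (R : Type) (z : List (Option Bool)) : St M R :=
  ⟨none, z, fun _ => [], fun i => (M i).blank⟩

variable [Fintype ι] [Fintype R]

noncomputable instance : Fintype (Ctl M) :=
  haveI := fun i => (M i).tm.ΛFin
  haveI := fun i => (M i).tm.σFin
  inferInstanceAs (Fintype (Option (Option Bool) × ∀ i, Option (M i).tm.Λ × (M i).tm.σ))

/-- The stack machine that carries out a program, with output register `out`. -/
noncomputable def VProg.machine (p : VProg M R) (out : R) : Machine where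
  tm :=
    { K := StackIx M R
      kDecidableEq := inferInstance
      kFin := haveI := fun i => (M i).tm.kFin; inferInstance
      k₀ := .inr none
      k₁ := .inr (some out)
      Γ := Sym M R
      Λ := Option p.Lab
      main := some p.entry
      σ := Ctl M
      initialState := (St.start M R []).ctl
      Γk₀Fin := inferInstanceAs (Fintype (Option Bool))
      m := fun a => match a with
        | some a => p.code (Option p.Lab) some none a
        -- The output convention asks for the initial control state at the halt, so it is restored
        -- here.
        | none => .load (fun _ => (St.start M R []).ctl) .halt }
  inputAlphabet := Equiv.refl _
  outputAlphabet := Equiv.refl _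

/-- The halting configuration of the output convention has empty stacks apart from the output, which
is why a program must clean up its input, registers and embedded machines. The additional step is
the final one that resets the control. -/
theorem VProg.outputsWithin {p : VProg M R} {out : R} {ws : List (List Bool)} {y : List Bool}
    {T : ℕ} {s : St M R} (h : RunsIn p (St.start M R (encodeInput ws)) T s)
    (hi : s.inp = []) (hr : s.reg = Function.update (fun _ => []) out y)
    (hc : s.cfg = fun i => (M i).blank) : OutputsWithin (p.machine out) ws y (T + 1) := by
  obtain ⟨t, ht, h⟩ := h
  refine ⟨⟨⟨t + 1, ?_⟩, Nat.succ_le_succ ht⟩⟩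
  have h₁ := h.stepsTo (p.machine out).tm.m some none fun a => rfl
  have h₂ := h₁.trans (StepsTo.single (c := ⟨none, (St.start M R []).ctl, s.stk⟩) rfl)
  unfold StepsTo at h₂
  refine Eq.trans ?_ (h₂.trans ?_)
  · change (flip bind (TM2.step _))^[t + 1] _ = _
    congr 2
    unfold initList
    congr 1
    funext k
    rcases k with x | _ | r
    · exact (dif_neg (by rintro ⟨⟩)).trans rfl
    · refine (dif_pos rfl).trans ?_
      change List.map _ _ = _
      exact List.map_id _
    · exact (dif_neg (by rintro ⟨⟩)).trans rfl
  · refine congrArg some ?_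
    unfold haltList
    refine congrArg (TM2.Cfg.mk _ _) ?_
    funext k
    rcases k with x | _ | r
    · refine Eq.trans ?_ (dif_neg (by rintro ⟨⟩)).symm
      simp only [St.stk, hc, Machine.blank]
      rfl
    · refine Eq.trans ?_ (dif_neg (by rintro ⟨⟩)).symm
      exact hi
    · by_cases h : r = out
      · subst h
        refine Eq.trans ?_ (dif_pos rfl).symm
        change s.reg r = List.map _ _
        rw [hr, Function.update_self]
        exact (List.map_id _).symm
      · refine Eq.trans ?_ (dif_neg fun h' => h (by cases h'; rfl)).symm
        change s.reg r = _
        rw [hr, Function.update_of_ne h]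
        rfl

end VM

theorem OutputsWithin.mono {M : Machine} {ws : List (List Bool)} {y : List Bool} {t t' : ℕ}
    (h : OutputsWithin M ws y t) (ht : t ≤ t') : OutputsWithin M ws y t' :=
  let ⟨⟨h, hn⟩⟩ := h
  ⟨⟨h, hn.trans ht⟩⟩

end AdviceComplexity

/-! ## A library of programs -/

namespace AdviceComplexity

open Turing TM2

set_option linter.unusedSectionVars false

section Macros

variable {ι R : Type} [DecidableEq ι] [DecidableEq R]
variable {M : ι → Machine}

/-- `RunsIn`, up to the final value of the scratch cell. -/
def Yields (p : VProg M R) (s : St M R) (T : ℕ) (s' : St M R) : Prop :=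
  ∃ w, RunsIn p s T (s'.setV w)

/-- `RunsIn`, up to the initial and the final value of the scratch cell. -/
def Does (p : VProg M R) (s : St M R) (T : ℕ) (s' : St M R) : Prop :=
  ∀ w, Yields p (s.setV w) T s'

variable {p q : VProg M R} {s s₁ s₂ : St M R} {T T₁ T₂ : ℕ}

theorem Yields.mono (h : Yields p s T s₁) (hT : T ≤ T₁) : Yields p s T₁ s₁ :=
  let ⟨w, h⟩ := h
  ⟨w, h.mono hT⟩

theorem Does.mono (h : Does p s T s₁) (hT : T ≤ T₁) : Does p s T₁ s₁ :=
  fun w => (h w).mono hT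

theorem Does.congr (h : Does p s T s₁) {s' : St M R} (hs : s = s') (hT : T ≤ T₁)
    (hs' : s₁ = s₂) : Does p s' T₁ s₂ :=
  hs ▸ hs' ▸ h.mono hT

theorem RunsIn.yields {s' : St M R} {w : Option (Option Bool)} (h : RunsIn p s T s')
    (hs : s = s₁) (hs' : s' = s₂.setV w) : Yields p s₁ T s₂ :=
  ⟨w, hs ▸ hs' ▸ h⟩

theorem St.ext_reg {s s' : St M R} (hr : ∀ r, s.reg r = s'.reg r)
    (hv : s.v = s'.v := by simp [opPush, bitOf])
    (hi : s.inp = s'.inp := by simp [opPush]) (hc : s.cfg = s'.cfg := by simp [opPush]) : s = s' :=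
  St.ext' hv hi hr (congrFun hc)

theorem Does.seq (h : Does p s T s₁) (h' : Does q s₁ T₁ s₂) : Does (p ⨾ q) s (T + T₁) s₂ :=
  fun w =>
    let ⟨w', r⟩ := h w
    let ⟨w'', r'⟩ := h' w'
    ⟨w'', r.seq r'⟩

theorem Yields.seq (h : Yields p s T s₁) (h' : Does q s₁ T₁ s₂) : Yields (p ⨾ q) s (T + T₁) s₂ :=
  let ⟨w', r⟩ := h
  let ⟨w'', r'⟩ := h' w'
  ⟨w'', r.seq r'⟩

/-- Do nothing. -/
def nop : VProg M R := .op (opV id)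

theorem does_nop (s : St M R) : Does nop s 1 s := fun w => ⟨w, RunsIn.op (opV id) _⟩

/-- Push a bit on a register. -/
def push (r : R) (b : Bool) : VProg M R := .op (opPush r fun _ => b)

theorem does_push (r : R) (b : Bool) (s : St M R) :
    Does (push r b) s 1 (s.setReg r (b :: s.reg r)) :=
  fun w => ⟨w, RunsIn.op (opPush r fun _ => b) _⟩

/-- The bit in the scratch cell. -/
def bitOf (v : Option (Option Bool)) : Bool := (v.getD none).getD false

/-- Push the bit in the scratch cell on a register. -/
def pushV (r : R) : VProg M R := .op (opPush r bitOf)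

theorem runs_pushV (r : R) (s : St M R) :
    RunsIn (pushV r) s 1 (s.setReg r (bitOf s.v :: s.reg r)) :=
  RunsIn.op (opPush r bitOf) s

/-- Discard the top of a register. -/
def drop (r : R) : VProg M R := .op (opPop r)

theorem does_drop (r : R) (s : St M R) : Does (drop r) s 1 (s.setReg r (s.reg r).tail) :=
  fun w => ⟨(s.reg r).head?.map some, RunsIn.op (opPop r) (s.setV w)⟩

/-- Pop a register and run `p` if there was a bit to pop, and `q` otherwise. -/
def ifPop (r : R) (p q : VProg M R) : VProg M R := .op (opPop r) ⨾ .ite vSome p q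

/-- The branch may use the popped bit, so its hypothesis fixes the scratch cell. The two extra steps
are the pop and the test. -/
theorem does_ifPop_cons {r : R} {b : Bool} {l : List Bool} (hr : s.reg r = b :: l)
    (h : Yields p ((s.setReg r l).setV (some (some b))) T s₁) :
    Does (ifPop r p q) s (T + 2) s₁ := by
  intro w
  obtain ⟨w', h⟩ := h
  refine ⟨w', ((RunsIn.op (opPop r) (s.setV w)).seq (RunsIn.ite_pos (T := T) ?_ ?_)).mono
    (by omega)⟩
  · simp [opPop, hr, vSome, St.ctl]
  · simpa [opPop, hr] using h

theorem does_ifPop_nil {r : R} (hr : s.reg r = []) (h : Does q s T s₁) :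
    Does (ifPop r p q) s (T + 2) s₁ := by
  intro w
  obtain ⟨w', h⟩ := h none
  refine ⟨w', ((RunsIn.op (opPop r) (s.setV w)).seq (RunsIn.ite_neg (T := T) ?_ ?_)).mono
    (by omega)⟩
  · simp [opPop, hr, vSome, St.ctl]
  · have e : (s.setV none).setReg r [] = s.setV none := by
      rw [← hr]; exact St.setReg_self _ _
    simpa [opPop, hr, e] using h

/-- Empty a register; for each of its bits, put the bit in the scratch cell and run `body`. -/
def foreach (r : R) (body : VProg M R) : VProg M R :=
  .op (opPop r) ⨾ .while vSome (body ⨾ .op (opPop r))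

/-- The loop `foreach`, for states `F a l`, where `a` is the data the body acts on and `l` is what
is left in the register. -/
theorem yields_foreach {α : Type} {r : R} {body : VProg M R} (F : α → List Bool → St M R)
    (g : α → Bool → α) (P : α → Prop) (hr : ∀ a l, (F a l).reg r = l)
    (hbody : ∀ a b l, P a →
      Yields body (((F a (b :: l)).setReg r l).setV (some (some b))) T (F (g a b) l) ∧ P (g a b))
    (a : α) (l : List Bool) (ha : P a) (w : Option (Option Bool)) :
    RunsIn (foreach r body) ((F a l).setV w) (l.length * (T + 2) + 2)
      ((F (l.foldl g a) []).setV none) := by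
  -- At the loop test the next bit is already in the scratch cell, so the invariant describes the
  -- state just after the pop.
  have key : ∀ (l : List Bool) (a : α), P a →
      RunsIn (.while vSome (body ⨾ .op (opPop r))) ((opPop r).run (F a l))
        (l.length * (T + 2) + 1) ((F (l.foldl g a) []).setV none) := by
    intro l
    induction l with
    | nil =>
      intro a ha
      have : (opPop r).run (F a []) = (F a []).setV none := by
        simp only [opPop, hr, List.head?_nil, Option.map_none, List.tail_nil]
        conv_rhs => rw [← St.setReg_self (F a []) r, hr]
        rfl
      rw [this]
      exact (RunsIn.while_false rfl).mono (by omega)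
    | cons b l ih =>
      intro a ha
      obtain ⟨⟨w', hb⟩, hP⟩ := hbody a b l ha
      have hb' : RunsIn body ((opPop r).run (F a (b :: l))) T ((F (g a b) l).setV w') := by
        convert hb using 1
        simp [opPop, hr]
      have e : (opPop r).run ((F (g a b) l).setV w') = (opPop r).run (F (g a b) l) := by
        simp [opPop]
      refine (RunsIn.while_true (T := T + 1) (T₁ := l.length * (T + 2) + 1) ?_
        (hb'.seq (RunsIn.op (opPop r) _)) ?_).mono ?_
      · simp [opPop, hr, vSome, St.ctl]
      · rw [e]
        exact ih _ hP
      · simp only [List.length_cons, Nat.add_mul]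
        omega
  have e : (opPop r).run ((F a l).setV w) = (opPop r).run (F a l) := by simp [opPop]
  exact ((RunsIn.op (opPop r) _).seq (e ▸ key l a ha)).mono (by omega)

theorem does_foreach {α : Type} {r : R} {body : VProg M R} (F : α → List Bool → St M R)
    (g : α → Bool → α) (P : α → Prop) (hr : ∀ a l, (F a l).reg r = l)
    (hbody : ∀ a b l, P a →
      Yields body (((F a (b :: l)).setReg r l).setV (some (some b))) T (F (g a b) l) ∧ P (g a b))
    (a : α) (l : List Bool) (ha : P a) :
    Does (foreach r body) (F a l) (l.length * (T + 2) + 2) (F (l.foldl g a) []) :=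
  fun w => ⟨none, yields_foreach F g P hr hbody a l ha w⟩

/-- Empty a register. -/
def clear (r : R) : VProg M R := foreach r nop

theorem does_clear (r : R) (s : St M R) :
    Does (clear r) s ((s.reg r).length * 3 + 2) (s.setReg r []) := by
  have := does_foreach (T := 1) (body := nop) (r := r) (fun (_ : Unit) l => s.setReg r l)
    (fun _ _ => ()) (fun _ => True) (by simp)
    (fun a b l _ => ⟨by simpa using (does_nop (s.setReg r l)) (some (some b)), trivial⟩) ()
    (s.reg r) trivial
  simpa [clear] using this

/-- Move a register to another one, reversing it. -/
def move (a b : R) : VProg M R := foreach a (pushV b)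

theorem foldl_flip_cons (l a : List Bool) : l.foldl (fun a b => b :: a) a = l.reverse ++ a := by
  induction l generalizing a with
  | nil => rfl
  | cons b l ih => simp [ih]

theorem does_move {a b : R} (h : a ≠ b) (s : St M R) :
    Does (move a b) s ((s.reg a).length * 3 + 2)
      ((s.setReg a []).setReg b ((s.reg a).reverse ++ s.reg b)) := by
  have := does_foreach (T := 1) (body := pushV b) (r := a)
    (fun (x : List Bool) l => (s.setReg a l).setReg b x)
    (fun x c => c :: x) (fun _ => True) (by simp [h])
    (fun x c l _ => ⟨?_, trivial⟩) (s.reg b)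
    (s.reg a) trivial
  · rw [foldl_flip_cons] at this
    refine this.congr (St.ext_reg fun r => ?_) le_rfl rfl
    simp
  · refine RunsIn.yields (w := some (some c)) (runs_pushV b _) rfl ?_
    refine St.ext_reg fun r => ?_
    simp [bitOf, Function.update_apply]
    split_ifs <;> simp_all

/-- Add a copy of the register `a` in front of the register `b`, using the empty register `t`. -/
def copy (a b t : R) : VProg M R := move a t ⨾ foreach t (pushV a ⨾ pushV b)

/-- Moving to `t` reverses the string and moving back reverses it again; on the way back each bit
goes both to `a`, which is thereby restored, and to `b`. -/
theorem does_copy {a b t : R} (hab : a ≠ b) (hat : a ≠ t) (hbt : b ≠ t) (s : St M R)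
    (ht : s.reg t = []) :
    Does (copy a b t) s ((s.reg a).length * 7 + 4) (s.setReg b (s.reg a ++ s.reg b)) := by
  have h₁ := does_move hat s
  have h₂ := does_foreach (T := 2) (body := pushV a ⨾ pushV b) (r := t)
    (fun (x : List Bool) l => ((s.setReg t l).setReg a x).setReg b (x ++ s.reg b))
    (fun x c => c :: x) (fun _ => True) (by simp [hat.symm, hbt.symm])
    (fun x c l _ => ⟨?_, trivial⟩) [] (s.reg a).reverse trivial
  · rw [foldl_flip_cons] at h₂
    refine (h₁.seq (h₂.congr (T₁ := (s.reg a).length * 4 + 2) (St.ext_reg fun r => ?_) (by simp)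
      (St.ext_reg fun r => ?_))).mono (by omega)
    all_goals
      simp [Function.update_apply, ht]
      split_ifs <;> simp_all
  · refine RunsIn.yields (w := some (some c)) ((runs_pushV a _).seq (runs_pushV b _)) rfl ?_
    refine St.ext_reg fun r => ?_
    simp [bitOf, Function.update_apply, hab, hat, hbt]
    split_ifs <;> simp_all

/-- Add the numeral `0^n` for the length `n` of the register `a` in front of the register `b`,
using the empty register `t`. -/
def tally (a b t : R) : VProg M R := move a t ⨾ foreach t (pushV a ⨾ push b false)

theorem does_tally {a b t : R} (hab : a ≠ b) (hat : a ≠ t) (hbt : b ≠ t) (s : St M R)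
    (ht : s.reg t = []) :
    Does (tally a b t) s ((s.reg a).length * 7 + 4)
      (s.setReg b (List.replicate (s.reg a).length false ++ s.reg b)) := by
  have h₁ := does_move hat s
  have h₂ := does_foreach (T := 2) (body := pushV a ⨾ push b false) (r := t)
    (fun (x : List Bool) l => ((s.setReg t l).setReg a x).setReg b
      (List.replicate x.length false ++ s.reg b))
    (fun x c => c :: x) (fun _ => True) (by simp [hat.symm, hbt.symm])
    (fun x c l _ => ⟨?_, trivial⟩) [] (s.reg a).reverse trivial
  · rw [foldl_flip_cons] at h₂
    refine (h₁.seq (h₂.congr (T₁ := (s.reg a).length * 4 + 2) (St.ext_reg fun r => ?_) (by simp)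
      (St.ext_reg fun r => ?_))).mono (by omega)
    all_goals
      simp [Function.update_apply, ht]
      split_ifs <;> simp_all
  · refine RunsIn.yields (w := some (some c))
      ((runs_pushV a _).seq (RunsIn.op (opPush b fun _ => false) _)) rfl ?_
    refine St.ext_reg fun r => ?_
    simp [bitOf, Function.update_apply, hab, hat, hbt, opPush]
    split_ifs <;> simp_all [List.replicate_succ]

end Macros

end AdviceComplexity

/-! ## Programs: arithmetic, reading the input, enumeration of strings -/

namespace AdviceComplexity

open Turing TM2

set_option linter.unusedSectionVars false

section Macros

variable {ι R : Type} [DecidableEq ι] [DecidableEq R]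
variable {M : ι → Machine}
variable {p q : VProg M R} {s s₁ s₂ : St M R} {T T₁ T₂ : ℕ}

/-- The unary numeral. -/
abbrev num (n : ℕ) : List Bool := List.replicate n false

/-- With `0^n` in the register `x`, write `0^(n^d)` in the empty register `a`, using the empty
registers `b` and `t`. -/
def pow (x a b t : R) : ℕ → VProg M R
  | 0 => push a false
  | d + 1 => pow x a b t d ⨾ foreach a (copy x b t) ⨾ move b a

/-- The running time of `pow`. -/
def powTime (n : ℕ) : ℕ → ℕ
  | 0 => 1
  | d + 1 => powTime n d + (n ^ d * (7 * n + 6) + 2 + (n ^ d * n * 3 + 2))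

theorem foldl_add_const (n a : ℕ) (l : List Bool) :
    l.foldl (fun a _ => a + n) a = a + l.length * n := by
  induction l generalizing a with
  | nil => simp
  | cons b l ih => simp only [List.foldl_cons, ih, List.length_cons]; ring

/-- Multiplication by n is repeated addition: each of the n ^ d bits of `a` causes a copy of `x` to
be added to `b`. Numerals consist of equal bits, so the reversal by `move` does no harm. -/
theorem does_pow {x a b t : R} (hxa : x ≠ a) (hxb : x ≠ b) (hxt : x ≠ t) (hab : a ≠ b)
    (hat : a ≠ t) (hbt : b ≠ t) (s : St M R) {n : ℕ} (hx : s.reg x = num n) (ha : s.reg a = [])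
    (hb : s.reg b = []) (ht : s.reg t = []) (d : ℕ) :
    Does (pow x a b t d) s (powTime n d) (s.setReg a (num (n ^ d))) := by
  induction d with
  | zero =>
    refine (does_push a false s).congr rfl le_rfl ?_
    simp [ha]
  | succ d ih =>
    have h₂ := does_foreach (T := 7 * n + 4) (body := copy x b t) (r := a)
      (fun (m : ℕ) l => (s.setReg a l).setReg b (num m)) (fun m _ => m + n) (fun _ => True)
      (by simp [hab]) (fun m c l _ => ⟨?_, trivial⟩) 0 (num (n ^ d)) trivial
    · have h₃ := does_move hab.symm ((s.setReg a []).setReg b (num (n ^ d * n)))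
      refine ih.seq ((h₂.seq (h₃.congr ?_ le_rfl rfl)).congr ?_ ?_ ?_)
      · rw [foldl_add_const]; simp
      · refine St.ext_reg fun r => ?_
        simp [Function.update_apply]
        rintro rfl
        simp [hab.symm, hb]
      · simp
      · refine St.ext_reg fun r => ?_
        simp [Function.update_apply, pow_succ, hab]
        split_ifs <;> simp_all
    · have h₁ := does_copy hxb hxt hbt ((s.setReg a l).setReg b (num m))
        (by simp [hat.symm, hbt.symm, ht])
      refine (h₁ (some (some c))).elim fun w h => ⟨w, ?_⟩
      convert h using 1
      · refine St.ext_reg fun r => ?_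
        simp [Function.update_apply]
        split_ifs <;> simp_all
      · simp [hxa, hxb, hx, Nat.mul_comm]
      · refine St.ext_reg fun r => ?_
        simp [Function.update_apply, hxa, hxb, hx]
        split_ifs <;> simp_all
        omega

/-- Push `0^k`. -/
def pushNum (r : R) : ℕ → VProg M R
  | 0 => nop
  | k + 1 => pushNum r k ⨾ push r false

theorem does_pushNum (r : R) (k : ℕ) (s : St M R) :
    Does (pushNum r k) s (k + 1) (s.setReg r (num k ++ s.reg r)) := by
  induction k with
  | zero => exact (does_nop s).congr rfl le_rfl (by simp)
  | succ k ih =>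
    refine (ih.seq (does_push r false _)).congr rfl le_rfl ?_
    simp [List.replicate_succ]

/-- With `0^n` in the register `x`, write `0^(n^k+k)` in the empty register `a`, using the empty
registers `b` and `t`. -/
def clock (x a b t : R) (k : ℕ) : VProg M R := pow x a b t k ⨾ pushNum a k

theorem does_clock {x a b t : R} (hxa : x ≠ a) (hxb : x ≠ b) (hxt : x ≠ t) (hab : a ≠ b)
    (hat : a ≠ t) (hbt : b ≠ t) (s : St M R) {n : ℕ} (hx : s.reg x = num n) (ha : s.reg a = [])
    (hb : s.reg b = []) (ht : s.reg t = []) (k : ℕ) :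
    Does (clock x a b t k) s (powTime n k + (k + 1)) (s.setReg a (num (polyBound k n))) := by
  refine ((does_pow hxa hxb hxt hab hat hbt s hx ha hb ht k).seq (does_pushNum a k _)).congr
    rfl le_rfl ?_
  simp [polyBound, List.replicate_append_replicate, Nat.add_comm]

/-- Move a string of the input, and the separator behind it, to the register `r`, using the empty
register `t`. -/
def readField (r t : R) : VProg M R :=
  .op opInp ⨾ .while vBit (pushV t ⨾ .op opInp) ⨾ move t r

theorem does_readField {r t : R} (hrt : r ≠ t) (s : St M R) {w : List Bool}
    {z : List (Option Bool)} (hi : s.inp = w.map some ++ none :: z) (ht : s.reg t = []) :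
    Does (readField r t) s (w.length * 6 + 4) ((s.setInp z).setReg r (w ++ s.reg r)) := by
  -- Here `x` is the part of the field read so far, stored in `t` in reverse order.
  have key : ∀ (w x : List Bool) (s : St M R), s.inp = w.map some ++ none :: z →
      s.reg t = x → RunsIn (.while vBit (pushV t ⨾ .op opInp)) (opInp.run s) (w.length * 3 + 1)
        (((s.setInp z).setReg t (w.reverse ++ x)).setV (some none)) := by
    intro w
    induction w with
    | nil =>
      intro x s hi ht
      have : opInp.run s = ((s.setInp z).setReg t ([].reverse ++ x)).setV (some none) := by
        refine St.ext_reg (fun r => ?_) ?_ ?_ ?_ <;> simp [opInp, hi, Function.update_apply]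
        rintro rfl; exact ht
      rw [this]
      exact (RunsIn.while_false rfl).mono (by omega)
    | cons b w ih =>
      intro x s hi ht
      have := ih (b :: x) ((opPush t bitOf).run (opInp.run s)) (by simp [opPush, opInp, hi])
        (by simp [opPush, opInp, hi, ht, bitOf])
      have h := RunsIn.while_true (b := vBit) (s := opInp.run s)
        (by simp [vBit, St.ctl, opInp, hi])
        ((RunsIn.op (opPush t bitOf) (opInp.run s)).seq (RunsIn.op opInp _)) this
      have e : ((((opPush t bitOf).run (opInp.run s)).setInp z).setReg t
          (w.reverse ++ b :: x)).setV (some none) =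
          ((s.setInp z).setReg t ((b :: w).reverse ++ x)).setV (some none) := by
        refine St.ext_reg (fun r => ?_) ?_ ?_ ?_ <;>
          simp [opInp, opPush, Function.update_apply]
        split_ifs <;> simp
      rw [e] at h
      refine h.mono ?_
      simp only [List.length_cons]
      omega
  intro v
  have e : opInp.run (s.setV v) = opInp.run s := by simp [opInp]
  have h₁ := key w [] s hi ht
  obtain ⟨w', h₂⟩ := does_move hrt.symm ((s.setInp z).setReg t (w.reverse ++ [])) (some none)
  refine ⟨w', ((RunsIn.op opInp _).seq (e ▸ h₁.seq h₂)).congr rfl ?_ ?_⟩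
  · simp; omega
  · refine St.ext_reg fun r' => ?_
    simp [Function.update_apply]
    split_ifs <;> simp_all

/-- Binary increment, least significant bit first. -/
def incr : List Bool → List Bool
  | [] => []
  | false :: l => true :: l
  | true :: l => false :: incr l

/-- Is there an overflow in the binary increment? -/
def overflows (l : List Bool) : Bool := l.all id

@[simp] theorem length_incr (l : List Bool) : (incr l).length = l.length := by
  induction l with
  | nil => rfl
  | cons b l ih => cases b <;> simp [incr, ih]

theorem incr_of_overflows {l : List Bool} (h : overflows l = true) : incr l = num l.length := by
  induction l with
  | nil => rfl
  | cons b l ih =>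
    cases b
    · simp [overflows] at h
    · have : overflows l = true := by simpa [overflows] using h
      simp [incr, ih this, List.replicate_succ]

/-- Increment the register `r`, and push a bit on the register `o` if there is no overflow;
the register `t` is empty. -/
def inc (r t o : R) : VProg M R :=
  .op (opPop r) ⨾ .while vTrue (push t false ⨾ .op (opPop r)) ⨾
    .ite vSome (push r true ⨾ push o true) nop ⨾ move t r

/-- The carry turns the leading ones into zeros, parked in `t`, until a zero is met and becomes a
one. Moving the parked zeros back completes the increment. If the register runs out first, this is
the overflow, and only zeros remain. -/
theorem does_inc {r t o : R} (hrt : r ≠ t) (hro : r ≠ o) (hto : t ≠ o) (s : St M R)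
    (ht : s.reg t = []) :
    Does (inc r t o) s ((s.reg r).length * 6 + 7) ((s.setReg r (incr (s.reg r))).setReg o
      (if overflows (s.reg r) then s.reg o else true :: s.reg o)) := by
  -- In the induction `x` zeros are already parked in `t`. The number `y` parked at the end stays
  -- unspecified, apart from its bound and the equation for the string after moving back.
  have key : ∀ (l : List Bool) (x : ℕ) (s : St M R), s.reg r = l → s.reg t = num x →
      ∃ y, y ≤ l.length + x ∧ ∃ s', RunsIn (.while vTrue (push t false ⨾ .op (opPop r)) ⨾
        .ite vSome (push r true ⨾ push o true) nop) ((opPop r).run s) (l.length * 3 + 4) s' ∧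
        s'.inp = s.inp ∧ s'.cfg = s.cfg ∧ s'.reg t = num y ∧
        num y ++ s'.reg r = num x ++ incr l ∧
        s'.reg o = (if overflows l then s.reg o else true :: s.reg o) ∧
        ∀ r', r' ≠ r → r' ≠ t → r' ≠ o → s'.reg r' = s.reg r' := by
    intro l
    induction l with
    | nil =>
      intro x s hr ht
      refine ⟨x, by omega, (opPop r).run s, ?_, ?_⟩
      · exact ((RunsIn.while_false (by simp [vTrue, opPop, hr, St.ctl])).seq (RunsIn.ite_neg
          (by simp [vSome, opPop, hr, St.ctl]) (RunsIn.op (opV id) _))).mono (by omega)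
      · refine ⟨by simp [opPop], by simp [opPop], by simp [opPop, hrt.symm, ht],
          by simp [opPop, hr, incr], by simp [opPop, hro.symm, overflows], fun r' h _ _ => ?_⟩
        simp [opPop, h]
    | cons b l ih =>
      intro x s hr ht
      cases b with
      | false =>
        refine ⟨x, by omega, (((opPop r).run s).setReg r (true :: l)).setReg o
          (true :: s.reg o), ?_, ?_⟩
        · have h₁ : RunsIn (.while vTrue (push t false ⨾ .op (opPop r))) ((opPop r).run s) 1
            ((opPop r).run s) := RunsIn.while_false (by simp [vTrue, opPop, hr, St.ctl])
          refine (h₁.seq (RunsIn.ite_pos (T := 2) (by simp [vSome, opPop, hr, St.ctl]) ?_)).mono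
            (by simp)
          refine ((RunsIn.op (opPush r fun _ => true) _).seq
            (RunsIn.op (opPush o fun _ => true) _)).congr rfl le_rfl ?_
          simp [opPush, opPop, hr, hro.symm]
        · refine ⟨by simp [opPop], by simp [opPop], by simp [opPop, hrt.symm, hto, ht],
            by simp [incr, hro], by simp [overflows], fun r' h _ h' => ?_⟩
          simp [opPop, h, h']
      | true =>
        obtain ⟨y, hy, s', h, hi, hc, h₁, h₂, h₃, h₄⟩ := ih (x + 1)
          ((opPush t fun _ => false).run ((opPop r).run s))
          (by simp [opPush, opPop, hr, hrt])
          (by simp [opPush, opPop, ht, hrt.symm, List.replicate_succ])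
        refine ⟨y, by simp; omega, s', ?_, ?_, ?_, h₁, ?_, ?_, ?_⟩
        -- The inductive run consists of the loop and the final branch; it is split so that one more
        -- round goes in front of the loop.
        · obtain ⟨t', ht', h⟩ := h
          cases h with
          | seq ha hb =>
            refine ⟨_, ?_, Runs.seq (Runs.while_true ?_ (Runs.seq (Runs.op _ _) (Runs.op _ _)) ha)
              hb⟩
            · simp only [List.length_cons]; omega
            · simp [vTrue, opPop, hr, St.ctl]
        · simpa [opPush, opPop] using hi
        · simpa [opPush, opPop] using hc
        · rw [h₂]
          simp [incr, List.replicate_succ']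
        · rw [h₃]
          simp [overflows, opPush, opPop, hto.symm, hro.symm]
        · intro r' a b c
          rw [h₄ r' a b c]
          simp [opPush, opPop, a, b]
  intro v
  obtain ⟨y, hy, s', h, hi, hc, h₁, h₂, h₃, h₄⟩ := key (s.reg r) 0 s rfl (by simpa using ht)
  obtain ⟨w', h'⟩ := does_move hrt.symm s' s'.v
  have e : (opPop r).run (s.setV v) = (opPop r).run s := by simp [opPop]
  obtain ⟨t₁, ht₁, h⟩ := h
  obtain ⟨t₂, ht₂, h'⟩ := h'
  cases h with
  | seq ha hb =>
    refine ⟨w', 1 + (_ + (_ + t₂)), ?_,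
      Runs.seq (Runs.op _ _) (Runs.seq (e ▸ ha) (Runs.seq hb ?_))⟩
    · rw [h₁] at ht₂
      simp at ht₂
      omega
    · refine Eq.mp (congrArg (Runs _ _ _) (St.ext_reg (fun r' => ?_) ?_ ?_ ?_)) h' <;>
        simp [hi, hc]
      simp only [Function.update_apply]
      by_cases a : r' = r
      · subst a
        simpa [hro, h₁] using h₂
      · by_cases c : r' = o
        · subst c
          simpa [hro.symm, hto.symm] using h₃
        · by_cases b : r' = t
          · subst b
            simp [a, c, ht]
          · simp [a, b, c, h₄ r' a b c]

/-- The binary strings of length `n`, in the order of `incr`. -/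
def enum : ℕ → List (List Bool)
  | 0 => [[]]
  | n + 1 => (enum n).flatMap fun w => [false :: w, true :: w]

/-- Successive strings in the order of `incr`, up to an overflow. -/
def IsRun : List (List Bool) → Prop
  | [] => False
  | [w] => overflows w = true
  | w :: w' :: L => overflows w = false ∧ w' = incr w ∧ IsRun (w' :: L)

/-- With a new lowest bit in front, going from 0 to 1 causes no carry, and going from 1 to 0
increments the rest. -/
theorem isRun_flatMap {L : List (List Bool)} (h : IsRun L) :
    IsRun (L.flatMap fun w => [false :: w, true :: w]) := by
  induction L with
  | nil => exact h
  | cons w L ih =>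
    cases L with
    | nil =>
      have : overflows w = true := h
      simpa [IsRun, overflows, incr] using this
    | cons w' L =>
      obtain ⟨h₁, h₂, h₃⟩ := h
      have := ih h₃
      simp only [List.flatMap_cons, List.cons_append, List.nil_append] at this ⊢
      refine ⟨by simp [overflows], by simp [incr], by simpa [overflows] using h₁,
        by simp [incr, h₂], this⟩

theorem isRun_enum (n : ℕ) : IsRun (enum n) := by
  induction n with
  | zero => rfl
  | succ n ih => exact isRun_flatMap ih

theorem mem_enum {n : ℕ} {w : List Bool} : w ∈ enum n ↔ w.length = n := by
  induction n generalizing w with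
  | zero => simp [enum]
  | succ n ih =>
    simp only [enum, List.mem_flatMap, ih]
    constructor
    · rintro ⟨a, ha, h⟩
      simp only [List.mem_cons, List.not_mem_nil, or_false] at h
      rcases h with rfl | rfl <;> simp [ha]
    · intro h
      cases w with
      | nil => simp at h
      | cons b w =>
        refine ⟨w, by simpa using h, ?_⟩
        cases b <;> simp

theorem length_enum (n : ℕ) : (enum n).length = 2 ^ n := by
  induction n with
  | zero => rfl
  | succ n ih => simp [enum, List.length_flatMap, ih, pow_succ]

theorem nodup_enum (n : ℕ) : (enum n).Nodup := by
  induction n with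
  | zero => simp [enum]
  | succ n ih =>
    refine List.nodup_flatMap.2 ⟨fun w _ => by simp, ?_⟩
    refine ih.imp fun {a b} hab => ?_
    simp [Function.onFun, List.disjoint_left, hab]

theorem enum_eq_cons (n : ℕ) : ∃ L, enum n = num n :: L := by
  induction n with
  | zero => exact ⟨[], rfl⟩
  | succ n ih =>
    obtain ⟨L, hL⟩ := ih
    exact ⟨_, by simp [enum, hL, List.replicate_succ]; rfl⟩

/-- With `0^n` in the register `r`, let it run through all strings of its length, and run `body`
for each; the registers `t` and `o` are empty. -/
def forBits (r t o : R) (body : VProg M R) : VProg M R :=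
  push o true ⨾ foreach o (body ⨾ inc r t o)

/-- The register `o` holds a bit exactly as long as the loop is to continue: `inc` pushes one unless
the counter overflows. The overflow resets the counter to zeros, so `r` ends as it began. -/
theorem does_forBits {α : Type} {r t o : R} (hrt : r ≠ t) (hro : r ≠ o) (hto : t ≠ o)
    {body : VProg M R} (F : α → List Bool → St M R) (g : α → List Bool → α) (P : α → Prop)
    (hr : ∀ a w, (F a w).reg r = w) (ht : ∀ a w, (F a w).reg t = [])
    (ho : ∀ a w, (F a w).reg o = []) (hF : ∀ a w w', (F a w).setReg r w' = F a w') (n : ℕ)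
    (hbody : ∀ a w, w.length = n → P a → Does body (F a w) T (F (g a w) w) ∧ P (g a w))
    (a : α) (ha : P a) :
    Does (forBits r t o body) (F a (num n)) (2 ^ n * (T + (6 * n + 9)) + 4)
      (F ((enum n).foldl g a) (num n)) := by
  -- The body refills `o`, so `does_foreach` does not apply, and the loop is followed along the list
  -- `L` of strings still to come.
  have key : ∀ (L : List (List Bool)) (a : α), IsRun L → (∀ w ∈ L, w.length = n) → P a →
      ∀ s, (L.head?.map fun w => (opPop o).run ((F a w).setReg o [true])) = some s →
      RunsIn (.while vSome ((body ⨾ inc r t o) ⨾ .op (opPop o))) s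
        (L.length * (T + (6 * n + 9)) + 1) ((F (L.foldl g a) (num n)).setV none) := by
    intro L
    induction L with
    | nil => exact fun a h => h.elim
    | cons w L ih =>
      intro a hL hlen ha s hs
      have hw : w.length = n := hlen w (by simp)
      have hs : (opPop o).run ((F a w).setReg o [true]) = s := by simpa using hs
      have hs' : s = (F a w).setV (some (some true)) := by
        rw [← hs]
        refine St.ext_reg (fun r => ?_) ?_ ?_ ?_ <;> simp [opPop, Function.update_apply]
        rintro rfl; rw [ho]
      obtain ⟨hb, hP⟩ := hbody a w hw ha
      have h := hb.seq (does_inc hrt hro hto _ (ht _ _))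
      rw [hr, ho, hF] at h
      obtain ⟨v, h⟩ := h (some (some true))
      have hv : vSome s.ctl = true := by simp [hs', vSome, St.ctl]
      rw [← hs'] at h
      cases L with
      | nil =>
        have hov : overflows w = true := hL
        rw [if_pos hov, incr_of_overflows hov, hw] at h
        have e : (opPop o).run (((F (g a w) (num n)).setReg o []).setV v) =
            (F (g a w) (num n)).setV none := by
          refine St.ext_reg (fun r => ?_) ?_ ?_ ?_ <;> simp [opPop, Function.update_apply]
          rintro rfl; rw [ho]
        refine (RunsIn.while_true hv (h.seq (RunsIn.op (opPop o) _))
          (T₁ := 1) (s₂ := (F (g a w) (num n)).setV none) ?_).mono ?_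
        · rw [e]
          exact RunsIn.while_false rfl
        · simp; omega
      | cons w' L =>
        obtain ⟨h₁, rfl, h₃⟩ := hL
        rw [h₁] at h
        refine (RunsIn.while_true hv (h.seq (RunsIn.op (opPop o) _))
          (ih (g a w) h₃ (fun x hx => hlen x (List.mem_cons_of_mem _ hx)) hP _ ?_)).mono ?_
        · simp [opPop]
        · simp only [List.length_cons, hw]
          ring_nf
          omega
  intro v
  obtain ⟨L, hL⟩ := enum_eq_cons n
  have := key (enum n) a (isRun_enum n) (fun w hw => mem_enum.1 hw) ha
    ((opPop o).run ((F a (num n)).setReg o [true])) (by simp [hL])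
  obtain ⟨w, h₁⟩ := does_push o true (F a (num n)) v
  rw [ho] at h₁
  have e : (opPop o).run (((F a (num n)).setReg o [true]).setV w) =
      (opPop o).run ((F a (num n)).setReg o [true]) := by simp [opPop]
  refine ⟨none, (h₁.seq ((RunsIn.op (opPop o) _).seq (e ▸ this))).mono ?_⟩
  rw [length_enum]
  omega

end Macros

end AdviceComplexity

/-! ## Programs that run the embedded machines -/

namespace AdviceComplexity

open Turing TM2

set_option linter.unusedSectionVars false

section Simulation

/-- Push a string on the input stack of a configuration. -/
def Machine.feedList (M : Machine) (z : List (Option Bool)) (c : M.Cfg) : M.Cfg :=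
  ⟨c.l, c.var, Function.update c.stk M.tm.k₀
    (z.map M.inputAlphabet.symm ++ c.stk M.tm.k₀)⟩

/-- The initial configuration. -/
def Machine.startCfg (M : Machine) (z : List (Option Bool)) : M.Cfg :=
  M.feedList z ⟨some M.tm.main, M.tm.initialState, fun _ => []⟩

/-- The bit on top of the output stack after `t` steps. -/
def Machine.result (M : Machine) (t : ℕ) (ws : List (List Bool)) : Bool :=
  M.topOut (M.next^[t] (M.startCfg (encodeInput ws)))

theorem Machine.feedList_nil (M : Machine) (c : M.Cfg) : M.feedList [] c = c := by
  simp [feedList]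

theorem Machine.feed_feedList (M : Machine) (a : Option Bool) (z : List (Option Bool))
    (c : M.Cfg) : M.feed a (M.feedList z c) = M.feedList (a :: z) c := by
  simp [feedList, feed]

theorem Machine.feedList_append (M : Machine) (y z : List (Option Bool)) (c : M.Cfg) :
    M.feedList y (M.feedList z c) = M.feedList (y ++ z) c := by
  simp [feedList]

theorem initList_eq_startCfg (M : Machine) (z : List (Option Bool)) :
    initList M.tm (z.map M.inputAlphabet.symm) = M.startCfg z := by
  unfold initList Machine.startCfg Machine.feedList
  congr 1
  funext k
  by_cases h : k = M.tm.k₀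
  · subst h
    simp
  · simp [h]

theorem Machine.next_of_halted (M : Machine) {c : M.Cfg} (h : c.l = none) : M.next c = c := by
  rcases c with ⟨l, w, T⟩
  simp only at h
  subst h
  rfl

theorem Machine.iterate_next_of_halted (M : Machine) {c : M.Cfg} (h : c.l = none) (n : ℕ) :
    M.next^[n] c = c :=
  Function.iterate_fixed (M.next_of_halted h) n

theorem Machine.iterate_next_of_steps (M : Machine) {c c' : M.Cfg} {n : ℕ}
    (h : (flip bind (TM2.step M.tm.m))^[n] (some c) = some c') : M.next^[n] c = c' := by
  induction n generalizing c with
  | zero => simpa using h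
  | succ n ih =>
    rw [Function.iterate_succ_apply] at h ⊢
    change (flip bind (TM2.step M.tm.m))^[n] (TM2.step M.tm.m c) = _ at h
    cases hs : TM2.step M.tm.m c with
    | none =>
      rw [hs] at h
      have : ∀ n, (flip bind (TM2.step M.tm.m))^[n] none = none := fun n =>
        Function.iterate_fixed rfl n
      rw [this] at h
      cases h
    | some d =>
      rw [hs] at h
      have : M.next c = d := by simp [Machine.next, hs]
      rw [this]
      exact ih h

/-- The machine halts at some time up to `t`, and `Machine.next` fixes halting configurations. So
running it for exactly `t` steps yields the output. -/
theorem OutputsWithin.iterate_next {M : Machine} {ws : List (List Bool)} {y : List Bool} {t : ℕ}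
    (h : OutputsWithin M ws y t) :
    M.next^[t] (M.startCfg (encodeInput ws)) = haltList M.tm (y.map M.outputAlphabet.symm) := by
  obtain ⟨⟨⟨n, h⟩, hn⟩⟩ := h
  rw [initList_eq_startCfg] at h
  have := M.iterate_next_of_steps h
  obtain ⟨m, rfl⟩ := Nat.exists_eq_add_of_le hn
  rw [Nat.add_comm, Function.iterate_add_apply]
  rw [this]
  exact M.iterate_next_of_halted rfl m

theorem OutputsWithin.result_eq {M : Machine} {ws : List (List Bool)} {b : Bool} {t : ℕ}
    (h : OutputsWithin M ws [b] t) : M.result t ws = b := by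
  rw [Machine.result, h.iterate_next]
  simp [Machine.topOut, haltList]

/-- A bound for the number of symbols pushed by a statement. -/
def pushes {K : Type} {Γ : K → Type} {Λ σ : Type} : TM2.Stmt Γ Λ σ → ℕ
  | .push _ _ q => pushes q + 1
  | .peek _ _ q => pushes q
  | .pop _ _ q => pushes q
  | .load _ q => pushes q
  | .branch _ q₁ q₂ => pushes q₁ + pushes q₂
  | .goto _ => 0
  | .halt => 0

/-- Bounds on the growth of the stacks are needed for the time to empty them after a simulation. -/
theorem length_stepAux_le {K : Type} [DecidableEq K] {Γ : K → Type} {Λ σ : Type}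
    (q : TM2.Stmt Γ Λ σ) (v : σ) (T : ∀ k, List (Γ k)) (k : K) :
    ((TM2.stepAux q v T).stk k).length ≤ (T k).length + pushes q := by
  induction q generalizing v T with
  | push k' f q ih =>
    refine (ih _ _).trans ?_
    by_cases h : k = k'
    · subst h; simp [pushes]; omega
    · simp [pushes, h]
  | pop k' f q ih =>
    refine (ih _ _).trans ?_
    by_cases h : k = k'
    · subst h; simp [pushes]
    · simp [pushes, h]
  | peek k' f q ih => exact ih _ _
  | load f q ih => exact ih _ _
  | branch f q₁ q₂ ih₁ ih₂ =>
    simp only [TM2.stepAux, pushes]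
    cases f v
    · exact (ih₂ _ _).trans (by omega)
    · exact (ih₁ _ _).trans (by omega)
  | goto f => simp [TM2.stepAux, pushes]
  | halt => simp [TM2.stepAux, pushes]

/-- A bound for the number of symbols pushed in a step. -/
def Machine.grow (M : Machine) : ℕ :=
  ∑ l ∈ M.tm.ΛFin.elems, pushes (M.tm.m l)

theorem Machine.length_next_le (M : Machine) (c : M.Cfg) (k : M.tm.K) :
    ((M.next c).stk k).length ≤ (c.stk k).length + M.grow := by
  rcases c with ⟨_ | l, w, T⟩
  · exact Nat.le_add_right _ _
  · refine (length_stepAux_le (M.tm.m l) w T k).trans ?_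
    exact Nat.add_le_add_left
      (Finset.single_le_sum (f := fun l => pushes (M.tm.m l)) (fun _ _ => Nat.zero_le _)
        (M.tm.ΛFin.complete l)) (T k).length

theorem Machine.length_iterate_next_le (M : Machine) (c : M.Cfg) (k : M.tm.K) (n : ℕ) :
    ((M.next^[n] c).stk k).length ≤ (c.stk k).length + n * M.grow := by
  induction n with
  | zero => simp
  | succ n ih =>
    rw [Function.iterate_succ_apply']
    refine (M.length_next_le _ k).trans ?_
    rw [Nat.add_mul]
    omega

theorem Machine.length_startCfg_le (M : Machine) (z : List (Option Bool)) (k : M.tm.K) :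
    ((M.startCfg z).stk k).length ≤ z.length := by
  by_cases h : k = M.tm.k₀
  · subst h; simp [startCfg, feedList]
  · simp [startCfg, feedList, h]

variable {ι R : Type} [DecidableEq ι] [DecidableEq R]
variable {M : ι → Machine}
variable {p q : VProg M R} {s s₁ s₂ : St M R} {T T₁ T₂ : ℕ}

/-- Push the register `r` on the input stack of the machine `M i`, using the empty register
`t`. -/
def feedReg (i : ι) (r t : R) : VProg M R :=
  move r t ⨾ foreach t (pushV r ⨾ .op (opFeed i fun v => v.getD none))

theorem does_feedReg (i : ι) {r t : R} (hrt : r ≠ t) (s : St M R) (ht : s.reg t = []) :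
    Does (feedReg i r t) s ((s.reg r).length * 7 + 4)
      (s.setCfg i ((M i).feedList ((s.reg r).map some) (s.cfg i))) := by
  have h₁ := does_move hrt s
  have h₂ := does_foreach (T := 2) (r := t)
    (body := pushV r ⨾ .op (opFeed i fun v => v.getD none))
    (fun (x : List Bool) l => ((s.setReg t l).setReg r x).setCfg i
      ((M i).feedList (x.map some) (s.cfg i)))
    (fun x c => c :: x) (fun _ => True) (by simp [hrt.symm])
    (fun x c l _ => ⟨?_, trivial⟩) [] (s.reg r).reverse trivial
  · rw [foldl_flip_cons] at h₂
    refine (h₁.seq (h₂.congr (T₁ := (s.reg r).length * 4 + 2) (St.ext_reg (fun r => ?_) ?_ ?_ ?_)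
      (by simp) (St.ext_reg fun r => ?_))).mono (by omega)
    all_goals
      simp [Function.update_apply, ht, Machine.feedList_nil]
      try split_ifs <;> simp_all
  · refine RunsIn.yields (w := some (some c)) ((runs_pushV r _).seq (RunsIn.op (opFeed i _) _))
      rfl ?_
    refine St.ext_reg (fun r => ?_) ?_ ?_ ?_ <;>
      simp [bitOf, Function.update_apply, opFeed, Machine.feed_feedList]
    split_ifs <;> simp_all

/-- Write the contents of registers on the input stack of the machine `M i`. -/
def loadRegs (i : ι) (t : R) : List R → VProg M R
  | [] => .op (opInit i)
  | r :: rs => loadRegs i t rs ⨾ .op (opFeed i fun _ => none) ⨾ feedReg i r t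

theorem encodeInput_cons (w : List Bool) (ws : List (List Bool)) :
    encodeInput (w :: ws) = w.map some ++ none :: encodeInput ws := by
  simp [encodeInput]

/-- The first string has to end on top of the input stack, so the tail of the tuple is pushed before
it, and each separator before its string. -/
theorem does_loadRegs (i : ι) {t : R} (rs : List R) (hrs : t ∉ rs) (s : St M R)
    (ht : s.reg t = []) (hc : s.cfg i = (M i).blank) :
    Does (loadRegs i t rs) s ((encodeInput (rs.map s.reg)).length * 7 + 1)
      (s.setCfg i ((M i).startCfg (encodeInput (rs.map s.reg)))) := by
  induction rs with
  | nil =>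
    refine fun v => RunsIn.yields (w := v) (RunsIn.op (opInit i) _) rfl ?_
    refine St.ext_reg (fun r => ?_) ?_ ?_ ?_ <;>
      simp [opInit, hc, Machine.blank, encodeInput, Machine.startCfg, Machine.feedList_nil]
  | cons r rs ih =>
    have hr : r ≠ t := fun h => hrs (h ▸ List.mem_cons_self)
    have h₁ : Does (.op (opFeed i fun _ => none)) (s.setCfg i ((M i).startCfg
        (encodeInput (rs.map s.reg)))) 1 (s.setCfg i ((M i).startCfg
        (none :: encodeInput (rs.map s.reg)))) := by
      refine fun v => RunsIn.yields (w := v) (RunsIn.op (opFeed i fun _ => none) _) rfl ?_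
      refine St.ext_reg (fun r => ?_) ?_ ?_ ?_ <;>
        simp [opFeed, Machine.startCfg, Machine.feed_feedList]
    refine ((ih fun h => hrs (List.mem_cons_of_mem _ h)).seq
      (h₁.seq (does_feedReg i hr _ (by simpa using ht)))).congr rfl ?_ ?_
    · simp [encodeInput_cons]; omega
    · simp [encodeInput_cons, Machine.startCfg, Machine.feedList_append]

/-- Let the machine `M i` do as many steps as there are bits in the register `c`. -/
noncomputable def runClock (i : ι) (c : R) : VProg M R := foreach c (.op (opStep i))

theorem does_runClock (i : ι) (c : R) (s : St M R) :
    Does (runClock i c) s ((s.reg c).length * 3 + 2)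
      ((s.setReg c []).setCfg i ((M i).next^[(s.reg c).length] (s.cfg i))) := by
  have h := does_foreach (T := 1) (r := c) (body := .op (opStep i))
    (fun (x : (M i).Cfg) l => (s.setReg c l).setCfg i x) (fun x _ => (M i).next x)
    (fun _ => True) (by simp) (fun x b l _ => ⟨?_, trivial⟩) (s.cfg i) (s.reg c) trivial
  · refine h.congr (St.ext_reg fun r => ?_) le_rfl (St.ext_reg (fun r => ?_) ?_ ?_ ?_)
    · simp
    · simp
    · simp
    · simp
    · have : ∀ (l : List Bool) (x : (M i).Cfg), l.foldl (fun x _ => (M i).next x) x =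
          (M i).next^[l.length] x := by
        intro l
        induction l with
        | nil => intro x; rfl
        | cons b l ih => intro x; simp [ih]
      simp [this]
  · refine RunsIn.yields (w := some (some b)) (RunsIn.op (opStep i) _) rfl ?_
    refine St.ext_reg (fun r => ?_) ?_ ?_ ?_ <;> simp [opStep, Function.update_apply]
    split_ifs <;> rfl

/-- Let the machine `M i` run until it halts. -/
noncomputable def runFree (i : ι) : VProg M R := .while (running i) (.op (opStep i))

theorem does_runFree (i : ι) (n : ℕ) (s : St M R) (h : ((M i).next^[n] (s.cfg i)).l = none) :
    Does (runFree i) s (n * 2 + 1) (s.setCfg i ((M i).next^[n] (s.cfg i))) := by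
  induction n generalizing s with
  | zero =>
    refine fun v => RunsIn.yields (w := v) (RunsIn.while_false ?_) rfl ?_
    · have : (s.cfg i).l = none := h
      simp [running, St.ctl, this]
    · simp
  | succ n ih =>
    intro v
    by_cases hl : (s.cfg i).l = none
    · refine (RunsIn.yields (w := v) (RunsIn.while_false ?_) rfl ?_).mono ?_
      · simp [running, St.ctl, hl]
      · simp [(M i).iterate_next_of_halted hl]
      · omega
    · obtain ⟨w, h'⟩ := ih (s.setCfg i ((M i).next (s.cfg i))) (by simpa using h) v
      refine ⟨w, (RunsIn.while_true ?_ (RunsIn.op (opStep i) _)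
        (h'.congr ?_ le_rfl rfl)).congr rfl ?_ ?_⟩
      · simpa [running, St.ctl, Option.isSome_iff_ne_none] using hl
      · simp [opStep]
      · omega
      · simp

/-- Push the top of the output stack of the machine `M i` on the register `r`. -/
def getOut (i : ι) (r : R) : VProg M R := .op (opOut i) ⨾ pushV r

theorem does_getOut (i : ι) (r : R) (s : St M R) :
    Does (getOut i r) s 2 (s.setReg r ((M i).topOut (s.cfg i) :: s.reg r)) := by
  refine fun v => RunsIn.yields (w := some (some ((M i).topOut (s.cfg i))))
    ((RunsIn.op (opOut i) _).seq (runs_pushV r _)) rfl ?_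
  refine St.ext_reg (fun r => ?_) ?_ ?_ ?_ <;> simp [opOut, bitOf]

/-- Empty the stacks of the machine `M i`. -/
noncomputable def wipe (i : ι) : VProg M R :=
  .op (opV fun _ => some none) ⨾ .while vSome (.op (opDrain i))

/-- Each round removes one symbol from every stack and notes whether there was any. After `H` rounds
all stacks are empty, and one more round detects this. -/
theorem does_wipe (i : ι) (H : ℕ) (s : St M R) (h : ∀ k, ((s.cfg i).stk k).length ≤ H) :
    Does (wipe i) s (H * 2 + 4) (s.setCfg i (M i).blank) := by
  have key : ∀ (H : ℕ) (s : St M R), (∀ k, ((s.cfg i).stk k).length ≤ H) → vSome s.ctl = true →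
      RunsIn (.while vSome (.op (opDrain i))) s (H * 2 + 3)
        ((s.setCfg i (M i).blank).setV none) := by
    intro H
    induction H with
    | zero =>
      intro s h hv
      have h : ∀ k, (s.cfg i).stk k = [] := fun k => by simpa using h k
      refine (RunsIn.while_true (T := 1) (T₁ := 1) hv (RunsIn.op (opDrain i) _)
        ((RunsIn.while_false ?_).congr rfl le_rfl ?_)).mono (by omega)
      · simp [opDrain, vSome, St.ctl, h]
      · refine St.ext_reg (fun r => ?_) ?_ ?_ ?_ <;>
          simp [opDrain, h, Machine.popAll, Machine.blank]
    | succ H ih =>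
      intro s h hv
      by_cases h0 : ∀ k, (s.cfg i).stk k = []
      · refine (RunsIn.while_true (T := 1) (T₁ := 1) hv (RunsIn.op (opDrain i) _)
          ((RunsIn.while_false ?_).congr rfl le_rfl ?_)).mono (by omega)
        · simp [opDrain, vSome, St.ctl, h0]
        · refine St.ext_reg (fun r => ?_) ?_ ?_ ?_ <;>
            simp [opDrain, h0, Machine.popAll, Machine.blank]
      · push Not at h0
        refine (RunsIn.while_true hv (RunsIn.op (opDrain i) _)
          ((ih ((opDrain i).run s) (fun k => ?_) ?_).congr rfl le_rfl ?_)).mono (by omega)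
        · simp only [opDrain, St.setCfg_cfg, Function.update_self, Machine.popAll,
            List.length_tail]
          have := h k
          omega
        · simp only [vSome, St.ctl, opDrain, St.setCfg_v, St.setV_v]
          rw [if_pos h0]
          rfl
        · refine St.ext_reg (fun r => ?_) ?_ ?_ ?_ <;> simp [opDrain]
  intro v
  refine ⟨none, ((RunsIn.op (opV fun _ => some none) (s.setV v)).seq
    (key H (s.setV (some none)) h rfl)).congr rfl (by omega) ?_⟩
  simp

/-- Run the machine `M i` on the contents of the registers `rs`, for as many steps as there are
bits in the register `c`; push the resulting bit on the register `res`. -/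
noncomputable def sim (i : ι) (c u t res : R) (rs : List R) : VProg M R :=
  loadRegs i t rs ⨾ copy c u t ⨾ runClock i u ⨾ getOut i res ⨾ wipe i

/-- The running time of `sim`, for input of length `e` and time bound `n`. -/
def Machine.simTime (M : Machine) (e n : ℕ) : ℕ := e * 9 + n * 10 + n * M.grow * 2 + 13

/-- Nothing is assumed about the embedded machine: the clock ends every run, and `Machine.result` is
defined in any case. The clock is copied to `u`, because a run consumes it. -/
theorem does_sim (i : ι) {c u t res : R} {rs : List R} (hcu : c ≠ u) (hct : c ≠ t) (hut : u ≠ t)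
    (hrs : t ∉ rs) (hur : u ≠ res) (s : St M R) (ht : s.reg t = [])
    (hu : s.reg u = []) (hc : s.cfg i = (M i).blank) :
    Does (sim i c u t res rs) s
      ((M i).simTime (encodeInput (rs.map s.reg)).length (s.reg c).length)
      (s.setReg res ((M i).result (s.reg c).length (rs.map s.reg) :: s.reg res)) := by
  refine ((does_loadRegs i rs hrs s ht hc).seq ((does_copy hcu hct hut _ (by simpa using ht)).seq
    ((does_runClock i u _).seq ((does_getOut i res _).seq (does_wipe i
      ((encodeInput (rs.map s.reg)).length + (s.reg c).length * (M i).grow) _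
      fun k => ?_))))).congr rfl ?_ ?_
  · simp only [St.setReg_cfg, St.setCfg_cfg, Function.update_self, St.setReg_reg, St.setCfg_reg,
      hu, List.append_nil]
    exact ((M i).length_iterate_next_le _ _ _).trans
      (Nat.add_le_add_right ((M i).length_startCfg_le _ _) _)
  · simp [Machine.simTime, hu]; ring_nf; try omega
  · refine St.ext_reg (fun r => ?_) ?_ ?_ ?_ <;> simp [hu, Function.update_apply, Machine.result]
    · split_ifs <;> simp_all
    · rw [← hc]

/-- Run the machine `M i` on the contents of the registers `rs`, until it halts;
push the resulting bit on the register `res`. -/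
noncomputable def simFree (i : ι) (t res : R) (rs : List R) : VProg M R :=
  loadRegs i t rs ⨾ runFree i ⨾ getOut i res ⨾ wipe i

theorem does_simFree (i : ι) {t res : R} {rs : List R} (hrs : t ∉ rs) (s : St M R)
    (ht : s.reg t = []) (hc : s.cfg i = (M i).blank) {n : ℕ} {b : Bool}
    (h : OutputsWithin (M i) (rs.map s.reg) [b] n) :
    Does (simFree i t res rs) s ((M i).simTime (encodeInput (rs.map s.reg)).length n)
      (s.setReg res (b :: s.reg res)) := by
  refine ((does_loadRegs i rs hrs s ht hc).seq ((does_runFree i n _ ?_).seq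
    ((does_getOut i res _).seq (does_wipe i
      ((encodeInput (rs.map s.reg)).length + n * (M i).grow) _
      fun k => ?_)))).congr rfl ?_ ?_
  · simp [h.iterate_next, haltList]
  · simp only [St.setReg_cfg, St.setCfg_cfg, Function.update_self]
    exact ((M i).length_iterate_next_le _ _ _).trans
      (Nat.add_le_add_right ((M i).length_startCfg_le _ _) _)
  · simp [Machine.simTime]; ring_nf; try omega
  · refine St.ext_reg (fun r => ?_) ?_ ?_ ?_ <;> simp [Function.update_apply]
    · split_ifs
      · have := h.result_eq
        rw [Machine.result] at this
        rw [this]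
      · rfl
    · rw [← hc]

end Simulation

end AdviceComplexity

/-! ## Polynomial and exponential bounds -/

namespace AdviceComplexity

/-- Polynomially bounded functions. -/
def PolyB (f : ℕ → ℕ) : Prop := ∃ C k, ∀ n, f n ≤ C * (n + 1) ^ k

theorem PolyB.mono {f g : ℕ → ℕ} (hg : PolyB g) (h : ∀ n, f n ≤ g n) : PolyB f :=
  let ⟨C, k, hk⟩ := hg
  ⟨C, k, fun n => (h n).trans (hk n)⟩

theorem PolyB.const (c : ℕ) : PolyB fun _ => c := ⟨c, 0, fun n => by simp⟩

theorem PolyB.id : PolyB fun n => n := ⟨1, 1, fun n => by simp⟩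

theorem PolyB.add {f g : ℕ → ℕ} (hf : PolyB f) (hg : PolyB g) : PolyB fun n => f n + g n := by
  obtain ⟨C, k, hk⟩ := hf
  obtain ⟨D, l, hl⟩ := hg
  refine ⟨C + D, k + l, fun n => (Nat.add_le_add (hk n) (hl n)).trans ?_⟩
  rw [Nat.add_mul]
  gcongr <;> omega

theorem PolyB.mul {f g : ℕ → ℕ} (hf : PolyB f) (hg : PolyB g) : PolyB fun n => f n * g n := by
  obtain ⟨C, k, hk⟩ := hf
  obtain ⟨D, l, hl⟩ := hg
  refine ⟨C * D, k + l, fun n => (Nat.mul_le_mul (hk n) (hl n)).trans (le_of_eq ?_)⟩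
  ring

theorem PolyB.pow {f : ℕ → ℕ} (hf : PolyB f) (d : ℕ) : PolyB fun n => f n ^ d := by
  induction d with
  | zero => exact PolyB.const 1
  | succ d ih => exact ih.mul hf

theorem PolyB.polyBound {f : ℕ → ℕ} (hf : PolyB f) (k : ℕ) : PolyB fun n => polyBound k (f n) :=
  (hf.pow k).add (PolyB.const k)

theorem PolyB.le_polyBound {f : ℕ → ℕ} (hf : PolyB f) :
    ∃ k₀, ∀ k, k₀ ≤ k → ∀ n, f n ≤ AdviceComplexity.polyBound k n := by
  obtain ⟨C, k, hk⟩ := hf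
  -- For n < 2 the additive constant of `polyBound` dominates C * 2 ^ k; for n ≥ 2 the factor C is
  -- at most n ^ C, and n + 1 ≤ n ^ 2, so the exponent C + 2 * k is enough.
  refine ⟨C * 2 ^ k + C + 2 * k, fun K hK n => (hk n).trans ?_⟩
  unfold AdviceComplexity.polyBound
  rcases Nat.lt_or_ge n 2 with h | h
  · have : C * (n + 1) ^ k ≤ C * 2 ^ k := by gcongr; omega
    omega
  · have h₁ : n + 1 ≤ n ^ 2 := by nlinarith
    have h₂ : C ≤ n ^ C := (Nat.lt_pow_self h).le
    calc C * (n + 1) ^ k ≤ n ^ C * (n ^ 2) ^ k := by gcongr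
      _ = n ^ (C + 2 * k) := by rw [← pow_mul, ← pow_add]
      _ ≤ n ^ K := Nat.pow_le_pow_right (by omega) (by omega)
      _ ≤ _ := by omega

/-- Functions with an exponential bound `2 ^ poly`. -/
def ExpB (f : ℕ → ℕ) : Prop := ∃ g, PolyB g ∧ ∀ n, f n ≤ 2 ^ g n

theorem ExpB.mono {f g : ℕ → ℕ} (hg : ExpB g) (h : ∀ n, f n ≤ g n) : ExpB f :=
  let ⟨p, hp, hk⟩ := hg
  ⟨p, hp, fun n => (h n).trans (hk n)⟩

theorem ExpB.two_pow {f : ℕ → ℕ} (hf : PolyB f) : ExpB fun n => 2 ^ f n := ⟨f, hf, fun _ => le_rfl⟩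

theorem PolyB.expB {f : ℕ → ℕ} (hf : PolyB f) : ExpB f :=
  (ExpB.two_pow hf).mono fun _ => Nat.lt_two_pow_self.le

theorem ExpB.const (c : ℕ) : ExpB fun _ => c := (PolyB.const c).expB

theorem ExpB.add {f g : ℕ → ℕ} (hf : ExpB f) (hg : ExpB g) : ExpB fun n => f n + g n := by
  obtain ⟨p, hp, hf⟩ := hf
  obtain ⟨q, hq, hg⟩ := hg
  refine ⟨_, (hp.add hq).add (PolyB.const 1), fun n => (Nat.add_le_add (hf n) (hg n)).trans ?_⟩
  have h₁ : 2 ^ p n ≤ 2 ^ (p n + q n) := Nat.pow_le_pow_right (by omega) (by omega)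
  have h₂ : 2 ^ q n ≤ 2 ^ (p n + q n) := Nat.pow_le_pow_right (by omega) (by omega)
  rw [pow_succ]
  omega

theorem ExpB.mul {f g : ℕ → ℕ} (hf : ExpB f) (hg : ExpB g) : ExpB fun n => f n * g n := by
  obtain ⟨p, hp, hf⟩ := hf
  obtain ⟨q, hq, hg⟩ := hg
  refine ⟨_, hp.add hq, fun n => (Nat.mul_le_mul (hf n) (hg n)).trans ?_⟩
  rw [pow_add]

theorem ExpB.le_polyBound {f : ℕ → ℕ} (hf : ExpB f) :
    ∃ k, ∀ n, f n ≤ 2 ^ AdviceComplexity.polyBound k n := by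
  obtain ⟨p, hp, hf⟩ := hf
  obtain ⟨k, hk⟩ := hp.le_polyBound
  exact ⟨k, fun n => (hf n).trans (Nat.pow_le_pow_right (by omega) (hk k le_rfl n))⟩

theorem PolyB.powTime {f : ℕ → ℕ} (hf : PolyB f) (d : ℕ) :
    PolyB fun n => AdviceComplexity.powTime (f n) d := by
  induction d with
  | zero => exact PolyB.const 1
  | succ d ih =>
    exact ih.add ((((hf.pow d).mul (((PolyB.const 7).mul hf).add (PolyB.const 6))).add
      (PolyB.const 2)).add ((((hf.pow d).mul hf).mul (PolyB.const 3)).add (PolyB.const 2)))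

theorem PolyB.simTime {e n : ℕ → ℕ} (he : PolyB e) (hn : PolyB n) (M : Machine) :
    PolyB fun x => M.simTime (e x) (n x) :=
  (((he.mul (PolyB.const 9)).add (hn.mul (PolyB.const 10))).add
    ((hn.mul (PolyB.const _)).mul (PolyB.const 2))).add (PolyB.const 13)

theorem ExpB.simTime {e n : ℕ → ℕ} (he : ExpB e) (hn : ExpB n) (M : Machine) :
    ExpB fun x => M.simTime (e x) (n x) :=
  (((he.mul (ExpB.const 9)).add (hn.mul (ExpB.const 10))).add
    ((hn.mul (ExpB.const _)).mul (ExpB.const 2))).add (ExpB.const 13)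

theorem Machine.simTime_mono (M : Machine) {e e' n n' : ℕ} (he : e ≤ e') (hn : n ≤ n') :
    M.simTime e n ≤ M.simTime e' n' := by
  unfold Machine.simTime
  gcongr

end AdviceComplexity

/-! ## Programs: loops over two registers, comparison of bits -/

namespace AdviceComplexity

open Turing TM2

set_option linter.unusedSectionVars false

section Macros

variable {ι R : Type} [DecidableEq ι] [DecidableEq R]
variable {M : ι → Machine}

/-- The step function of a loop that consumes a list. -/
def stepList {α : Type} (g : Bool → List Bool → α → List Bool × α) :
    List Bool × α → List Bool × α
  | ([], x) => ([], x)
  | (b :: l, x) => g b l x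

theorem foldl_const_eq_iterate {α β : Type} (f : α → α) (l : List β) (a : α) :
    l.foldl (fun a _ => f a) a = f^[l.length] a := by
  induction l generalizing a with
  | nil => rfl
  | cons b l ih => simp [ih]

/-- Every round on a nonempty list uses up at least its head, so as many rounds as there are bits
consume all of it. -/
theorem stepList_iterate_fst {α : Type} {g : Bool → List Bool → α → List Bool × α}
    (hg : ∀ b l x, (g b l x).1.length ≤ l.length) (k : ℕ) (l : List Bool) (x : α)
    (h : l.length ≤ k) : ((stepList g)^[k] (l, x)).1 = [] := by
  induction k generalizing l x with
  | zero => simpa using h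
  | succ k ih =>
    cases l with
    | nil => exact ih [] x (by simp)
    | cons c l =>
      refine ih _ _ ((hg c l x).trans ?_)
      simpa using h

/-- The body may consume a variable number of bits of `a`, so a separate counter `c` bounds the
number of rounds; once `a` is empty, the remaining rounds are idle. -/
theorem does_foreach_ifPop {α : Type} {c a : R} {body : VProg M R} {T : ℕ}
    (F : List Bool → List Bool → α → St M R) (g : Bool → List Bool → α → List Bool × α)
    (hc : ∀ k l x, (F k l x).reg c = k) (ha : ∀ k l x, (F k l x).reg a = l)
    (hFc : ∀ k k' l x, (F k l x).setReg c k' = F k' l x)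
    (hFa : ∀ k l l' x, (F k l x).setReg a l' = F k l' x)
    (hbody : ∀ k b l x, Yields body ((F k l x).setV (some (some b))) T
      (F k (g b l x).1 (g b l x).2)) (k l : List Bool) (x : α) :
    Does (foreach c (ifPop a body nop)) (F k l x) (k.length * (T + 5) + 2)
      (F [] ((stepList g)^[k.length] (l, x)).1 ((stepList g)^[k.length] (l, x)).2) := by
  have h := does_foreach (T := T + 3) (r := c) (body := ifPop a body nop)
    (fun (w : List Bool × α) l => F l w.1 w.2) (fun w _ => stepList g w) (fun _ => True)
    (fun _ _ => hc _ _ _) (fun w b l _ => ⟨?_, trivial⟩) (l, x) k trivial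
  · rw [foldl_const_eq_iterate] at h
    exact h
  · rcases w with ⟨_ | ⟨b', r⟩, x⟩
    · have := does_ifPop_nil (p := body) (ha l [] x) (does_nop _) (some (some b))
      rw [hFc]
      exact this.mono (by omega)
    · have := does_ifPop_cons (q := nop) (ha l (b' :: r) x) (by
        rw [hFa]; exact hbody l b' r x) (some (some b))
      rw [hFc]
      exact this.mono (by omega)

/-- Move bits from the register `a` to the register `b`, as many as there are in the register
`c`, and in reverse order; the registers `u` and `t` are empty. -/
def takeBits (c u t a b : R) : VProg M R := copy c u t ⨾ foreach u (ifPop a (pushV b) nop)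

theorem does_takeBits {c u t a b : R} (hcu : c ≠ u) (hct : c ≠ t) (hut : u ≠ t) (hua : u ≠ a)
    (hub : u ≠ b) (hab : a ≠ b) (s : St M R) {n : ℕ} (hc : s.reg c = num n)
    (hu : s.reg u = []) (ht : s.reg t = []) :
    Does (takeBits c u t a b) s (n * 13 + 6) ((s.setReg a ((s.reg a).drop n)).setReg b
      (((s.reg a).take n).reverse ++ s.reg b)) := by
  have h₁ := does_copy hcu hct hut s ht
  have h₂ := does_foreach_ifPop (T := 1) (c := u) (a := a) (body := pushV b)
    (fun k l x => ((s.setReg u k).setReg a l).setReg b x) (fun y l x => (l, y :: x))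
    (by simp [hua, hub]) (by simp [hab]) (fun k k' l x => St.ext_reg fun r => ?_)
    (fun k l l' x => St.ext_reg fun r => ?_) (fun k y l x => ?_) (num n) (s.reg a) (s.reg b)
  · have h₃ : ∀ (n : ℕ) (l x : List Bool), (stepList fun y l x => (l, y :: x))^[n] (l, x) =
        (l.drop n, (l.take n).reverse ++ x) := by
      intro n
      induction n with
      | zero => intro l x; simp
      | succ n ih =>
        intro l x
        rw [Function.iterate_succ_apply]
        cases l with
        | nil => rw [stepList, ih]; simp
        | cons y l => rw [stepList, ih]; simp
    simp only [h₃] at h₂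
    refine (h₁.seq (h₂.congr (T₁ := n * 6 + 2) (St.ext_reg fun r => ?_) (by simp)
      (St.ext_reg fun r => ?_))).mono ?_
    · simp [Function.update_apply, hc, hu]
      split_ifs <;> simp_all
    · simp [Function.update_apply]
      split_ifs <;> simp_all
    · simp [hc]; omega
  · simp [Function.update_apply]
    split_ifs <;> simp_all
  · simp [Function.update_apply]
    split_ifs <;> simp_all
  · refine RunsIn.yields (w := some (some y)) (runs_pushV b _) rfl (St.ext_reg fun r => ?_)
    simp [Function.update_apply, bitOf]

/-- A bit as the contents of a register. -/
def flag (b : Bool) : List Bool := if b then [true] else []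

/-- Pop the registers `a` and `b`, and set the flag in the register `f` if they differ. -/
def cmp (a b f : R) : VProg M R :=
  .op (opPop a) ⨾ .ite vTrue
    (.op (opPop b) ⨾ .ite vTrue nop (drop f ⨾ push f true))
    (.op (opPop b) ⨾ .ite vTrue (drop f ⨾ push f true) nop)

theorem does_cmp {a b f : R} (hab : a ≠ b) (haf : a ≠ f) (hbf : b ≠ f) (s : St M R)
    {x y z : Bool} {l l' : List Bool} (ha : s.reg a = x :: l) (hb : s.reg b = y :: l')
    (hf : s.reg f = flag z) :
    Does (cmp a b f) s 6 (((s.setReg a l).setReg b l').setReg f (flag (z || (x != y)))) := by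
  intro v
  have h₁ : RunsIn (.op (opPop a)) (s.setV v) 1 ((s.setReg a l).setV (some (some x))) :=
    (RunsIn.op (opPop a) _).congr rfl le_rfl (by simp [opPop, ha])
  have h₂ : RunsIn (.op (opPop b)) ((s.setReg a l).setV (some (some x))) 1
      (((s.setReg a l).setReg b l').setV (some (some y))) :=
    (RunsIn.op (opPop b) _).congr rfl le_rfl (by simp [opPop, hb, hab.symm])
  have h₃ : ∀ w, Yields (drop f ⨾ push f true) (((s.setReg a l).setReg b l').setV w) 2
      (((s.setReg a l).setReg b l').setReg f [true]) := by
    intro w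
    refine ((does_drop f _).seq (does_push f true _)).congr rfl le_rfl ?_ w
    cases z <;> simp [haf.symm, hbf.symm, hf, flag]
  have h₄ : Does nop ((s.setReg a l).setReg b l') 1
      (((s.setReg a l).setReg b l').setReg f (flag z)) :=
    (does_nop _).congr rfl le_rfl (by
      refine St.ext_reg fun r => ?_
      simp [Function.update_apply]
      split_ifs <;> simp_all)
  obtain ⟨w₃, h₃⟩ := h₃ (some (some y))
  obtain ⟨w₄, h₄⟩ := h₄ (some (some y))
  cases x <;> cases y
  · refine ⟨w₄, (h₁.seq (RunsIn.ite_neg rfl (h₂.seq (RunsIn.ite_neg rfl h₄)))).congr rfl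
      (by omega) (by simp)⟩
  · refine ⟨w₃, (h₁.seq (RunsIn.ite_neg rfl (h₂.seq (RunsIn.ite_pos rfl h₃)))).congr rfl
      (by omega) (by simp [flag])⟩
  · refine ⟨w₃, (h₁.seq (RunsIn.ite_pos rfl (h₂.seq (RunsIn.ite_neg rfl h₃)))).congr rfl
      (by omega) (by simp [flag])⟩
  · refine ⟨w₄, (h₁.seq (RunsIn.ite_pos rfl (h₂.seq (RunsIn.ite_pos rfl h₄)))).congr rfl
      (by omega) (by simp)⟩

end Macros

end AdviceComplexity

/-! ## The probabilistic machine -/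

namespace AdviceComplexity

open Turing TM2

set_option linter.unusedSectionVars false

section BPP

/-- The registers of the probabilistic machine. -/
inductive BReg
  | x | adv | rnd | n | bl | clk | blk | tst | y | oc | ic | cnt | tmp | aux | ex | res | ans | bad
  deriving DecidableEq

instance : Fintype BReg :=
  ⟨{.x, .adv, .rnd, .n, .bl, .clk, .blk, .tst, .y, .oc, .ic, .cnt, .tmp, .aux, .ex, .res, .ans,
    .bad}, fun r => by cases r <;> decide⟩

/-- The contents of the registers of the probabilistic machine. -/
structure BRegs where
  (x adv rnd n bl clk blk tst y oc ic cnt tmp aux ex res ans bad : List Bool := [])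

/-- The contents of a register. -/
@[simp] def BRegs.get (e : BRegs) : BReg → List Bool
  | .x => e.x | .adv => e.adv | .rnd => e.rnd | .n => e.n | .bl => e.bl | .clk => e.clk
  | .blk => e.blk | .tst => e.tst | .y => e.y | .oc => e.oc | .ic => e.ic | .cnt => e.cnt
  | .tmp => e.tmp | .aux => e.aux | .ex => e.ex | .res => e.res | .ans => e.ans | .bad => e.bad

/-- Write a register. -/
@[simp] def BRegs.set (e : BRegs) (r : BReg) (l : List Bool) : BRegs := match r with
  | .x => {e with x := l} | .adv => {e with adv := l} | .rnd => {e with rnd := l}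
  | .n => {e with n := l} | .bl => {e with bl := l} | .clk => {e with clk := l}
  | .blk => {e with blk := l} | .tst => {e with tst := l} | .y => {e with y := l}
  | .oc => {e with oc := l} | .ic => {e with ic := l} | .cnt => {e with cnt := l}
  | .tmp => {e with tmp := l} | .aux => {e with aux := l} | .ex => {e with ex := l}
  | .res => {e with res := l} | .ans => {e with ans := l} | .bad => {e with bad := l}

variable (M : Machine)

/-- The states of the probabilistic machine between runs of the embedded machine `M`. -/
def BRegs.st (e : BRegs) (inp : List (Option Bool) := []) : St (fun _ : Unit => M) BReg :=
  ⟨none, inp, e.get, fun _ => M.blank⟩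

@[simp] theorem BRegs.st_setReg (e : BRegs) (z : List (Option Bool)) (r : BReg) (l : List Bool) :
    (e.st M z).setReg r l = (e.set r l).st M z := by
  refine St.ext_reg (fun r' => ?_) rfl rfl rfl
  cases r <;> cases r' <;> rfl

@[simp] theorem BRegs.st_reg (e : BRegs) (z : List (Option Bool)) (r : BReg) :
    (e.st M z).reg r = e.get r := rfl

@[simp] theorem BRegs.st_cfg (e : BRegs) (z : List (Option Bool)) :
    (e.st M z).cfg = fun _ => M.blank := rfl

@[simp] theorem BRegs.st_inp (e : BRegs) (z : List (Option Bool)) :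
    (e.st M z).inp = z := rfl

@[simp] theorem BRegs.st_setInp (e : BRegs) (z z' : List (Option Bool)) :
    (e.st M z).setInp z' = e.st M z' := rfl

/-- Check a test: the expected bit is in the scratch cell, and the question is next in the
register `tst`. -/
noncomputable def testBody : VProg (fun _ : Unit => M) BReg :=
  pushV .ex ⨾ takeBits .n .cnt .tmp .tst .y ⨾ sim () .clk .cnt .tmp .res [.y, .blk] ⨾
    cmp .ex .res .bad ⨾ clear .y

/-- Check whether the string in `blk` passes all tests in `adv`. -/
noncomputable def tests : VProg (fun _ : Unit => M) BReg :=
  copy .adv .tst .tmp ⨾ copy .adv .ic .tmp ⨾ foreach .ic (ifPop .tst (testBody M) nop)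

/-- Cut off a block of the random string; if it is the first one that passes all tests, use it
to decide about the input. -/
noncomputable def blockBody : VProg (fun _ : Unit => M) BReg :=
  takeBits .bl .cnt .tmp .rnd .blk ⨾
    ifPop .ans (pushV .ans)
      (tests M ⨾ ifPop .bad nop (sim () .clk .cnt .tmp .ans [.x, .blk])) ⨾
    clear .blk

/-- The program of the probabilistic machine. -/
noncomputable def bppProg (d k : ℕ) : VProg (fun _ : Unit => M) BReg :=
  readField .x .tmp ⨾ readField .adv .tmp ⨾ readField .rnd .tmp ⨾ tally .x .n .tmp ⨾
    pow .n .bl .aux .tmp d ⨾ clock .n .clk .aux .tmp k ⨾ copy .rnd .oc .tmp ⨾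
    foreach .oc (ifPop .rnd (blockBody M) nop) ⨾
    ifPop .ans (pushV .ans) (push .ans false) ⨾ clear .x ⨾ clear .adv ⨾ clear .n ⨾ clear .bl ⨾
    clear .clk ⨾ clear .rnd

/-- The check of a test with expected bit `c`: `l` is the rest of the list of tests, and `z` tells
whether a test failed so far. -/
def testStep (T n : ℕ) (a : List Bool) (c : Bool) (l : List Bool) (z : Bool) :
    List Bool × Bool :=
  (l.drop n, z || (c != M.result T [(l.take n).reverse, a]))

/-- Does the string `a` fail a test? -/
def fails (T n : ℕ) (adv a : List Bool) : Bool :=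
  ((stepList (testStep M T n a))^[adv.length] (adv, false)).2

/-- The inspection of a block; `l` is the rest of the random string, and `z` holds the answer. -/
def blockStep (T n N : ℕ) (adv x : List Bool) (_ : Bool) (l z : List Bool) :
    List Bool × List Bool :=
  (l.drop N, if z ≠ [] then z else if fails M T n adv (l.take N).reverse then []
    else [M.result T [x, (l.take N).reverse]])

/-- The time for a test. -/
def Machine.testTime (T n N : ℕ) : ℕ := M.simTime (n + N + 2) T + n * 16 + 18

/-- The time for all tests. -/
def Machine.testsTime (A T n N : ℕ) : ℕ := A * (M.testTime T n N + 19) + 10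

/-- The time for a block. -/
def Machine.blockTime (A T n N : ℕ) : ℕ :=
  M.testsTime A T n N + M.simTime (n + N + 2) T + N * 16 + 20

/-- The contents of the registers in the course of the computation. -/
abbrev bEnv (x adv : List Bool) (n N T : ℕ) (rnd oc blk tst ic ans : List Bool) (z : Bool) :
    BRegs :=
  {x := x, adv := adv, n := num n, bl := num N, clk := num T, rnd := rnd, oc := oc, blk := blk,
   tst := tst, ic := ic, ans := ans, bad := flag z}

variable (x adv : List Bool) (n N T : ℕ)

theorem length_encodeInput (ws : List (List Bool)) :
    (encodeInput ws).length = (ws.map fun w => w.length + 1).sum := by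
  induction ws with
  | nil => rfl
  | cons w ws ih => simp [encodeInput_cons, ih]; omega

theorem yields_testBody (rnd oc blk r ic ans : List Bool) (c z : Bool) (hb : blk.length ≤ N) :
    Yields (testBody M) (((bEnv x adv n N T rnd oc blk r ic ans z).st M).setV (some (some c)))
      (M.testTime T n N) ((bEnv x adv n N T rnd oc blk (r.drop n) ic ans
        (z || (c != M.result T [(r.take n).reverse, blk]))).st M) := by
  have h₁ : Yields (pushV .ex)
      (((bEnv x adv n N T rnd oc blk r ic ans z).st M).setV (some (some c))) 1
      (({bEnv x adv n N T rnd oc blk r ic ans z with ex := [c]} : BRegs).st M) :=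
    RunsIn.yields (w := some (some c)) (runs_pushV _ _) rfl
      (St.ext_reg (fun r => by cases r <;> rfl) rfl rfl rfl)
  have h₂ : Does (takeBits .n .cnt .tmp .tst .y)
      (({bEnv x adv n N T rnd oc blk r ic ans z with ex := [c]} : BRegs).st M) (n * 13 + 6)
      (({bEnv x adv n N T rnd oc blk (r.drop n) ic ans z with
        ex := [c], y := (r.take n).reverse} : BRegs).st M) :=
    (does_takeBits (by decide) (by decide) (by decide) (by decide) (by decide) (by decide)
      _ rfl rfl rfl).congr rfl le_rfl (by simp)
  have h₃ : Does (sim () .clk .cnt .tmp .res [.y, .blk])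
      (({bEnv x adv n N T rnd oc blk (r.drop n) ic ans z with
        ex := [c], y := (r.take n).reverse} : BRegs).st M) (M.simTime (n + N + 2) T)
      (({bEnv x adv n N T rnd oc blk (r.drop n) ic ans z with
        ex := [c], y := (r.take n).reverse,
        res := [M.result T [(r.take n).reverse, blk]]} : BRegs).st M) := by
    refine (does_sim () (by decide) (by decide) (by decide) (by decide) (by decide)
      _ rfl rfl rfl).congr rfl (M.simTime_mono ?_ ?_) ?_
    · simp [length_encodeInput]; omega
    · simp
    · simp
  have h₄ : Does (cmp .ex .res .bad)
      (({bEnv x adv n N T rnd oc blk (r.drop n) ic ans z with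
        ex := [c], y := (r.take n).reverse,
        res := [M.result T [(r.take n).reverse, blk]]} : BRegs).st M) 6
      (({bEnv x adv n N T rnd oc blk (r.drop n) ic ans
        (z || (c != M.result T [(r.take n).reverse, blk])) with
        y := (r.take n).reverse} : BRegs).st M) :=
    (does_cmp (by decide) (by decide) (by decide) _ rfl rfl rfl).congr rfl le_rfl (by simp)
  have h₅ : Does (clear .y)
      (({bEnv x adv n N T rnd oc blk (r.drop n) ic ans
        (z || (c != M.result T [(r.take n).reverse, blk])) with
        y := (r.take n).reverse} : BRegs).st M) (n * 3 + 2)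
      ((bEnv x adv n N T rnd oc blk (r.drop n) ic ans
        (z || (c != M.result T [(r.take n).reverse, blk]))).st M) :=
    (does_clear BReg.y _).congr rfl (by simp) (by simp)
  refine (h₁.seq (h₂.seq (h₃.seq (h₄.seq h₅)))).mono ?_
  simp only [Machine.testTime]
  omega

/-- The counter starts with the length of the advice, which is enough since every test consumes at
least the bit with its expected answer. -/
theorem does_tests (rnd oc blk ans : List Bool) (hb : blk.length ≤ N) :
    Does (tests M) ((bEnv x adv n N T rnd oc blk [] [] ans false).st M)
      (M.testsTime adv.length T n N)
      ((bEnv x adv n N T rnd oc blk [] [] ans (fails M T n adv blk)).st M) := by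
  have h₁ : Does (copy .adv .tst .tmp) ((bEnv x adv n N T rnd oc blk [] [] ans false).st M)
      (adv.length * 7 + 4) ((bEnv x adv n N T rnd oc blk adv [] ans false).st M) :=
    (does_copy (by decide) (by decide) (by decide) _ rfl).congr rfl le_rfl (by simp)
  have h₂ : Does (copy .adv .ic .tmp) ((bEnv x adv n N T rnd oc blk adv [] ans false).st M)
      (adv.length * 7 + 4) ((bEnv x adv n N T rnd oc blk adv adv ans false).st M) :=
    (does_copy (by decide) (by decide) (by decide) _ rfl).congr rfl le_rfl (by simp)
  have h₃ := does_foreach_ifPop (T := M.testTime T n N) (c := BReg.ic) (a := BReg.tst)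
    (body := testBody M) (fun k l z => (bEnv x adv n N T rnd oc blk l k ans z).st M)
    (testStep M T n blk) (fun _ _ _ => rfl) (fun _ _ _ => rfl) (fun _ _ _ _ => by simp)
    (fun _ _ _ _ => by simp)
    (fun k c l z => yields_testBody M x adv n N T rnd oc blk l k ans c z hb) adv adv false
  rw [stepList_iterate_fst (fun _ _ _ => by simp [testStep]) _ _ _ le_rfl] at h₃
  refine (h₁.seq (h₂.seq h₃)).congr rfl ?_ rfl
  simp only [Machine.testsTime]
  ring_nf
  omega

/-- An answer found earlier is popped and put back. Otherwise the tests are run, and the flag of a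
failed test is consumed by the branch on it, so that it is clear for the next block. -/
theorem yields_blockBody (hx : x.length = n) (rnd oc ans : List Bool) (c : Bool) :
    Yields (blockBody M) (((bEnv x adv n N T rnd oc [] [] [] ans false).st M).setV (some (some c)))
      (M.blockTime adv.length T n N) ((bEnv x adv n N T (blockStep M T n N adv x c rnd ans).1 oc
        [] [] [] (blockStep M T n N adv x c rnd ans).2 false).st M) := by
  set blk := (rnd.take N).reverse with hblk
  have hb : blk.length ≤ N := by simp [hblk]
  set ans' := (blockStep M T n N adv x c rnd ans).2 with hans
  have h₁ : Does (takeBits .bl .cnt .tmp .rnd .blk)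
      ((bEnv x adv n N T rnd oc [] [] [] ans false).st M) (N * 13 + 6)
      ((bEnv x adv n N T (rnd.drop N) oc blk [] [] ans false).st M) :=
    (does_takeBits (by decide) (by decide) (by decide) (by decide) (by decide) (by decide)
      _ rfl rfl rfl).congr rfl le_rfl (by simp [hblk])
  have h₂ : Does (ifPop .ans (pushV .ans)
      (tests M ⨾ ifPop .bad nop (sim () .clk .cnt .tmp .ans [.x, .blk])))
      ((bEnv x adv n N T (rnd.drop N) oc blk [] [] ans false).st M)
      (M.testsTime adv.length T n N + (M.simTime (n + N + 2) T + 2) + 2)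
      ((bEnv x adv n N T (rnd.drop N) oc blk [] [] ans' false).st M) := by
    cases ans with
    | cons b l =>
      refine (does_ifPop_cons (T := 1) (b := b) (l := l) rfl ?_).mono (by omega)
      refine RunsIn.yields (w := some (some b)) (runs_pushV _ _) rfl ?_
      refine St.ext_reg (fun r => ?_) rfl rfl rfl
      cases r <;> simp [hans, blockStep, bitOf]
    | nil =>
      refine (does_ifPop_nil rfl ((does_tests M x adv n N T (rnd.drop N) oc blk [] hb).seq
        ?_)).mono le_rfl
      cases hf : fails M T n adv blk with
      | true =>
        refine (does_ifPop_cons (T := 1) (b := true) (l := []) rfl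
          ((does_nop _).congr rfl le_rfl ?_ _)).mono
          (Nat.add_le_add_right (by unfold Machine.simTime; omega) 2)
        simp [hans, blockStep, ← hblk, hf, flag, bEnv]
      | false =>
        refine (does_ifPop_nil rfl (does_sim () (by decide) (by decide) (by decide) (by decide)
          (by decide) _ rfl rfl rfl)).congr rfl (Nat.add_le_add_right (M.simTime_mono ?_ ?_) 2) ?_
        · simp [length_encodeInput, hx]; omega
        · simp
        · simp [hans, blockStep, ← hblk, hf]
  have h₃ : Does (clear .blk) ((bEnv x adv n N T (rnd.drop N) oc blk [] [] ans' false).st M)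
      (N * 3 + 2) ((bEnv x adv n N T (rnd.drop N) oc [] [] [] ans' false).st M) :=
    (does_clear BReg.blk _).congr rfl (by simp; omega) (by simp)
  refine ((h₁.seq (h₂.seq h₃)) (some (some c))).mono ?_
  simp only [Machine.blockTime]
  omega

/-- The answer of the probabilistic machine. -/
def bppAnswer (rnd : List Bool) : Bool :=
  ((stepList (blockStep M T n N adv x))^[rnd.length] (rnd, [])).2.head?.getD false

/-- The time of the probabilistic machine. -/
def Machine.bppTime (d k A Q n : ℕ) : ℕ :=
  Q * (M.blockTime A (polyBound k n) n (n ^ d) + 30) + A * 10 + n * 30 + powTime n d +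
    powTime n k + k + n ^ d * 3 + polyBound k n * 3 + 100

theorem length_blockStep_iterate (m : ℕ) (rnd : List Bool) :
    ((stepList (blockStep M T n N adv x))^[m] (rnd, [])).2.length ≤ 1 := by
  have : ∀ (m : ℕ) (w : List Bool × List Bool), w.2.length ≤ 1 →
      ((stepList (blockStep M T n N adv x))^[m] w).2.length ≤ 1 := by
    intro m
    induction m with
    | zero => exact fun w h => h
    | succ m ih =>
      intro w h
      refine ih _ ?_
      rcases w with ⟨_ | ⟨c, l⟩, z⟩
      · exact h
      · simp only [stepList, blockStep]
        split_ifs <;> simp_all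
  exact this m _ (by simp)

/-- This holds for arbitrary advice and random bits; in particular it provides halting with a
one-bit answer on every random string. -/
theorem outputsWithin_bpp (d k : ℕ) (hx : x.length = n) (rnd : List Bool) :
    OutputsWithin ((bppProg M d k).machine .ans) [x, adv, rnd]
      [bppAnswer M x adv n (n ^ d) (polyBound k n) rnd]
      (M.bppTime d k adv.length rnd.length n) := by
  set N := n ^ d with hN
  set T := polyBound k n with hT
  set a := ((stepList (blockStep M T n N adv x))^[rnd.length] (rnd, [])).2 with ha
  have h₁ : Does (readField .x .tmp) (({} : BRegs).st M (encodeInput [x, adv, rnd])) (n * 6 + 4)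
      (({x := x} : BRegs).st M (encodeInput [adv, rnd])) :=
    (does_readField (by decide) _ (encodeInput_cons _ _) rfl).congr rfl (by rw [hx]) (by simp)
  have h₂ : Does (readField .adv .tmp) (({x := x} : BRegs).st M (encodeInput [adv, rnd]))
      (adv.length * 6 + 4) (({x := x, adv := adv} : BRegs).st M (encodeInput [rnd])) :=
    (does_readField (by decide) _ (encodeInput_cons _ _) rfl).congr rfl le_rfl (by simp)
  have h₃ : Does (readField .rnd .tmp) (({x := x, adv := adv} : BRegs).st M (encodeInput [rnd]))
      (rnd.length * 6 + 4) (({x := x, adv := adv, rnd := rnd} : BRegs).st M) :=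
    (does_readField (by decide) _ (encodeInput_cons _ _) rfl).congr rfl le_rfl
      (by simp [encodeInput])
  have h₄ : Does (tally .x .n .tmp) (({x := x, adv := adv, rnd := rnd} : BRegs).st M) (n * 7 + 4)
      (({x := x, adv := adv, rnd := rnd, n := num n} : BRegs).st M) :=
    (does_tally (by decide) (by decide) (by decide) _ rfl).congr rfl (by simp [hx]) (by simp [hx])
  have h₅ : Does (pow .n .bl .aux .tmp d)
      (({x := x, adv := adv, rnd := rnd, n := num n} : BRegs).st M) (powTime n d)
      (({x := x, adv := adv, rnd := rnd, n := num n, bl := num N} : BRegs).st M) :=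
    (does_pow (by decide) (by decide) (by decide) (by decide) (by decide) (by decide) _ rfl rfl
      rfl rfl d).congr rfl le_rfl (by simp [hN])
  have h₆ : Does (clock .n .clk .aux .tmp k)
      (({x := x, adv := adv, rnd := rnd, n := num n, bl := num N} : BRegs).st M)
      (powTime n k + (k + 1)) ((bEnv x adv n N T rnd [] [] [] [] [] false).st M) :=
    (does_clock (by decide) (by decide) (by decide) (by decide) (by decide) (by decide) _ rfl rfl
      rfl rfl k).congr rfl le_rfl (by simp [hT, bEnv, flag])
  have h₇ : Does (copy .rnd .oc .tmp) ((bEnv x adv n N T rnd [] [] [] [] [] false).st M)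
      (rnd.length * 7 + 4) ((bEnv x adv n N T rnd rnd [] [] [] [] false).st M) :=
    (does_copy (by decide) (by decide) (by decide) _ rfl).congr rfl le_rfl (by simp)
  have h₈ := does_foreach_ifPop (T := M.blockTime adv.length T n N) (c := BReg.oc) (a := BReg.rnd)
    (body := blockBody M) (fun k l z => (bEnv x adv n N T l k [] [] [] z false).st M)
    (blockStep M T n N adv x) (fun _ _ _ => rfl) (fun _ _ _ => rfl) (fun _ _ _ _ => by simp)
    (fun _ _ _ _ => by simp)
    (fun k c l z => yields_blockBody M x adv n N T hx l k z c) rnd rnd []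
  rw [stepList_iterate_fst (fun _ _ _ => by simp [blockStep]) _ _ _ le_rfl] at h₈
  have h₉ : Does (ifPop .ans (pushV .ans) (push .ans false))
      ((bEnv x adv n N T [] [] [] [] [] a false).st M) 3
      ((bEnv x adv n N T [] [] [] [] [] [a.head?.getD false] false).st M) := by
    -- At most one answer is ever recorded, so one pop and one push leave a single bit; if no block
    -- passed, the answer is 0.
    have := length_blockStep_iterate M x adv n N T rnd.length rnd
    rw [← ha] at this
    rcases a with _ | ⟨b, _ | ⟨c, l⟩⟩
    · exact does_ifPop_nil rfl ((does_push _ _ _).congr rfl le_rfl (by simp))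
    · refine does_ifPop_cons (T := 1) (b := b) (l := []) rfl ?_
      refine RunsIn.yields (w := some (some b)) (runs_pushV _ _) rfl ?_
      refine St.ext_reg (fun r => ?_) rfl rfl rfl
      cases r <;> simp [bitOf]
    · simp at this
  have hc : ∀ (r : BReg) (e : BRegs), Does (clear r) (e.st M) ((e.get r).length * 3 + 2)
      ((e.set r []).st M) := fun r e => (does_clear r _).congr rfl le_rfl (by simp)
  have h : Does (bppProg M d k) _ _ _ :=
    h₁.seq (h₂.seq (h₃.seq (h₄.seq (h₅.seq (h₆.seq (h₇.seq (h₈.seq (h₉.seq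
    ((hc .x _).seq ((hc .adv _).seq ((hc .n _).seq ((hc .bl _).seq ((hc .clk _).seq
      (hc .rnd _))))))))))))))
  obtain ⟨w, h⟩ := h none
  have e : ((({} : BRegs).st M (encodeInput [x, adv, rnd])).setV none) =
      St.start (fun _ => M) BReg (encodeInput [x, adv, rnd]) :=
    St.ext_reg (fun r => by cases r <;> rfl) rfl rfl rfl
  rw [e] at h
  refine OutputsWithin.mono (VProg.outputsWithin h ?_ ?_ ?_) ?_
  · rfl
  · funext r
    cases r <;> rfl
  · rfl
  · simp [Machine.bppTime, hx, ← hN, ← hT]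
    ring_nf
    omega

end BPP

end AdviceComplexity

/-! ## The exponential time machine -/

namespace AdviceComplexity

open Turing TM2

set_option linter.unusedSectionVars false

section EXP

/-- The registers of the exponential time machine. -/
inductive EReg
  | z | idx | n | clk | a | x | res | ex | bad | out | tmp | aux | o | oc | ic | pw
  deriving DecidableEq

instance : Fintype EReg :=
  ⟨{.z, .idx, .n, .clk, .a, .x, .res, .ex, .bad, .out, .tmp, .aux, .o, .oc, .ic, .pw},
    fun r => by cases r <;> decide⟩

/-- The contents of the registers of the exponential time machine. -/
structure ERegs where
  (z idx n clk a x res ex bad out tmp aux o oc ic pw : List Bool := [])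

/-- The contents of a register. -/
@[simp] def ERegs.get (e : ERegs) : EReg → List Bool
  | .z => e.z | .idx => e.idx | .n => e.n | .clk => e.clk | .a => e.a | .x => e.x
  | .res => e.res | .ex => e.ex | .bad => e.bad | .out => e.out | .tmp => e.tmp
  | .aux => e.aux | .o => e.o | .oc => e.oc | .ic => e.ic | .pw => e.pw

/-- Write a register. -/
@[simp] def ERegs.set (e : ERegs) (r : EReg) (l : List Bool) : ERegs := match r with
  | .z => {e with z := l} | .idx => {e with idx := l} | .n => {e with n := l}
  | .clk => {e with clk := l} | .a => {e with a := l} | .x => {e with x := l}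
  | .res => {e with res := l} | .ex => {e with ex := l} | .bad => {e with bad := l}
  | .out => {e with out := l} | .tmp => {e with tmp := l} | .aux => {e with aux := l}
  | .o => {e with o := l} | .oc => {e with oc := l} | .ic => {e with ic := l}
  | .pw => {e with pw := l}

/-- A pair of machines. -/
abbrev pair (M D : Machine) (b : Bool) : Machine := if b then D else M

variable (M D : Machine)

/-- The states of the exponential time machine between runs of the embedded machines. -/
def ERegs.st (e : ERegs) (inp : List (Option Bool) := []) : St (pair M D) EReg :=
  ⟨none, inp, e.get, fun b => (pair M D b).blank⟩

@[simp] theorem ERegs.st_setReg (e : ERegs) (z : List (Option Bool)) (r : EReg) (l : List Bool) :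
    (e.st M D z).setReg r l = (e.set r l).st M D z := by
  refine St.ext_reg (fun r' => ?_) rfl rfl rfl
  cases r <;> cases r' <;> rfl

@[simp] theorem ERegs.st_reg (e : ERegs) (z : List (Option Bool)) (r : EReg) :
    (e.st M D z).reg r = e.get r := rfl

@[simp] theorem ERegs.st_cfg (e : ERegs) (z : List (Option Bool)) :
    (e.st M D z).cfg = fun b => (pair M D b).blank := rfl

@[simp] theorem ERegs.st_inp (e : ERegs) (z : List (Option Bool)) :
    (e.st M D z).inp = z := rfl

@[simp] theorem ERegs.st_setInp (e : ERegs) (z z' : List (Option Bool)) :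
    (e.st M D z).setInp z' = e.st M D z' := rfl

/-- A step in the search for a root. -/
def rootBody (d : ℕ) : VProg (pair M D) EReg :=
  pow .n .pw .aux .tmp d ⨾ copy .z .ic .tmp ⨾ foreach .pw (drop .ic) ⨾
    ifPop .ic (push .n false) nop ⨾ clear .ic

/-- Compare the machines `M` and `D` on the question in `x`, where `M` has advice `a`. -/
noncomputable def compareBody : VProg (pair M D) EReg :=
  sim false .clk .ic .tmp .res [.x, .a] ⨾ simFree true .tmp .ex [.x] ⨾ cmp .res .ex .bad

/-- If the string in the register `a` is good advice, then count it, and put it out if the counter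
overflows. -/
noncomputable def candidateBody : VProg (pair M D) EReg :=
  copy .n .x .tmp ⨾ forBits .x .tmp .o (compareBody M D) ⨾ clear .x ⨾
    ifPop .bad nop (inc .idx .tmp .o ⨾ ifPop .o nop (clear .out ⨾ copy .a .out .tmp))

/-- The program of the exponential time machine. -/
noncomputable def expProg (d k : ℕ) : VProg (pair M D) EReg :=
  readField .z .tmp ⨾ readField .idx .tmp ⨾ copy .z .oc .tmp ⨾ foreach .oc (rootBody M D d) ⨾
    clock .n .clk .aux .tmp k ⨾ copy .z .a .tmp ⨾ forBits .a .tmp .o (candidateBody M D) ⨾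
    clear .z ⨾ clear .idx ⨾ clear .n ⨾ clear .clk ⨾ clear .a

/-- A step in the search for a root. -/
def rootStep (d N n : ℕ) : ℕ := if n ^ d < N then n + 1 else n

/-- The least number whose `d`-th power is at least `N`. -/
def root (d N : ℕ) : ℕ := (rootStep d N)^[N] 0

theorem rootStep_le {d N n : ℕ} (hd : 0 < d) (h : n ≤ N) : rootStep d N n ≤ N := by
  unfold rootStep
  split_ifs with h'
  · exact (Nat.le_self_pow hd.ne' n).trans_lt h'
  · exact h

theorem rootStep_iterate_le {d N : ℕ} (hd : 0 < d) (j : ℕ) : (rootStep d N)^[j] 0 ≤ N := by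
  induction j with
  | zero => simp
  | succ j ih => rw [Function.iterate_succ_apply']; exact rootStep_le hd ih

theorem root_le {d N : ℕ} (hd : 0 < d) : root d N ≤ N := rootStep_iterate_le hd N

/-- After j rounds the search is at min(j, m), and m ^ d rounds are at least m. On other arguments
only the bound `root_le` matters, for the running time. -/
theorem root_pow {d : ℕ} (hd : 0 < d) (m : ℕ) : root d (m ^ d) = m := by
  have : ∀ j, (rootStep d (m ^ d))^[j] 0 = min j m := by
    intro j
    induction j with
    | zero => simp
    | succ j ih =>
      rw [Function.iterate_succ_apply', ih, rootStep]
      rcases Nat.lt_or_ge j m with h | h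
      · rw [Nat.min_eq_left h.le, if_pos (Nat.pow_lt_pow_left h hd.ne'), Nat.min_eq_left h]
      · rw [Nat.min_eq_right h, if_neg (lt_irrefl _), Nat.min_eq_right (h.trans (Nat.le_succ j))]
  rw [root, this, Nat.min_eq_right (Nat.le_self_pow hd.ne' m)]

theorem powTime_mono (d : ℕ) {n m : ℕ} (h : n ≤ m) : powTime n d ≤ powTime m d := by
  induction d with
  | zero => rfl
  | succ d ih =>
    unfold powTime
    gcongr

/-- The time for a step in the search for a root. -/
def rootTime (d N : ℕ) : ℕ := powTime N d + N * 10 + N ^ d * 3 + 20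

/-- The test n ^ d < N is a truncated subtraction in unary: n ^ d bits are dropped from a copy of 0
^ N, and what is left is tested for emptiness. -/
theorem does_rootBody (d N n : ℕ) (hn : n ≤ N) (idx oc : List Bool) :
    Does (rootBody M D d) (({z := num N, idx := idx, n := num n, oc := oc} : ERegs).st M D)
      (rootTime d N)
      (({z := num N, idx := idx, n := num (rootStep d N n), oc := oc} : ERegs).st M D) := by
  have h₁ : Does (pow .n .pw .aux .tmp d)
      (({z := num N, idx := idx, n := num n, oc := oc} : ERegs).st M D) (powTime n d)
      (({z := num N, idx := idx, n := num n, oc := oc, pw := num (n ^ d)} : ERegs).st M D) :=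
    (does_pow (by decide) (by decide) (by decide) (by decide) (by decide) (by decide) _ rfl rfl
      rfl rfl d).congr rfl le_rfl (by simp)
  have h₂ : Does (copy .z .ic .tmp)
      (({z := num N, idx := idx, n := num n, oc := oc, pw := num (n ^ d)} : ERegs).st M D)
      (N * 7 + 4)
      (({z := num N, idx := idx, n := num n, oc := oc, pw := num (n ^ d), ic := num N} :
        ERegs).st M D) :=
    (does_copy (by decide) (by decide) (by decide) _ rfl).congr rfl (by simp) (by simp)
  have h₃ := does_foreach (T := 1) (r := EReg.pw) (body := drop .ic)
    (fun (w : List Bool) l =>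
      (({z := num N, idx := idx, n := num n, oc := oc, pw := l, ic := w} : ERegs).st M D))
    (fun w _ => w.tail) (fun _ => True) (fun _ _ => rfl)
    (fun w b l _ => ⟨((does_drop EReg.ic _).congr rfl le_rfl (by simp) _), trivial⟩)
    (num N) (num (n ^ d)) trivial
  have e : ∀ (l w : List Bool), l.foldl (fun w _ => w.tail) w = w.drop l.length := by
    intro l
    induction l with
    | nil => simp
    | cons b l ih => intro w; simp [ih]
  rw [e] at h₃
  have h₄ : Does (ifPop .ic (push .n false) nop ⨾ clear .ic)
      (({z := num N, idx := idx, n := num n, oc := oc, ic := (num N).drop (num (n ^ d)).length} :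
        ERegs).st M D) (N * 3 + 5)
      (({z := num N, idx := idx, n := num (rootStep d N n), oc := oc} : ERegs).st M D) := by
    rcases Nat.lt_or_ge (n ^ d) N with h | h
    · obtain ⟨m, hm⟩ := Nat.exists_eq_add_of_lt h
      have hd : (num N).drop (num (n ^ d)).length = false :: num m := by
        simp [hm, Nat.add_assoc, List.replicate_succ]
      rw [hd]
      refine ((does_ifPop_cons (T := 1) rfl ((does_push EReg.n false _).congr rfl le_rfl
        (by simp; rfl) _)).seq ((does_clear EReg.ic _).congr (T₁ := N * 3 + 2) rfl ?_ ?_)).mono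
          (by omega)
      · simp; omega
      · simp [rootStep, h, List.replicate_succ]
    · have hd : (num N).drop (num (n ^ d)).length = [] := by simp [h]
      rw [hd]
      refine ((does_ifPop_nil (T := 1) rfl (does_nop _)).seq ((does_clear EReg.ic _).congr
        (T₁ := N * 3 + 2) rfl ?_ ?_)).mono (by omega)
      · simp
      · simp [rootStep, h.not_gt]
  refine (h₁.seq (h₂.seq (h₃.seq h₄))).congr rfl ?_ rfl
  have := powTime_mono d hn
  have := Nat.pow_le_pow_left hn d
  simp [rootTime]
  omega

/-- The contents of the registers in the course of the computation. -/
abbrev eEnv (N n T : ℕ) (idx a x out : List Bool) (z : Bool) : ERegs :=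
  {z := num N, idx := idx, n := num n, clk := num T, a := a, x := x, out := out, bad := flag z}

/-- The time to compare `M` and `D` on a question. -/
def compareTime (N n T t : ℕ) : ℕ := M.simTime (n + N + 2) T + D.simTime (n + 1) t + 6

variable {D} {δ : List Bool → Bool} {t : ℕ → ℕ} (hD : ∀ x, OutputsWithin D [x] [δ x] (t x.length))

include hD in
theorem does_compareBody (N n T : ℕ) (idx a x out : List Bool) (z : Bool) (ha : a.length = N)
    (hx : x.length = n) :
    Does (compareBody M D) ((eEnv N n T idx a x out z).st M D) (compareTime M D N n T (t n))
      ((eEnv N n T idx a x out (z || (M.result T [x, a] != δ x))).st M D) := by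
  have h₁ : Does (sim false .clk .ic .tmp .res [.x, .a]) ((eEnv N n T idx a x out z).st M D)
      (M.simTime (n + N + 2) T)
      (({eEnv N n T idx a x out z with res := [M.result T [x, a]]} : ERegs).st M D) := by
    refine (does_sim false (by decide) (by decide) (by decide) (by decide) (by decide)
      _ rfl rfl rfl).congr rfl (M.simTime_mono ?_ ?_) ?_
    · simp [length_encodeInput]; omega
    · simp
    · simp [pair]
  have h₂ : Does (simFree true .tmp .ex [.x])
      (({eEnv N n T idx a x out z with res := [M.result T [x, a]]} : ERegs).st M D)
      (D.simTime (n + 1) (t n))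
      (({eEnv N n T idx a x out z with res := [M.result T [x, a]], ex := [δ x]} :
        ERegs).st M D) := by
    refine (does_simFree (n := t n) (b := δ x) true (by decide) _ rfl rfl ?_).congr rfl
      (D.simTime_mono ?_ le_rfl) ?_
    · exact hx ▸ hD x
    · simp [length_encodeInput]; omega
    · simp
  have h₃ : Does (cmp .res .ex .bad)
      (({eEnv N n T idx a x out z with res := [M.result T [x, a]], ex := [δ x]} :
        ERegs).st M D) 6
      ((eEnv N n T idx a x out (z || (M.result T [x, a] != δ x))).st M D) :=
    (does_cmp (by decide) (by decide) (by decide) _ rfl rfl rfl).congr rfl le_rfl (by simp)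
  refine (h₁.seq (h₂.seq h₃)).mono ?_
  simp only [compareTime]
  omega

/-- Does the machine `M` with advice `a` err on some string of length `n`? -/
def errs (δ : List Bool → Bool) (T n : ℕ) (a : List Bool) : Bool :=
  (enum n).any fun x => M.result T [x, a] != δ x

/-- Count the string `a` if it is good advice, and select it if the counter overflows. -/
def candidateStep (δ : List Bool → Bool) (T n : ℕ) (w : List Bool × List Bool) (a : List Bool) :
    List Bool × List Bool :=
  if errs M δ T n a then w else (incr w.1, if overflows w.1 then a else w.2)

variable (D) in
/-- The time for a candidate. -/
def candidateTime (L N n T t : ℕ) : ℕ :=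
  2 ^ n * (compareTime M D N n T t + (6 * n + 9)) + n * 10 + L * 6 + N * 10 + 40

-- The bit that `inc` leaves in `o` tells that the counter did not overflow; it is consumed at once,
-- since `o` must be empty again for the enclosing enumeration.
include hD in
theorem does_candidateBody (N n T : ℕ) (idx a out : List Bool) (ha : a.length = N)
    (ho : out.length ≤ N) :
    Does (candidateBody M D) ((eEnv N n T idx a [] out false).st M D)
      (candidateTime M D idx.length N n T (t n))
      ((eEnv N n T (candidateStep M δ T n (idx, out) a).1 a []
        (candidateStep M δ T n (idx, out) a).2 false).st M D) := by
  have h₁ : Does (copy .n .x .tmp) ((eEnv N n T idx a [] out false).st M D) (n * 7 + 4)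
      ((eEnv N n T idx a (num n) out false).st M D) :=
    (does_copy (by decide) (by decide) (by decide) _ rfl).congr rfl (by simp) (by simp)
  have h₂ := does_forBits (r := EReg.x) (t := .tmp) (o := .o) (body := compareBody M D)
    (by decide) (by decide) (by decide) (fun z x => (eEnv N n T idx a x out z).st M D)
    (fun z x => z || (M.result T [x, a] != δ x)) (fun _ => True) (fun _ _ => rfl)
    (fun _ _ => rfl) (fun _ _ => rfl) (fun _ _ _ => by simp) n
    (fun z x hx _ => ⟨does_compareBody M hD N n T idx a x out z ha hx, trivial⟩) false trivial
  have e : ∀ (l : List (List Bool)) (z : Bool),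
      l.foldl (fun z x => z || (M.result T [x, a] != δ x)) z =
        (z || l.any fun x => M.result T [x, a] != δ x) := by
    intro l
    induction l with
    | nil => simp
    | cons b l ih => intro z; rw [List.foldl_cons, ih, List.any_cons, Bool.or_assoc]
  rw [e, Bool.false_or] at h₂
  have h₃ : Does (clear .x) ((eEnv N n T idx a (num n) out (errs M δ T n a)).st M D) (n * 3 + 2)
      ((eEnv N n T idx a [] out (errs M δ T n a)).st M D) :=
    (does_clear EReg.x _).congr rfl (by simp) (by simp)
  have h₄ : Does (ifPop .bad nop (inc .idx .tmp .o ⨾ ifPop .o nop (clear .out ⨾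
      copy .a .out .tmp))) ((eEnv N n T idx a [] out (errs M δ T n a)).st M D)
      (idx.length * 6 + N * 10 + 17) ((eEnv N n T (candidateStep M δ T n (idx, out) a).1 a []
        (candidateStep M δ T n (idx, out) a).2 false).st M D) := by
    cases hs : errs M δ T n a with
    | true =>
      refine (does_ifPop_cons (T := 1) (b := true) (l := []) rfl
        ((does_nop _).congr rfl le_rfl ?_ _)).mono (by omega)
      simp [candidateStep, hs, eEnv, flag]
    | false =>
      have hi := (does_inc (r := EReg.idx) (t := .tmp) (o := .o) (by decide) (by decide)
        (by decide) ((eEnv N n T idx a [] out false).st M D) rfl)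
      refine (does_ifPop_nil (T := idx.length * 6 + N * 10 + 15) rfl ?_).mono (by omega)
      cases hov : overflows idx with
      | false =>
        refine (hi.seq ((does_ifPop_cons (T := 1) (b := true) (l := []) ?_
          ((does_nop _).congr rfl le_rfl ?_ _)))).mono ?_
        · simp [hov]
        · simp [candidateStep, hs, hov]
        · simp; omega
      | true =>
        have hc : Does (clear .out) ((eEnv N n T (incr idx) a [] out false).st M D) (N * 3 + 2)
            ((eEnv N n T (incr idx) a [] [] false).st M D) :=
          (does_clear EReg.out _).congr rfl (by simp; omega) (by simp)
        have hc' : Does (copy .a .out .tmp) ((eEnv N n T (incr idx) a [] [] false).st M D)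
            (N * 7 + 4) ((eEnv N n T (incr idx) a [] a false).st M D) :=
          (does_copy (by decide) (by decide) (by decide) _ rfl).congr rfl (by simp [ha])
            (by simp)
        refine (hi.seq (does_ifPop_nil ?_ ((hc.seq hc').congr ?_ le_rfl ?_))).mono ?_
        · simp [hov]
        · simp [hov]
        · simp [candidateStep, hs, hov]
        · simp; omega
  refine (h₁.seq (h₂.seq (h₃.seq h₄))).congr rfl ?_ rfl
  simp only [candidateTime]
  omega

/-- The output of the exponential time machine. -/
def expOutput (δ : List Bool → Bool) (T n N : ℕ) (idx : List Bool) : List Bool :=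
  ((enum N).foldl (candidateStep M δ T n) (idx, [])).2

variable (D) in
/-- The time of the exponential time machine. -/
def expTime (d k L N n t : ℕ) : ℕ :=
  2 ^ N * (candidateTime M D L N n (polyBound k n) t + (6 * N + 9)) + N * (rootTime d N + 2) +
    powTime n k + k + polyBound k n * 3 + n * 3 + N * 30 + L * 10 + 100

theorem length_candidateStep_fst (T n : ℕ) (w : List Bool × List Bool) (a : List Bool) :
    (candidateStep M δ T n w a).1.length = w.1.length := by
  unfold candidateStep
  split_ifs <;> simp

theorem length_foldl_candidateStep_fst (T n : ℕ) (l : List (List Bool))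
    (w : List Bool × List Bool) :
    (l.foldl (candidateStep M δ T n) w).1.length = w.1.length := by
  induction l generalizing w with
  | nil => rfl
  | cons a l ih => rw [List.foldl_cons, ih, length_candidateStep_fst]

include hD in
theorem outputsWithin_exp {d : ℕ} (hd : 0 < d) (k N : ℕ) (idx : List Bool) :
    OutputsWithin ((expProg M D d k).machine .out) [num N, idx]
      (expOutput M δ (polyBound k (root d N)) (root d N) N idx)
      (expTime M D d k idx.length N (root d N) (t (root d N))) := by
  set n := root d N with hn
  set T := polyBound k n with hT
  have h₁ : Does (readField .z .tmp) (({} : ERegs).st M D (encodeInput [num N, idx])) (N * 6 + 4)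
      (({z := num N} : ERegs).st M D (encodeInput [idx])) :=
    (does_readField (by decide) _ (encodeInput_cons _ _) rfl).congr rfl (by simp) (by simp)
  have h₂ : Does (readField .idx .tmp) (({z := num N} : ERegs).st M D (encodeInput [idx]))
      (idx.length * 6 + 4) (({z := num N, idx := idx} : ERegs).st M D) :=
    (does_readField (by decide) _ (encodeInput_cons _ _) rfl).congr rfl le_rfl
      (by simp [encodeInput])
  have h₃ : Does (copy .z .oc .tmp) (({z := num N, idx := idx} : ERegs).st M D) (N * 7 + 4)
      (({z := num N, idx := idx, n := num 0, oc := num N} : ERegs).st M D) :=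
    (does_copy (by decide) (by decide) (by decide) _ rfl).congr rfl (by simp) (by simp)
  have h₄ := does_foreach (T := rootTime d N) (r := EReg.oc) (body := rootBody M D d)
    (fun n l => (({z := num N, idx := idx, n := num n, oc := l} : ERegs).st M D))
    (fun n _ => rootStep d N n) (fun n => n ≤ N) (fun _ _ => rfl)
    (fun n b l hn => ⟨((does_rootBody M D d N n hn idx l).congr (by simp) le_rfl rfl _),
      rootStep_le hd hn⟩) 0 (num N) (Nat.zero_le _)
  rw [foldl_const_eq_iterate, List.length_replicate] at h₄
  have h₅ : Does (clock .n .clk .aux .tmp k)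
      (({z := num N, idx := idx, n := num n} : ERegs).st M D) (powTime n k + (k + 1))
      ((eEnv N n T idx [] [] [] false).st M D) :=
    (does_clock (by decide) (by decide) (by decide) (by decide) (by decide) (by decide) _ rfl rfl
      rfl rfl k).congr rfl le_rfl (by simp [hT, eEnv, flag])
  have h₆ : Does (copy .z .a .tmp) ((eEnv N n T idx [] [] [] false).st M D) (N * 7 + 4)
      ((eEnv N n T idx (num N) [] [] false).st M D) :=
    (does_copy (by decide) (by decide) (by decide) _ rfl).congr rfl (by simp) (by simp)
  have h₇ := does_forBits (r := EReg.a) (t := .tmp) (o := .o) (body := candidateBody M D)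
    (by decide) (by decide) (by decide)
    (fun (w : List Bool × List Bool) a => (eEnv N n T w.1 a [] w.2 false).st M D)
    (candidateStep M δ T n) (fun w => w.1.length = idx.length ∧ w.2.length ≤ N) (fun _ _ => rfl)
    (fun _ _ => rfl) (fun _ _ => rfl) (fun _ _ _ => by simp) N
    (fun w a ha hw => ⟨hw.1 ▸ does_candidateBody M hD N n T w.1 a w.2 ha hw.2, by
      rw [length_candidateStep_fst]
      refine ⟨hw.1, ?_⟩
      unfold candidateStep
      split_ifs
      exacts [hw.2, ha.le, hw.2]⟩) (idx, []) ⟨rfl, Nat.zero_le _⟩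
  have hc : ∀ (r : EReg) (e : ERegs), Does (clear r) (e.st M D) ((e.get r).length * 3 + 2)
      ((e.set r []).st M D) := fun r e => (does_clear r _).congr rfl le_rfl (by simp)
  have h : Does (expProg M D d k) _ _ _ :=
    h₁.seq (h₂.seq (h₃.seq (h₄.seq (h₅.seq (h₆.seq (h₇.seq ((hc .z _).seq ((hc .idx _).seq
      ((hc .n _).seq ((hc .clk _).seq (hc .a _)))))))))))
  obtain ⟨w, h⟩ := h none
  have e : ((({} : ERegs).st M D (encodeInput [num N, idx])).setV none) =
      St.start (pair M D) EReg (encodeInput [num N, idx]) :=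
    St.ext_reg (fun r => by cases r <;> rfl) rfl rfl rfl
  rw [e] at h
  refine OutputsWithin.mono (VProg.outputsWithin h ?_ ?_ ?_) ?_
  · rfl
  · funext r
    cases r <;> rfl
  · rfl
  · simp [expTime, length_foldl_candidateStep_fst, ← hT]
    ring_nf
    omega

end EXP

end AdviceComplexity

/-! ## The index of good advice -/

namespace AdviceComplexity

section Index

/-- The number with given binary digits, least significant digit first. -/
def val : List Bool → ℕ
  | [] => 0
  | b :: l => b.toNat + 2 * val l

theorem val_num (n : ℕ) : val (num n) = 0 := by
  induction n with
  | zero => rfl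
  | succ n ih => simp [List.replicate_succ, val, ih]

theorem val_incr {l : List Bool} (h : overflows l = false) : val (incr l) = val l + 1 := by
  induction l with
  | nil => simp [overflows] at h
  | cons b l ih =>
    cases b
    · simp [incr, val]; omega
    · have : val (incr l) = val l + 1 := ih (by simpa [overflows] using h)
      simp [incr, val, this]; omega

/-- All digits are ones exactly at the greatest value 2 ^ length - 1. -/
theorem overflows_iff (l : List Bool) : overflows l = true ↔ 2 ^ l.length ≤ val l + 1 := by
  induction l with
  | nil => simp [overflows, val]
  | cons b l ih =>
    have : overflows (b :: l) = (b && overflows l) := rfl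
    rw [this, Bool.and_eq_true, ih, List.length_cons, pow_succ, val]
    have : val l < 2 ^ l.length := by
      clear ih this
      induction l with
      | nil => simp [val]
      | cons b l ih => cases b <;> simp [val, pow_succ] <;> omega
    cases b <;> simp <;> omega

theorem exists_val_eq {L v : ℕ} (h : v < 2 ^ L) : ∃ l : List Bool, l.length = L ∧ val l = v := by
  induction L generalizing v with
  | zero => exact ⟨[], rfl, by simp at h; simp [val, h]⟩
  | succ L ih =>
    obtain ⟨l, hl, hv⟩ := ih (v := v / 2) (by rw [pow_succ] at h; omega)
    rcases Nat.mod_two_eq_zero_or_one v with h' | h'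
    · exact ⟨false :: l, by simp [hl], by simp [val, hv]; omega⟩
    · exact ⟨true :: l, by simp [hl], by simp [val, hv]; omega⟩

variable (M : Machine) (δ : List Bool → Bool) (T n : ℕ)

/-- While the counter has room for all good strings of the list, it never overflows: it advances by
their number, and the selected string stays the same. -/
theorem foldl_candidateStep (l : List (List Bool)) (w : List Bool × List Bool)
    (h : val w.1 + l.countP (fun a => !errs M δ T n a) < 2 ^ w.1.length) :
    (l.foldl (candidateStep M δ T n) w).2 = w.2 ∧
      val (l.foldl (candidateStep M δ T n) w).1 =
        val w.1 + l.countP (fun a => !errs M δ T n a) := by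
  induction l generalizing w with
  | nil => simp
  | cons a l ih =>
    rw [List.countP_cons] at h
    rw [List.foldl_cons, List.countP_cons]
    cases ha : errs M δ T n a with
    | true =>
      have e : candidateStep M δ T n w a = w := by simp [candidateStep, ha]
      rw [e]
      simp only [ha, Bool.not_true, Bool.false_eq_true, if_false, Nat.add_zero] at h ⊢
      exact ih w h
    | false =>
      simp only [ha, Bool.not_false, if_true] at h ⊢
      have ho : overflows w.1 = false := by
        rw [← Bool.not_eq_true, overflows_iff]
        omega
      have e : candidateStep M δ T n w a = (incr w.1, w.2) := by simp [candidateStep, ha, ho]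
      have hv := val_incr ho
      rw [e]
      obtain ⟨h₁, h₂⟩ := ih (incr w.1, w.2) (by simp only [length_incr, hv]; omega)
      refine ⟨h₁, h₂.trans ?_⟩
      simp only [hv]
      omega

/-- If there are at most `2 ^ L` strings of good advice, then each of them is selected by an index
of length `L`. -/
theorem exists_expOutput_eq {N L : ℕ} {a : List Bool} (ha : a.length = N)
    (hg : errs M δ T n a = false)
    (h : (enum N).countP (fun a => !errs M δ T n a) ≤ 2 ^ L) :
    ∃ idx : List Bool, idx.length = L ∧ expOutput M δ T n N idx = a := by
  obtain ⟨l₁, l₂, hl⟩ := List.append_of_mem (mem_enum.2 ha)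
  rw [hl, List.countP_append, List.countP_cons] at h
  simp only [hg, Bool.not_false, if_true] at h
  set r := l₁.countP fun a => !errs M δ T n a with hr
  -- With `r` good strings before `a`, this starting value makes the counter reach its maximum just
  -- before `a`, so that `a` causes the overflow.
  obtain ⟨idx, hi, hv⟩ := exists_val_eq (L := L) (v := 2 ^ L - 1 - r) (by omega)
  refine ⟨idx, hi, ?_⟩
  rw [expOutput, hl, List.foldl_append, List.foldl_cons]
  have h₁ := foldl_candidateStep M δ T n l₁ (idx, []) (by simp only [hv, hi, ← hr]; omega)
  have hlen := length_foldl_candidateStep_fst M (δ := δ) T n l₁ (idx, [])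
  generalize l₁.foldl (candidateStep M δ T n) (idx, []) = w at h₁ hlen
  have ho : overflows w.1 = true := by
    rw [overflows_iff, h₁.2, hlen, ← hr, hi, hv]
    omega
  have e : candidateStep M δ T n w a = (num L, a) := by
    simp only [candidateStep, hg, Bool.false_eq_true, if_false, ho, if_true,
      incr_of_overflows ho, hlen, hi]
  rw [e]
  -- The counter restarts at 0, and fewer than 2 ^ L good strings follow, so `a` is not replaced.
  exact (foldl_candidateStep M δ T n l₂ (num L, a) (by
    simp only [val_num, List.length_replicate]; omega)).1

end Index

/-! ## Random strings -/

section Random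

/-- The strings of length `n`. -/
def strings (n : ℕ) : Finset (List Bool) := (enum n).toFinset

@[simp] theorem mem_strings {n : ℕ} {w : List Bool} : w ∈ strings n ↔ w.length = n := by
  simp [strings, mem_enum]

theorem card_strings (n : ℕ) : (strings n).card = 2 ^ n := by
  rw [strings, List.toFinset_card_of_nodup (nodup_enum n), length_enum]

theorem countP_enum (n : ℕ) (p : List Bool → Bool) :
    (enum n).countP p = ((strings n).filter fun a => p a = true).card := by
  rw [List.countP_eq_length_filter, strings, ← List.toFinset_filter,
    List.toFinset_card_of_nodup ((nodup_enum n).filter _)]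

/-- The expectation over a uniformly random string of length `n`. -/
noncomputable def expect (n : ℕ) (f : List Bool → ℝ) : ℝ := (∑ w ∈ strings n, f w) / 2 ^ n

theorem expect_const (n : ℕ) (c : ℝ) : expect n (fun _ => c) = c := by
  simp [expect, card_strings]

theorem expect_congr {n : ℕ} {f g : List Bool → ℝ} (h : ∀ w, w.length = n → f w = g w) :
    expect n f = expect n g := by
  rw [expect, expect, Finset.sum_congr rfl fun w hw => h w (mem_strings.1 hw)]

/-- Independence of disjoint parts of a random string: splitting after `a` bits is a bijection onto
pairs. -/
theorem expect_add_length (a b : ℕ) (f : List Bool → ℝ) :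
    expect (a + b) f = expect a fun u => expect b fun v => f (u ++ v) := by
  simp only [expect]
  rw [← Finset.sum_div, div_div, pow_add, mul_comm, ← Finset.sum_product']
  congr 1
  refine Finset.sum_bij' (fun w _ => (w.take a, w.drop a)) (fun p _ => p.1 ++ p.2) ?_ ?_ ?_ ?_ ?_
  · intro w hw
    rw [mem_strings] at hw
    simp [hw]
  · intro p hp
    rw [Finset.mem_product, mem_strings, mem_strings] at hp
    simp [hp]
  · intro w _
    simp
  · rintro ⟨u, v⟩ hp
    simp only [Finset.mem_product, mem_strings] at hp
    simp [← hp.1]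
  · intro w _
    simp

theorem expect_reverse (n : ℕ) (f : List Bool → ℝ) :
    (expect n fun w => f w.reverse) = expect n f := by
  unfold expect
  congr 1
  exact Finset.sum_bij' (fun w _ => w.reverse) (fun w _ => w.reverse) (by simp) (by simp)
    (by simp) (by simp) (by simp)

theorem expect_tail (n : ℕ) (f : List Bool → ℝ) :
    (expect (n + 1) fun w => f w.tail) = expect n f := by
  rw [add_comm, expect_add_length]
  refine (expect_congr fun u hu => ?_).trans (expect_const 1 (expect n f))
  obtain ⟨b, rfl⟩ := List.length_eq_one_iff.1 hu
  rfl

theorem expect_nonneg_le_one {n : ℕ} {f : List Bool → ℝ} (h : ∀ w, 0 ≤ f w ∧ f w ≤ 1) :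
    expect n f ≤ 1 := by
  rw [expect, div_le_one (by positivity)]
  refine (Finset.sum_le_sum fun w _ => (h w).2).trans ?_
  simp [card_strings]

theorem prob_ofFn (m : ℕ) (p : List Bool → Prop) [DecidablePred p] :
    prob m {r | p (List.ofFn r)} = 1 - expect m fun w => if p w then 0 else 1 := by
  have h₁ : ({r : Fin m → Bool | p (List.ofFn r)}.ncard : ℝ) =
      ((strings m).filter p).card := by
    rw [← Set.ncard_image_of_injective _ List.ofFn_injective, ← Set.ncard_coe_finset]
    congr 2
    ext w
    simp only [Set.mem_image, Set.mem_ofPred_eq, Finset.coe_filter, mem_strings]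
    constructor
    · rintro ⟨r, hr, rfl⟩
      exact ⟨by simp, hr⟩
    · rintro ⟨rfl, hw⟩
      exact ⟨w.get, by simpa using hw, by simp⟩
  have h₂ : (∑ w ∈ strings m, if p w then (0 : ℝ) else 1) =
      2 ^ m - ((strings m).filter p).card := by
    have := Finset.card_filter_add_card_filter_not (s := strings m) p
    rw [card_strings] at this
    have h : (((strings m).filter p).card : ℝ) + ((strings m).filter fun w => ¬ p w).card =
        2 ^ m := by
      exact_mod_cast this
    rw [← h, add_sub_cancel_left, Finset.card_filter]
    push_cast
    exact Finset.sum_congr rfl fun w _ => by by_cases h : p w <;> simp [h]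
  rw [prob, expect, h₁, h₂]
  field_simp
  ring

end Random

/-! ## The choice of the tests -/

section Tests

-- Greedy choice of tests. `S` plays the role of the good strings: they pass every test, so the
-- survivors can never become fewer than `S`. A question on which less than 3/4 of the survivors are
-- right becomes a test, and the hypothesis `ht` leaves no room for `t` such choices.
open Classical in
theorem exists_tests {α β : Type} (U S : Finset α) (X : Set β) (ok : β → α → Prop)
    (hU : S ⊆ U) (hS : ∀ a ∈ S, ∀ x ∈ X, ok x a) (t : ℕ)
    (ht : 3 ^ t * U.card < 4 ^ t * S.card) :
    ∃ Q : List β, Q.length ≤ t ∧ (∀ x ∈ Q, x ∈ X) ∧ ∀ x ∈ X,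
      3 * (U.filter fun a => ∀ y ∈ Q, ok y a).card ≤
        4 * (U.filter fun a => (∀ y ∈ Q, ok y a) ∧ ok x a).card := by
  by_contra hcon
  push Not at hcon
  -- If the process never stopped, i tests would leave at most a fraction (3/4) ^ i of `U`.
  have key : ∀ i ≤ t, ∃ Q : List β, Q.length = i ∧ (∀ x ∈ Q, x ∈ X) ∧
      4 ^ i * (U.filter fun a => ∀ y ∈ Q, ok y a).card ≤ 3 ^ i * U.card := by
    intro i
    induction i with
    | zero => exact fun _ => ⟨[], rfl, by simp, by simp⟩
    | succ i ih =>
      intro hi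
      obtain ⟨Q, hQ, hX, hc⟩ := ih (by omega)
      obtain ⟨x, hx, h⟩ := hcon Q (by omega) hX
      refine ⟨x :: Q, by simp [hQ], by simpa [hx] using hX, ?_⟩
      have e : (U.filter fun a => ∀ y ∈ x :: Q, ok y a) =
          U.filter fun a => (∀ y ∈ Q, ok y a) ∧ ok x a := by
        refine Finset.filter_congr fun a _ => ?_
        simp [and_comm]
      rw [e, pow_succ, pow_succ]
      nlinarith [pow_pos (show 0 < 4 by norm_num) i]
  obtain ⟨Q, -, hX, hc⟩ := key t le_rfl
  have : S.card ≤ (U.filter fun a => ∀ y ∈ Q, ok y a).card :=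
    Finset.card_le_card fun a ha =>
      Finset.mem_filter.2 ⟨hU ha, fun y hy => hS a ha y (hX y hy)⟩
  exact absurd (ht.trans_le (Nat.mul_le_mul_left _ this)) hc.not_gt

/-- Three reductions by the factor 3/4 more than halve a set, as 27 * 2 ≤ 64, and `q` is less than 2
to the power of its bit length. -/
theorem three_pow_mul_lt_four_pow (q : ℕ) :
    3 ^ (3 * (Nat.log 2 q + 1)) * q < 4 ^ (3 * (Nat.log 2 q + 1)) := by
  have h : q < 2 ^ (Nat.log 2 q + 1) := Nat.lt_pow_succ_log_self (by norm_num) q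
  set j := Nat.log 2 q + 1
  rw [pow_mul, pow_mul]
  calc (3 ^ 3) ^ j * q < (3 ^ 3) ^ j * 2 ^ j := by gcongr
    _ = (3 ^ 3 * 2) ^ j := (mul_pow ..).symm
    _ ≤ (4 ^ 3) ^ j := Nat.pow_le_pow_left (by norm_num) j

/-- The advice that consists of the tests with the questions `Q`. -/
def testAdvice (δ : List Bool → Bool) (Q : List (List Bool)) : List Bool :=
  -- Questions are stored backwards because `takeBits` reverses what it takes.
  Q.flatMap fun x => δ x :: x.reverse

theorem length_testAdvice (δ : List Bool → Bool) {Q : List (List Bool)} {n : ℕ}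
    (hQ : ∀ x ∈ Q, x.length = n) : (testAdvice δ Q).length = Q.length * (n + 1) := by
  induction Q with
  | nil => simp [testAdvice]
  | cons x Q ih =>
    have := ih fun y hy => hQ y (List.mem_cons_of_mem _ hy)
    have hx := hQ x List.mem_cons_self
    simp only [testAdvice, List.flatMap_cons, List.length_append, List.length_cons,
      List.length_reverse, hx] at this ⊢
    rw [this]
    ring

theorem stepList_iterate_nil {α : Type} (g : Bool → List Bool → α → List Bool × α) (i : ℕ)
    (z : α) : (stepList g)^[i] ([], z) = ([], z) := Function.iterate_fixed rfl i

/-- The machine makes as many rounds as the advice has bits, more than there are tests if n > 0; the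
induction therefore allows any sufficient number `i` of rounds. -/
theorem fails_testAdvice (M : Machine) (δ : List Bool → Bool) (T : ℕ) {n : ℕ} (a : List Bool)
    {Q : List (List Bool)} (hQ : ∀ x ∈ Q, x.length = n) :
    fails M T n (testAdvice δ Q) a = Q.any fun x => δ x != M.result T [x, a] := by
  have key : ∀ (Q : List (List Bool)) (i : ℕ) (z : Bool), (∀ x ∈ Q, x.length = n) →
      Q.length ≤ i → (stepList (testStep M T n a))^[i] (testAdvice δ Q, z) =
        ([], z || Q.any fun x => δ x != M.result T [x, a]) := by
    intro Q
    induction Q with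
    | nil => intro i z _ _; simp [testAdvice, stepList_iterate_nil]
    | cons x Q ih =>
      intro i z hQ hi
      have hx := hQ x List.mem_cons_self
      obtain ⟨i, rfl⟩ := Nat.exists_eq_add_of_le' (Nat.one_le_of_lt hi)
      rw [Function.iterate_succ_apply]
      have e : stepList (testStep M T n a) (testAdvice δ (x :: Q), z) =
          (testAdvice δ Q, z || (δ x != M.result T [x, a])) := by
        simp only [testAdvice, List.flatMap_cons, List.cons_append, stepList, testStep]
        rw [List.drop_left' (by simpa using hx), List.take_left' (by simpa using hx),
          List.reverse_reverse]
      rw [e, ih _ _ (fun y hy => hQ y (List.mem_cons_of_mem _ hy)) (by simpa using hi),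
        List.any_cons, Bool.or_assoc]
  rw [fails, key Q _ _ hQ, Bool.false_or]
  rw [length_testAdvice δ hQ]
  exact Nat.le_mul_of_pos_right _ (by omega)

end Tests

/-! ## The success probability -/

section Success

variable (M : Machine) (T n N : ℕ) (adv x : List Bool)

theorem blockStep_iterate_of_ne_nil (i : ℕ) (l z : List Bool) (hz : z ≠ []) :
    ((stepList (blockStep M T n N adv x))^[i] (l, z)).2 = z := by
  induction i generalizing l with
  | zero => rfl
  | succ i ih =>
    cases l with
    | nil => exact ih []
    | cons c l =>
      rw [Function.iterate_succ_apply]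
      simp only [stepList, blockStep, if_pos hz]
      exact ih _

theorem stepList_iterate_of_le {α : Type} {g : Bool → List Bool → α → List Bool × α}
    (hg : ∀ b l x, (g b l x).1.length ≤ l.length) {i : ℕ} {l : List Bool} (x : α)
    (h : l.length ≤ i) : (stepList g)^[i] (l, x) = (stepList g)^[l.length] (l, x) := by
  obtain ⟨j, rfl⟩ := Nat.exists_eq_add_of_le' h
  rw [Function.iterate_add_apply]
  have := stepList_iterate_fst hg l.length l x le_rfl
  generalize (stepList g)^[l.length] (l, x) = w at this
  obtain ⟨w₁, w₂⟩ := w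
  simp only at this
  rw [this, stepList_iterate_nil]

/-- After a failed block the machine behaves as if started afresh on the remaining bits, because its
surplus rounds are idle. A block takes N + 1 random bits: the loop pops one, and the other N,
reversed, are the candidate advice. -/
theorem bppAnswer_append (u w : List Bool) (hu : u.length = N + 1) :
    bppAnswer M x adv n N T (u ++ w) = if fails M T n adv u.tail.reverse then
      bppAnswer M x adv n N T w else M.result T [x, u.tail.reverse] := by
  obtain ⟨c, b, rfl⟩ := List.exists_cons_of_length_eq_add_one hu
  have hb : b.length = N := by simpa using hu
  change _ = if fails M T n adv b.reverse then _ else M.result T [x, b.reverse]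
  rw [bppAnswer, List.cons_append, List.length_cons, Function.iterate_succ_apply]
  simp only [stepList, blockStep, ne_eq, not_true, if_false,
    List.drop_left' hb, List.take_left' hb]
  by_cases h : fails M T n adv b.reverse = true
  · rw [if_pos h, if_pos h, stepList_iterate_of_le (fun _ _ _ => by simp [blockStep]) _ (by simp)]
    rfl
  · rw [if_neg h, if_neg h, blockStep_iterate_of_ne_nil _ _ _ _ _ _ _ _ _ (by simp)]
    rfl

open Classical in
/-- If `C` is the set of the strings that pass all tests, with density at least `g`, and three
quarters of them are right about `x`, then the probability of an error within `q` blocks. -/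
theorem expect_error_le (b : Bool) {g : ℝ}
    (hg : g * 2 ^ N = ((strings N).filter fun a => fails M T n adv a = false).card)
    (h : 3 * ((strings N).filter fun a => fails M T n adv a = false).card ≤
      4 * ((strings N).filter fun a => fails M T n adv a = false ∧ M.result T [x, a] = b).card)
    (q e : ℕ) :
    expect (q * (N + 1) + e) (fun r => if bppAnswer M x adv n N T r = b then 0 else 1) ≤
      1 / 4 + 3 / 4 / (1 + g * q) := by
  have hg₀ : 0 ≤ g := by
    by_contra hneg
    have : g * 2 ^ N < 0 := mul_neg_of_neg_of_pos (not_le.1 hneg) (by positivity)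
    rw [hg] at this
    exact absurd this (by simp)
  have hg₁ : g ≤ 1 := by
    have : g * 2 ^ N ≤ 1 * 2 ^ N := by
      rw [hg, one_mul]
      exact_mod_cast (Finset.card_filter_le _ _).trans (card_strings N).le
    exact le_of_mul_le_mul_right this (by positivity)
  induction q with
  | zero =>
    refine (expect_nonneg_le_one fun w => ?_).trans (by norm_num)
    split_ifs <;> norm_num
  | succ q ih =>
    have e₁ : (q + 1) * (N + 1) + e = (N + 1) + (q * (N + 1) + e) := by ring
    rw [e₁, expect_add_length]
    set v := expect (q * (N + 1) + e) fun r => if bppAnswer M x adv n N T r = b then 0 else 1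
    -- Deleting the first bit and reversing turns a uniform string of N + 1 bits into a uniform
    -- string of N bits.
    have e₂ : (expect (N + 1) fun u => expect (q * (N + 1) + e) fun w =>
        if bppAnswer M x adv n N T (u ++ w) = b then 0 else 1) =
        expect N fun a => if fails M T n adv a = true then v else
          if M.result T [x, a] = b then 0 else 1 := by
      rw [← expect_reverse N, ← expect_tail N]
      refine expect_congr fun u hu => ?_
      split_ifs with h₁ h₂
      · exact expect_congr fun w _ => by rw [bppAnswer_append _ _ _ _ _ _ _ _ hu, if_pos h₁]
      · exact (expect_congr fun w _ => by
          rw [bppAnswer_append _ _ _ _ _ _ _ _ hu, if_neg h₁, if_pos h₂]).trans (expect_const _ 0)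
      · exact (expect_congr fun w _ => by
          rw [bppAnswer_append _ _ _ _ _ _ _ _ hu, if_neg h₁, if_neg h₂]).trans (expect_const _ 1)
    set C := (strings N).filter fun a => fails M T n adv a = false with hC
    set R := (strings N).filter fun a => fails M T n adv a = false ∧ M.result T [x, a] = b
      with hR
    -- The error is `v` for a block that fails, 0 for one that passes and is right, and 1 for one
    -- that passes and is wrong; written with indicators, it sums to an expression in the
    -- cardinalities of `C` and `R`.
    have e₃ : ∀ a, (if fails M T n adv a = true then v else
        if M.result T [x, a] = b then 0 else 1) = v + (1 - v) *
          (if fails M T n adv a = false then 1 else 0) -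
          (if fails M T n adv a = false ∧ M.result T [x, a] = b then 1 else 0) := by
      intro a
      cases fails M T n adv a <;> by_cases h : M.result T [x, a] = b <;> simp [h]
    have e₄ : (∑ a ∈ strings N, (if fails M T n adv a = true then v else
        if M.result T [x, a] = b then 0 else 1)) = 2 ^ N * v + (1 - v) * C.card - R.card := by
      rw [Finset.sum_congr rfl fun a _ => e₃ a, Finset.sum_sub_distrib, Finset.sum_add_distrib,
        ← Finset.mul_sum, Finset.sum_boole, Finset.sum_boole]
      simp [card_strings, hC, hR]
    rw [e₂, expect, e₄, div_le_iff₀ (by positivity), ← hg]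
    have h' : 3 * (g * 2 ^ N) ≤ 4 * (R.card : ℝ) := by rw [hg]; exact_mod_cast h
    have hq : 0 < 1 + g * q := by positivity
    have hq' : 0 < 1 + g * (q + 1 : ℕ) := by positivity
    -- The recursion is v' ≤ (1 - g) v + g / 4. The decay (1 - g) ^ q is replaced by 1 / (1 + g q),
    -- which is sufficient since (1 - g)(1 + g (q + 1)) = 1 + g q - g² (q + 1).
    have h₁ : (1 - g) * (3 / 4 / (1 + g * q)) ≤ 3 / 4 / (1 + g * (q + 1 : ℕ)) := by
      rw [mul_div_assoc', div_le_div_iff₀ hq hq']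
      push_cast
      nlinarith [mul_nonneg (mul_nonneg hg₀ hg₀) (Nat.cast_nonneg (α := ℝ) q), mul_nonneg hg₀ hg₀]
    have h₂ : (1 - g) * v ≤ (1 - g) * (1 / 4 + 3 / 4 / (1 + g * q)) :=
      mul_le_mul_of_nonneg_left ih (by linarith)
    have h₃ : (1 - g) * v + g / 4 ≤ 1 / 4 + 3 / 4 / (1 + g * (q + 1 : ℕ)) := by linarith
    have h₄ := mul_le_mul_of_nonneg_right h₃ (show (0 : ℝ) ≤ 2 ^ N by positivity)
    nlinarith

end Success

end AdviceComplexity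

/-! ## The bounds and the theorem -/

namespace AdviceComplexity

open Filter Asymptotics

theorem polyBound_mono (k : ℕ) {n m : ℕ} (h : n ≤ m) : polyBound k n ≤ polyBound k m := by
  unfold polyBound
  gcongr

theorem compareTime_mono (M D : Machine) {N n T t N' n' T' t' : ℕ} (hN : N ≤ N') (hn : n ≤ n')
    (hT : T ≤ T') (ht : t ≤ t') : compareTime M D N n T t ≤ compareTime M D N' n' T' t' :=
  Nat.add_le_add_right (Nat.add_le_add (M.simTime_mono (by omega) hT)
    (D.simTime_mono (by omega) ht)) 6

theorem expTime_mono (M D : Machine) (d k : ℕ) {L N n t t' : ℕ} (hL : L ≤ N) (hn : n ≤ N)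
    (ht : t ≤ t') : expTime M D d k L N n t ≤ expTime M D d k N N N t' := by
  have hT := polyBound_mono k hn
  have h₁ := compareTime_mono M D le_rfl hn hT ht (N := N)
  have h₂ := powTime_mono k hn
  have h₃ : 2 ^ n ≤ 2 ^ N := Nat.pow_le_pow_right (by norm_num) hn
  unfold expTime candidateTime
  gcongr

theorem expB_expTime (M D : Machine) (d k : ℕ) {t : ℕ → ℕ} (ht : ExpB t) :
    ExpB fun N => expTime M D d k N N N (t N) := by
  have hid : ExpB fun N => N := PolyB.id.expB
  have hT : ExpB fun N => polyBound k N := (PolyB.id.polyBound k).expB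
  have h2 : ExpB fun N => 2 ^ N := ExpB.two_pow PolyB.id
  have hp : ∀ k, ExpB fun N => powTime N k := fun k => (PolyB.id.powTime k).expB
  have hc := ExpB.const
  have h₁ : ExpB fun N => compareTime M D N N (polyBound k N) (t N) :=
    ((ExpB.simTime ((hid.add hid).add (hc 2)) hT M).add
      (ExpB.simTime (hid.add (hc 1)) ht D)).add (hc 6)
  have h₂ : ExpB fun N => candidateTime M D N N N (polyBound k N) (t N) :=
    ((((h2.mul (h₁.add (((hc 6).mul hid).add (hc 9)))).add (hid.mul (hc 10))).add
      (hid.mul (hc 6))).add (hid.mul (hc 10))).add (hc 40)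
  have h₃ : ExpB fun N => rootTime d N :=
    (((hp d).add (hid.mul (hc 10))).add ((PolyB.id.pow d).expB.mul (hc 3))).add (hc 20)
  exact ((((((((h2.mul (h₂.add (((hc 6).mul hid).add (hc 9)))).add
    (hid.mul (h₃.add (hc 2)))).add (hp k)).add (hc k)).add (hT.mul (hc 3))).add
    (hid.mul (hc 3))).add (hid.mul (hc 30))).add (hid.mul (hc 10))).add (hc 100)

theorem Machine.bppTime_mono (M : Machine) (d k n : ℕ) {A A' R : ℕ} (h : A ≤ A') :
    M.bppTime d k A R n ≤ M.bppTime d k A' R n := by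
  unfold Machine.bppTime Machine.blockTime Machine.testsTime
  gcongr

theorem polyB_bppTime (M : Machine) (d k : ℕ) {A R : ℕ → ℕ} (hA : PolyB A) (hR : PolyB R) :
    PolyB fun n => M.bppTime d k (A n) (R n) n := by
  have hid := PolyB.id
  have hc := PolyB.const
  have hN : PolyB fun n => n ^ d := hid.pow d
  have hT : PolyB fun n => polyBound k n := hid.polyBound k
  have hs : PolyB fun n => M.simTime (n + n ^ d + 2) (polyBound k n) :=
    PolyB.simTime ((hid.add hN).add (hc 2)) hT M
  have h₁ : PolyB fun n => M.testTime (polyBound k n) n (n ^ d) :=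
    (hs.add (hid.mul (hc 16))).add (hc 18)
  have h₂ : PolyB fun n => M.testsTime (A n) (polyBound k n) n (n ^ d) :=
    (hA.mul (h₁.add (hc 19))).add (hc 10)
  have h₃ : PolyB fun n => M.blockTime (A n) (polyBound k n) n (n ^ d) :=
    ((h₂.add hs).add (hN.mul (hc 16))).add (hc 20)
  exact ((((((((hR.mul (h₃.add (hc 30))).add (hA.mul (hc 10))).add (hid.mul (hc 30))).add
    (hid.powTime d)).add (hid.powTime k)).add (hc k)).add (hN.mul (hc 3))).add
    (hT.mul (hc 3))).add (hc 100)

/-- The strings of length `N` that are good advice for the machine `M` on all inputs of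
length `n`. -/
def goodAdvice (M : Machine) (δ : List Bool → Bool) (T n N : ℕ) : Finset (List Bool) :=
  (strings N).filter fun a => errs M δ T n a = false

theorem errs_eq_false {M : Machine} {δ : List Bool → Bool} {T n : ℕ} {a : List Bool} :
    errs M δ T n a = false ↔ ∀ x : List Bool, x.length = n → M.result T [x, a] = δ x := by
  simp [errs, mem_enum]

/-- If infinitely often there is only little good advice, then `α` is infinitely often easy. -/
theorem infinitelyOften_of_card_goodAdvice_le {α : ℕ → List Bool} (hα : ∀ n, (α n).length = n)
    {ℓ : ℕ → ℕ} (hℓ : ∀ n, ℓ n ≤ n) (M D : Machine) {δ : List Bool → Bool} {t : ℕ → ℕ}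
    (ht : ExpB t) (htm : Monotone t) (hD : ∀ x, OutputsWithin D [x] [δ x] (t x.length))
    {d : ℕ} (hd : 0 < d) (k : ℕ) (hg : ∀ n, errs M δ (polyBound k n) n (α (n ^ d)) = false)
    (h : ∃ᶠ n in atTop, (goodAdvice M δ (polyBound k n) n (n ^ d)).card ≤ 2 ^ ℓ (n ^ d)) :
    α ∈ InfinitelyOften (FunEXPAdviceLength ℓ) := by
  -- The advice is an index that yields `α N` if a short one exists, and empty otherwise; the
  -- machine has to halt in time at every N, but to be right only infinitely often.
  have hβ : ∀ N, ∃ idx : List Bool, idx.length ≤ ℓ N ∧ ((∃ i : List Bool, i.length ≤ ℓ N ∧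
      expOutput M δ (polyBound k (root d N)) (root d N) N i = α N) →
      expOutput M δ (polyBound k (root d N)) (root d N) N idx = α N) := by
    intro N
    by_cases h : ∃ i : List Bool, i.length ≤ ℓ N ∧
      expOutput M δ (polyBound k (root d N)) (root d N) N i = α N
    · obtain ⟨i, hi, h'⟩ := h
      exact ⟨i, hi, fun _ => h'⟩
    · exact ⟨[], Nat.zero_le _, fun h' => absurd h' h⟩
  choose β hβ₁ hβ₂ using hβ
  obtain ⟨K, hK⟩ := (expB_expTime M D d k ht).le_polyBound
  refine ⟨fun N => expOutput M δ (polyBound k (root d N)) (root d N) N (β N),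
    ⟨β, hβ₁, (expProg M D d k).machine .out, K, fun N => ?_⟩, ?_⟩
  · exact (outputsWithin_exp M hD hd k N (β N)).mono
      ((expTime_mono M D d k ((hβ₁ N).trans (hℓ N)) (root_le hd) (htm (root_le hd))).trans (hK N))
  -- Agreement is obtained at the lengths n ^ d, which are unbounded since d > 0.
  · refine (tendsto_pow_atTop hd.ne').frequently (h.mono fun n hn => ?_)
    refine (hβ₂ (n ^ d) ?_).symm
    rw [root_pow hd]
    obtain ⟨i, hi, h'⟩ := exists_expOutput_eq M δ (polyBound k n) n (hα (n ^ d)) (hg n)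
      (L := ℓ (n ^ d)) (by
        rw [countP_enum]
        refine le_trans (le_of_eq ?_) hn
        congr 1
        exact Finset.filter_congr fun a _ => by simp)
    exact ⟨i, hi.le, h'⟩

/-- Up to the factor 2 lost in rounding down, 2 to the power N - c log N is at least 2 ^ N / N ^
⌈c⌉. The truncation at 0 in the exponent only strengthens the hypothesis. -/
theorem two_pow_le_of_lt (c : ℝ) {N s : ℕ} (hN : 0 < N)
    (h : 2 ^ ⌊(N : ℝ) - c * Real.logb 2 N⌋₊ < s) : 2 ^ N ≤ 2 * N ^ ⌈c⌉₊ * s := by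
  have hN' : (1 : ℝ) ≤ N := by exact_mod_cast hN
  have hlog : 0 ≤ Real.logb 2 N := Real.logb_nonneg (by norm_num) hN'
  set L := ⌊(N : ℝ) - c * Real.logb 2 N⌋₊
  have h₁ : (N : ℝ) ≤ (L + 1 : ℕ) + ⌈c⌉₊ * Real.logb 2 N := by
    have h₁ := (Nat.lt_floor_add_one ((N : ℝ) - c * Real.logb 2 N)).le
    have h₂ := mul_le_mul_of_nonneg_right (Nat.le_ceil c) hlog
    push_cast
    linarith
  have h₂ : (2 : ℝ) ^ (N : ℝ) ≤ 2 ^ (((L + 1 : ℕ) : ℝ) + ⌈c⌉₊ * Real.logb 2 N) :=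
    Real.rpow_le_rpow_of_exponent_le (by norm_num) h₁
  have h₃ : (2 : ℝ) ^ (⌈c⌉₊ * Real.logb 2 N) = (N : ℝ) ^ ⌈c⌉₊ := by
    rw [mul_comm, Real.rpow_mul (by norm_num), Real.rpow_logb (by norm_num) (by norm_num)
      (by positivity), Real.rpow_natCast]
  rw [Real.rpow_add (by norm_num), h₃, Real.rpow_natCast, Real.rpow_natCast] at h₂
  have h₄ : 2 ^ N ≤ 2 ^ (L + 1) * N ^ ⌈c⌉₊ := by exact_mod_cast h₂
  calc 2 ^ N ≤ 2 ^ (L + 1) * N ^ ⌈c⌉₊ := h₄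
    _ = 2 * N ^ ⌈c⌉₊ * 2 ^ L := by ring
    _ ≤ 2 * N ^ ⌈c⌉₊ * s := by gcongr

/-- If good advice is dense, then a random string yields the right answer, given suitable
tests. -/
theorem exists_advice (M : Machine) (δ : List Bool → Bool) (T n N Q m : ℕ)
    (hQ : 2 ^ N ≤ Q * (goodAdvice M δ T n N).card) (hm : 8 * Q * (N + 1) ≤ m) :
    ∃ adv : List Bool, adv.length ≤ 3 * (Nat.log 2 Q + 1) * (n + 1) ∧
      ∀ x : List Bool, x.length = n →
        2 / 3 ≤ prob m {r | bppAnswer M x adv n N T (List.ofFn r) = δ x} := by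
  classical
  set S := goodAdvice M δ T n N with hS
  obtain ⟨q, hq, hX, h⟩ := exists_tests (strings N) S {x : List Bool | x.length = n}
    (fun x a => M.result T [x, a] = δ x) (Finset.filter_subset _ _)
    (fun a ha => errs_eq_false.1 (Finset.mem_filter.1 ha).2) (3 * (Nat.log 2 Q + 1)) (by
      -- Density forces a good string to exist, which makes the inequality strict.
      have hS₀ : 0 < S.card := by
        by_contra h0
        have : S.card = 0 := by omega
        rw [this, mul_zero] at hQ
        exact absurd hQ (by simp)
      calc 3 ^ (3 * (Nat.log 2 Q + 1)) * (strings N).card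
          ≤ 3 ^ (3 * (Nat.log 2 Q + 1)) * (Q * S.card) := by
            rw [card_strings]; exact Nat.mul_le_mul_left _ hQ
        _ = 3 ^ (3 * (Nat.log 2 Q + 1)) * Q * S.card := by ring
        _ < _ := Nat.mul_lt_mul_of_pos_right (three_pow_mul_lt_four_pow Q) hS₀)
  have hf : ∀ a, fails M T n (testAdvice δ q) a = false ↔ ∀ y ∈ q, M.result T [y, a] = δ y := by
    intro a
    rw [fails_testAdvice M δ T a hX]
    simp only [List.any_eq_false, bne_iff_ne, ne_eq, not_not]
    exact forall₂_congr fun _ _ => eq_comm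
  refine ⟨testAdvice δ q, ?_, fun x hx => ?_⟩
  · rw [length_testAdvice δ hX]
    exact Nat.mul_le_mul_right _ hq
  set C := (strings N).filter fun a => fails M T n (testAdvice δ q) a = false with hC
  have hSC : S.card ≤ C.card := Finset.card_le_card fun a ha => by
    rw [hS, goodAdvice, Finset.mem_filter, errs_eq_false] at ha
    exact Finset.mem_filter.2 ⟨ha.1, (hf a).2 fun y hy => ha.2 y (hX y hy)⟩
  have hC₂ : (2 : ℝ) ^ N ≤ Q * C.card := by
    exact_mod_cast hQ.trans (Nat.mul_le_mul_left _ hSC)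
  obtain ⟨e, rfl⟩ := Nat.exists_eq_add_of_le hm
  have hx' := h x hx
  simp only [← hf] at hx'
  have herr := expect_error_le M T n N (testAdvice δ q) x (δ x) (g := C.card / 2 ^ N)
    (by field_simp; rw [hC]) hx' (8 * Q) e
  rw [prob_ofFn _ fun r => bppAnswer M x (testAdvice δ q) n N T r = δ x]
  -- The survivors contain the good strings, so their density is at least 1 / Q. With 8 Q blocks the
  -- error is at most 1/4 + (3/4) / 9 = 1/3.
  have hg : 8 ≤ (C.card / 2 ^ N : ℝ) * (8 * Q : ℕ) := by
    rw [div_mul_eq_mul_div, le_div_iff₀ (by positivity)]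
    push_cast
    linarith
  have : 3 / 4 / (1 + (C.card / 2 ^ N : ℝ) * (8 * Q : ℕ)) ≤ 1 / 12 := by
    rw [div_le_iff₀ (by linarith)]
    linarith
  linarith

/-- The logarithm of a polynomial is O(log n). From n = 2 on, constants are absorbed into multiples
of log n, and log (n + 1) ≤ 2 log n because n + 1 ≤ n ^ 2. -/
theorem isBigO_log_mul {Q : ℕ → ℕ} (hQ : PolyB Q) :
    (fun n => ((3 * (Nat.log 2 (Q n) + 1) * (n + 1) : ℕ) : ℝ)) =O[atTop]
      fun n : ℕ => (n : ℝ) * Real.log n := by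
  obtain ⟨C, k, hC⟩ := hQ
  have hlog2 : 0 < Real.log 2 := Real.log_pos (by norm_num)
  set B : ℝ :=
    6 * ((Real.log (C + 1) / Real.log 2 + 2 * k) / Real.log 2 + 1 / Real.log 2) with hB
  refine IsBigO.of_bound B ?_
  filter_upwards [eventually_ge_atTop 2] with n hn
  have hn' : (2 : ℝ) ≤ n := by exact_mod_cast hn
  have hln : Real.log 2 ≤ Real.log n := Real.log_le_log (by norm_num) hn'
  have hln0 : 0 < Real.log n := hlog2.trans_le hln
  have hC1 : 0 ≤ Real.log (C + 1) := Real.log_nonneg (by simp)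
  have h₁ : (Nat.log 2 (Q n) : ℝ) * Real.log 2 ≤ Real.log (C + 1) + k * Real.log (n + 1) := by
    rw [← Real.log_pow, ← Real.log_pow, ← Real.log_mul (by positivity) (by positivity)]
    refine Real.log_le_log (by positivity) ?_
    rcases Nat.eq_zero_or_pos (Q n) with h | h
    · rw [h]
      simp only [Nat.log_zero_right, pow_zero]
      exact one_le_mul_of_one_le_of_one_le (by simp) (one_le_pow₀ (by simp))
    · have h' : 2 ^ Nat.log 2 (Q n) ≤ (C + 1) * (n + 1) ^ k :=
        (Nat.pow_log_le_self 2 h.ne').trans ((hC n).trans (by gcongr; omega))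
      exact_mod_cast h'
  have h₂ : Real.log (n + 1) ≤ 2 * Real.log n := by
    rw [← Nat.cast_two, ← Real.log_pow]
    exact Real.log_le_log (by positivity) (by nlinarith)
  have h₃ : Real.log (C + 1) ≤ Real.log (C + 1) / Real.log 2 * Real.log n := by
    rw [div_mul_eq_mul_div, le_div_iff₀ hlog2]
    gcongr
  have h₄ : (Nat.log 2 (Q n) : ℝ) + 1 ≤
      ((Real.log (C + 1) / Real.log 2 + 2 * k) / Real.log 2 + 1 / Real.log 2) *
        Real.log n := by
    have h₅ : (Nat.log 2 (Q n) : ℝ) ≤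
        (Real.log (C + 1) / Real.log 2 + 2 * k) / Real.log 2 * Real.log n := by
      rw [div_mul_eq_mul_div, le_div_iff₀ hlog2]
      have := mul_le_mul_of_nonneg_left h₂ (Nat.cast_nonneg (α := ℝ) k)
      linarith
    have h₆ : 1 ≤ 1 / Real.log 2 * Real.log n := by
      rw [div_mul_eq_mul_div, le_div_iff₀ hlog2]
      linarith
    linarith
  rw [Real.norm_of_nonneg (by positivity), Real.norm_of_nonneg (by positivity)]
  push_cast
  have h₅ : (n : ℝ) + 1 ≤ 2 * n := by linarith
  calc 3 * ((Nat.log 2 (Q n) : ℝ) + 1) * (n + 1)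
      ≤ 3 * (((Real.log (C + 1) / Real.log 2 + 2 * k) / Real.log 2 +
        1 / Real.log 2) * Real.log n) * (2 * n) := by gcongr
    _ = B * (n * Real.log n) := by rw [hB]; ring

end AdviceComplexity

open AdviceComplexity Filter Asymptotics in
theorem mainTheorem5 (α : ℕ → List Bool) (hα : ∀ n : ℕ, (α n).length = n)
    (c : ℝ) (hc : 0 < c)
    (hard : α ∉ AdviceComplexity.InfinitelyOften
      (AdviceComplexity.FunEXPAdviceLength fun n : ℕ => ⌊(n : ℝ) - c * Real.logb 2 n⌋₊))
    (A : Language Bool) (hA : A ∈ AdviceComplexity.EXP)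
    (hP : ∃ d : ℕ, 0 < d ∧ A ∈ AdviceComplexity.PAdvice fun n : ℕ => α (n ^ d)) :
    A ∈ AdviceComplexity.BPPAdviceBigONLogN := by
  classical
  obtain ⟨D, kD, hD⟩ := hA
  obtain ⟨d, hd, M, k, hM⟩ := hP
  set δ : List Bool → Bool := fun x => decide (x ∈ A) with hδ
  have hans : ∀ x, answer A x = [δ x] := fun x => by simp [answer, hδ]
  have hg : ∀ n, errs M δ (polyBound k n) n (α (n ^ d)) = false := fun n =>
    errs_eq_false.2 fun x hx => by
      have := hM x
      rw [hans, hx] at this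
      exact this.result_eq
  -- This is the only use of hardness: its failure infinitely often would make `α` infinitely often
  -- computable from short advice.
  have hev : ∀ᶠ n : ℕ in atTop, 2 ^ ⌊((n ^ d : ℕ) : ℝ) - c * Real.logb 2 (n ^ d : ℕ)⌋₊ <
      (goodAdvice M δ (polyBound k n) n (n ^ d)).card := by
    by_contra hcon
    rw [not_eventually] at hcon
    refine hard (infinitelyOften_of_card_goodAdvice_le hα (fun N => ?_) M D
      (t := fun n => 2 ^ polyBound kD n) (ExpB.two_pow (PolyB.id.polyBound kD))
      (fun a b h => Nat.pow_le_pow_right (by norm_num) (polyBound_mono kD h))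
      (fun x => hans x ▸ hD x) hd k hg (hcon.mono fun n hn => not_lt.1 hn))
    refine Nat.floor_le_of_le ?_
    have : 0 ≤ Real.logb 2 N := by
      rcases Nat.eq_zero_or_pos N with rfl | h
      · simp
      · exact Real.logb_nonneg (by norm_num) (by exact_mod_cast h)
    nlinarith
  obtain ⟨n₀, hn₀⟩ := eventually_atTop.1 hev
  -- The first summand is the inverse density beyond n₀. The constant one serves n ≤ n₀, where all
  -- that is known is that `α (n ^ d)` is good, so that there is at least one good string.
  set Q : ℕ → ℕ := fun n => 2 * (n ^ d) ^ ⌈c⌉₊ + 2 ^ (n₀ ^ d) with hQ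
  have hQp : PolyB Q :=
    ((PolyB.const 2).mul ((PolyB.id.pow d).pow _)).add (PolyB.const _)
  have hdense : ∀ n, 2 ^ (n ^ d) ≤ Q n * (goodAdvice M δ (polyBound k n) n (n ^ d)).card := by
    intro n
    rw [hQ, add_mul]
    rcases Nat.lt_or_ge n₀ n with h | h
    · exact (two_pow_le_of_lt c (Nat.pow_pos (by omega)) (hn₀ n h.le)).trans (Nat.le_add_right _ _)
    · have h₁ : 0 < (goodAdvice M δ (polyBound k n) n (n ^ d)).card :=
        Finset.card_pos.2 ⟨α (n ^ d), Finset.mem_filter.2 ⟨by simp [hα], hg n⟩⟩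
      have h₂ : 2 ^ (n ^ d) ≤ 2 ^ (n₀ ^ d) :=
        Nat.pow_le_pow_right (by norm_num) (Nat.pow_le_pow_left h d)
      exact (h₂.trans (Nat.le_mul_of_pos_right _ h₁)).trans (Nat.le_add_left _ _)
  -- The random string has to hold 8 Q blocks of N + 1 bits; left-over bits are allowed.
  obtain ⟨m, hm⟩ := (((PolyB.const 8).mul hQp).mul
    ((PolyB.id.pow d).add (PolyB.const 1))).le_polyBound
  choose β hβ₁ hβ₂ using fun n => exists_advice M δ (polyBound k n) n (n ^ d) (Q n)
    (polyBound m n) (hdense n) (hm m le_rfl n)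
  have hℓ : PolyB fun n => 3 * (Nat.log 2 (Q n) + 1) * (n + 1) :=
    (((PolyB.const 3).mul ((hQp.mono fun n => Nat.log_le_self 2 (Q n)).add
      (PolyB.const 1))).mul (PolyB.id.add (PolyB.const 1)))
  obtain ⟨K, hK⟩ := (polyB_bppTime M d k hℓ (PolyB.id.polyBound m)).le_polyBound
  have hout : ∀ x : List Bool, ∀ r : Fin (polyBound m x.length) → Bool,
      OutputsWithin ((bppProg M d k).machine .ans) [x, β x.length, List.ofFn r]
        [bppAnswer M x (β x.length) x.length (x.length ^ d) (polyBound k x.length) (List.ofFn r)]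
        (polyBound K x.length) := fun x r =>
    (outputsWithin_bpp M x (β x.length) x.length d k rfl (List.ofFn r)).mono
      (by
        rw [List.length_ofFn]
        exact (M.bppTime_mono d k _ (hβ₁ _)).trans (hK K le_rfl _))
  refine ⟨fun n => 3 * (Nat.log 2 (Q n) + 1) * (n + 1), isBigO_log_mul hQp, β, hβ₁,
    (bppProg M d k).machine .ans, K, m, fun x => ⟨fun r => ⟨_, hout x r⟩, ?_⟩⟩
  refine (hβ₂ x.length x rfl).trans ?_
  unfold prob
  refine div_le_div_of_nonneg_right (Nat.cast_le.2 (Set.ncard_le_ncard (fun r hr => ?_)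
    (Set.toFinite _))) (by positivity)
  have := hout x r
  -- Random strings with the right answer all belong to the event in the definition of BPP, since
  -- the machine outputs this answer in time.
  rw [show bppAnswer M x _ _ _ _ _ = δ x from hr, ← hans] at this
  exact this
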